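/- **Model.** Let $h$ be a real random variable whose law $\mu$ is symmetric about $0$, let $\theta>0$, and let $S_0\subset[n]$ with $|S_0|=k$. Under the alternative $\mathbb P_{S_0}$ one observes $m$ independent copies $\sigma^{(1)},\dots,\sigma^{(m)}$ of a random $\sigma\in\{-1,1\}^n$: the (unobserved) fields $h_1,\dots,h_n$ are i.i.d. with law $\mu$ (fresh for each copy) and, given them, $$\mathbb P_{S_0}(\sigma\mid h)\ \propto\ \exp\Big(\frac{\theta}{2k}\Big(\sum_{i\in S_0}\sigma_i\Big)^2+\sum_{i=1}^n h_i\sigma_i\Big).$$ Under the null hypothesis $\mathbb P_0$ the quadratic term is absent. For $S\subset[n]$ with $|S|=k$ let $W_S=\frac1k\sum_{i,j\in S}\sigma_i\sigma_j$ (diagonal terms included) and $\phi_S=\frac1k\big(\frac1m\sum_{l=1}^m(\sum_{i\in S}\sigma^{(l)}_i)^2-k\big)$. For a threshold $\tau$, the *local (scan) test* rejects $\mathbb P_0$ if $\max_{|S|=k}\phi_S\ge\tau$, and the *global test* rejects $\mathbb P_0$ if $\frac1k\big(\frac1m\sum_{l=1}^m(\sum_{i=1}^n\sigma^{(l)}_i)^2-n\big)\ge\tau$;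 the *combined test* is the local test if $k<n^{2/3}$ and the global test if $k\ge n^{2/3}$. The risk of a test against $S_0$ is the sum of its Type I error under $\mathbb P_0$ and its Type II error under $\mathbb P_{S_0}$. Put $q=\mathbb E[\operatorname{sech}^2 h]$ and $V=\dfrac{1-\theta q^2}{(1-\theta q)^2}$. We say that a threshold $\tau$ is *good* if the following three statements hold. * (Local.) There is $C>0$ such that for every $\delta>0$ there is $K$ such that for all $n,m$ and all $S_0\subset[n]$ with $K\le k=|S_0|\le n/2$ and $m\ge C\,k\log(n/k)$, the risk of the local test is at most $\delta$. * (Global.) For every $\delta>0$ there are $C>0$ and $K$ such that for all $n,m$ and all $S_0\subset[n]$ with $k=|S_0|\ge K$ and $m\ge C\,n^2/k^2$, the risk of the global test is at most $\delta$. * (Combined.) For every $\delta>0$ there are $C>0$ and $K$ such that for all $n,m$ and all $S_0\subset[n]$ with $k=|S_0|\ge K$, and with $m\ge C\,k\log(n/k)$ if $k<n^{2/3}$ and $m\ge C\,n^2/k^2$ if $k\ge n^{2/3}$, the risk of the combined test is at most $\delta$. **Theorem.** Assume $0<\theta<1/\mathbb E[\operatorname{sech}^2h]$. Then $V>1$,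 and there is a good threshold $\tau>0$. If moreover $0$ is the unique global minimizer of the mean-field free energy $x\mapsto\frac{x^2}{2}-\mathbb E\big[\log\cosh(\sqrt\theta x+h)-\log\cosh h\big]$, then $$\mathbb E_{S_0}[W_{S_0}]\longrightarrow V=\frac{1-\theta\,\mathbb E[\operatorname{sech}^2h]^2}{(1-\theta\,\mathbb E[\operatorname{sech}^2h])^2}\qquad(k=|S_0|\to\infty),$$ and every $\tau\in(0,V-1)$ is a good threshold. -/

import Mathlib

open MeasureTheory Filter Topology

noncomputable section

namespace PlantedRFCW

/-- A configuration of `n` Ising spins; `true` stands for `+1` and `false` for `-1`. -/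
abbrev Config (n : ℕ) : Type := Fin n → Bool

/-- The numerical value of a spin. -/
def spin (b : Bool) : ℝ := if b then 1 else -1

/-- The sum of the spins with index in `S`. -/
def spinSum {n : ℕ} (S : Finset (Fin n)) (σ : Config n) : ℝ := ∑ i ∈ S, spin (σ i)

/-- The unnormalized Gibbs weight
`exp (θ / (2 |S|) * (∑_{i ∈ S} σ_i)^2 + ∑_i h_i σ_i)`. -/
def weight {n : ℕ} (θ : ℝ) (S : Finset (Fin n)) (h : Fin n → ℝ) (σ : Config n) : ℝ :=
  Real.exp (θ / (2 * (S.card : ℝ)) * spinSum S σ ^ 2 + ∑ i, h i * spin (σ i))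

/-- The Gibbs probability of `σ` given the field `h`. -/
def gibbs {n : ℕ} (θ : ℝ) (S : Finset (Fin n)) (h : Fin n → ℝ) (σ : Config n) : ℝ :=
  weight θ S h σ / ∑ σ' : Config n, weight θ S h σ'

/-- The law of one observed configuration: the fields `h_i` are i.i.d. with law `μ` and are not
observed, and given them the spins follow the Gibbs measure with clique `S`. -/
def plantedLaw {n : ℕ} (μ : Measure ℝ) (θ : ℝ) (S : Finset (Fin n)) : Measure (Config n) :=
  ∑ σ : Config n,
    ENNReal.ofReal (∫ h : Fin n → ℝ, gibbs θ S h σ ∂(Measure.pi fun _ => μ)) • Measure.dirac σ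

/-- The law of one configuration under the null hypothesis (no interaction): given `h`, the
weight is `exp (∑_i h_i σ_i)`. -/
def nullLaw (n : ℕ) (μ : Measure ℝ) : Measure (Config n) := plantedLaw μ 0 ∅

/-- Type I error plus Type II error, against the clique `S₀`, of the test based on `m` i.i.d.
configurations that rejects the null hypothesis on the set `R`. -/
def risk {n : ℕ} (μ : Measure ℝ) (θ : ℝ) (S₀ : Finset (Fin n)) (m : ℕ)
    (R : Set (Fin m → Config n)) : ℝ :=
  (Measure.pi fun _ : Fin m => nullLaw n μ).real R +
    (Measure.pi fun _ : Fin m => plantedLaw μ θ S₀).real Rᶜ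

/-- `W_S = (1 / |S|) ∑_{i, j ∈ S} σ_i σ_j`, the diagonal terms being included. -/
def pairStat {n : ℕ} (S : Finset (Fin n)) (σ : Config n) : ℝ :=
  (1 / (S.card : ℝ)) * ∑ i ∈ S, ∑ j ∈ S, spin (σ i) * spin (σ j)

/-- `φ_S = (1 / k) (1_Sᵀ Ê[σ σᵀ] 1_S - k)`, with `k = |S|` and `Ê` the average over the `m`
configurations. -/
def localStat {n m : ℕ} (S : Finset (Fin n)) (x : Fin m → Config n) : ℝ :=
  (1 / (S.card : ℝ)) *
    ((∑ i ∈ S, ∑ j ∈ S, (1 / (m : ℝ)) * ∑ l, spin (x l i) * spin (x l j)) - (S.card : ℝ))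

/-- The scan statistic: the maximum of `φ_S` over all `S` with `|S| = k`. -/
def scanStat {n m : ℕ} (k : ℕ) (x : Fin m → Config n) : ℝ :=
  ⨆ S : {S : Finset (Fin n) // S.card = k}, localStat S.1 x

/-- The global statistic `(1 / k) ((1 / m) ∑_l (∑_i σ_i^{(l)})^2 - n)`. -/
def globalStat {n m : ℕ} (k : ℕ) (x : Fin m → Config n) : ℝ :=
  (1 / (k : ℝ)) * ((1 / (m : ℝ)) * (∑ l, spinSum Finset.univ (x l) ^ 2) - (n : ℝ))

/-- Rejection region of the local (scan) test. -/
def scanTest (n m k : ℕ) (τ : ℝ) : Set (Fin m → Config n) := {x | τ ≤ scanStat k x}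

/-- Rejection region of the global test. -/
def globalTest (n m k : ℕ) (τ : ℝ) : Set (Fin m → Config n) := {x | τ ≤ globalStat k x}

/-- The two tests together: the local test if `k < n ^ (2 / 3)`, and otherwise the global one. -/
def combinedTest (n m k : ℕ) (τ : ℝ) : Set (Fin m → Config n) :=
  if k ^ 3 < n ^ 2 then scanTest n m k τ else globalTest n m k τ

/-- `k log (n / k)`. -/
def localRate (n k : ℕ) : ℝ := (k : ℝ) * Real.log ((n : ℝ) / (k : ℝ))

/-- `n ^ 2 / k ^ 2`. -/
def globalRate (n k : ℕ) : ℝ := (n : ℝ) ^ 2 / (k : ℝ) ^ 2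

/-- For `k ≤ n / 2`, the local test with threshold `τ` has vanishing risk as `k → ∞`, uniformly
in `n`, in the clique and in `m ≥ C k log (n / k)`. -/
def ScanTestSucceeds (μ : Measure ℝ) (θ τ : ℝ) : Prop :=
  ∃ C : ℝ, 0 < C ∧ ∀ δ : ℝ, 0 < δ → ∃ K : ℕ, ∀ (n m : ℕ) (S₀ : Finset (Fin n)),
    K ≤ S₀.card → 2 * S₀.card ≤ n → C * localRate n S₀.card ≤ (m : ℝ) →
      risk μ θ S₀ m (scanTest n m S₀.card τ) ≤ δ

/-- For every `δ`, the global test with threshold `τ` has risk at most `δ` if `k` is large and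
`m ≥ C n ^ 2 / k ^ 2`, with `C = C (δ)`. -/
def GlobalTestSucceeds (μ : Measure ℝ) (θ τ : ℝ) : Prop :=
  ∀ δ : ℝ, 0 < δ → ∃ C : ℝ, 0 < C ∧ ∃ K : ℕ, ∀ (n m : ℕ) (S₀ : Finset (Fin n)),
    K ≤ S₀.card → C * globalRate n S₀.card ≤ (m : ℝ) →
      risk μ θ S₀ m (globalTest n m S₀.card τ) ≤ δ

/-- The two tests together succeed with `m ≥ C k log (n / k)` samples if `k < n ^ (2 / 3)` and
`m ≥ C n ^ 2 / k ^ 2` samples otherwise. -/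
def CombinedTestSucceeds (μ : Measure ℝ) (θ τ : ℝ) : Prop :=
  ∀ δ : ℝ, 0 < δ → ∃ C : ℝ, 0 < C ∧ ∃ K : ℕ, ∀ (n m : ℕ) (S₀ : Finset (Fin n)),
    K ≤ S₀.card →
    C * (if S₀.card ^ 3 < n ^ 2 then localRate n S₀.card else globalRate n S₀.card) ≤ (m : ℝ) →
      risk μ θ S₀ m (combinedTest n m S₀.card τ) ≤ δ

/-- `E[sech²(h)]` for `h` with law `μ`. -/
def meanSechSq (μ : Measure ℝ) : ℝ := ∫ h, 1 / Real.cosh h ^ 2 ∂μ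

/-- `(1 - θ E[sech²(h)]²) / (1 - θ E[sech²(h)])²`. -/
def limitSecondMoment (μ : Measure ℝ) (θ : ℝ) : ℝ :=
  (1 - θ * meanSechSq μ ^ 2) / (1 - θ * meanSechSq μ) ^ 2

/-- The mean-field free energy `x² / 2 - E[log cosh (√θ x + h)]`, normalized to vanish at `x = 0`.
The normalized integrand is bounded for each `x`, so that no moment of `h` is needed. -/
def freeEnergy (μ : Measure ℝ) (θ x : ℝ) : ℝ :=
  x ^ 2 / 2 - ∫ h, (Real.log (Real.cosh (Real.sqrt θ * x + h)) - Real.log (Real.cosh h)) ∂μ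

/-- The point `0` is the only global minimizer of the mean-field free energy. -/
def ZeroUniqueMinimizer (μ : Measure ℝ) (θ : ℝ) : Prop :=
  ∀ x : ℝ, x ≠ 0 → freeEnergy μ θ 0 < freeEnergy μ θ x

end PlantedRFCW

end

noncomputable section

namespace PlantedRFCW

/-! ### Gibbs averages -/

/-! Write k = |S₀|, M for the spin sum over S₀, W = M²/k and q = E[sech² h]. The proof computes the
limit of E[W], turns a truncated lower bound on W into guarantees for the tests, and removes the
free-energy assumption by monotonicity in θ.

Limit of E[W]. The identity exp(a²/2) = E[exp(a Y)], Y standard Gaussian, linearizes the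
interaction. Given the field, the spins are summed out and there remains a real variable y with
density proportional to exp(-y²/2 + L(y)), where L(y) = ∑_{i ∈ S₀} (log cosh(h_i + s y) - log cosh
h_i) and s = √(θ/k). Its second moment is the Gibbs average of 1 + θW. Integration by parts gives
E[y] = E[L'(y)] and E[y²] = 1 + E[y L'(y)], while L'(y) ≈ √θ ξ + θ q y with ξ = k^(-1/2) ∑_{i ∈ S₀}
tanh h_i. Eliminating E[y] yields (1 - θq)² E[y²] ≈ (1 - θq) + θ ξ² (`abs_secondMoment_sub_le`).
Averaging over the field, where E[ξ²] = 1 - q, gives V.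

The errors are O(k^(-1/2)) once the fourth moment of y is bounded uniformly
(`exists_integral_fourthMoment_le`). For a typical field it is: for |y| at most a small multiple of
√k the slope θq < 1 makes the integration by parts contractive, and beyond that the unique minimizer
gives Gaussian decay (`exists_net_fieldTilt_le`). Atypical fields have exponentially small
probability, against a crude bound polynomial in k.

Tests. Since μ is symmetric, spins outside the clique are independent fair signs, independent of the
spins inside; in particular all spins are fair signs under the null. Type I errors follow from a
Chernoff bound for squared sums of signs, with a union bound over k-sets for the scan. For Type II
errors only `TruncatedMeanExceeds` is needed: truncation allows a lower-tail Chernoff bound. In the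
global statistic the cross term 2MN, with N the outside sum, is integrated out exactly and absorbed
into W, and N² is treated separately.

Removing the free-energy assumption. A nondecreasing function of W has a Gibbs mean nondecreasing in
θ (`gibbsAvg_mono_theta`), so the truncated bound passes from a smaller θ' to θ. If θ' < 1 then 0 is
automatically the unique minimizer (`zeroUniqueMinimizer_of_lt_one`), and V(θ') > 1 leaves room for
a positive threshold. -/

/-- The average of `f` under the Gibbs measure with field `h`. -/
def gibbsAvg {n : ℕ} (θ : ℝ) (S : Finset (Fin n)) (h : Fin n → ℝ) (f : Config n → ℝ) : ℝ :=
  ∑ σ, gibbs θ S h σ * f σ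

theorem spin_sq (b : Bool) : spin b ^ 2 = 1 := by
  cases b <;> simp [spin]

theorem spin_not (b : Bool) : spin (!b) = -spin b := by
  cases b <;> simp [spin]

theorem abs_spin (b : Bool) : |spin b| = 1 := by
  cases b <;> simp [spin]

theorem weight_pos {n : ℕ} (θ : ℝ) (S : Finset (Fin n)) (h : Fin n → ℝ) (σ : Config n) :
    0 < weight θ S h σ := Real.exp_pos _

theorem partition_pos {n : ℕ} (θ : ℝ) (S : Finset (Fin n)) (h : Fin n → ℝ) :
    0 < ∑ σ : Config n, weight θ S h σ :=
  Finset.sum_pos (fun σ _ => weight_pos θ S h σ) Finset.univ_nonempty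

theorem gibbs_nonneg {n : ℕ} (θ : ℝ) (S : Finset (Fin n)) (h : Fin n → ℝ) (σ : Config n) :
    0 ≤ gibbs θ S h σ :=
  div_nonneg (weight_pos θ S h σ).le (partition_pos θ S h).le

theorem sum_gibbs {n : ℕ} (θ : ℝ) (S : Finset (Fin n)) (h : Fin n → ℝ) :
    ∑ σ, gibbs θ S h σ = 1 := by
  unfold gibbs
  rw [← Finset.sum_div, div_self (partition_pos θ S h).ne']

theorem gibbs_le_one {n : ℕ} (θ : ℝ) (S : Finset (Fin n)) (h : Fin n → ℝ) (σ : Config n) :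
    gibbs θ S h σ ≤ 1 := by
  rw [← sum_gibbs θ S h]
  exact Finset.single_le_sum (fun τ _ => gibbs_nonneg θ S h τ) (Finset.mem_univ σ)

theorem continuous_gibbs {n : ℕ} (θ : ℝ) (S : Finset (Fin n)) (σ : Config n) :
    Continuous fun h : Fin n → ℝ => gibbs θ S h σ := by
  have hw : ∀ τ : Config n, Continuous fun h : Fin n → ℝ => weight θ S h τ := by
    intro τ
    unfold weight
    fun_prop
  exact (hw σ).div (continuous_finsetSum _ fun τ _ => hw τ) fun h => (partition_pos θ S h).ne'

theorem continuous_gibbsAvg {n : ℕ} (θ : ℝ) (S : Finset (Fin n)) (f : Config n → ℝ) :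
    Continuous fun h : Fin n → ℝ => gibbsAvg θ S h f :=
  continuous_finsetSum _ fun σ _ => (continuous_gibbs θ S σ).mul continuous_const

theorem gibbsAvg_mono {n : ℕ} (θ : ℝ) (S : Finset (Fin n)) (h : Fin n → ℝ)
    {f g : Config n → ℝ} (hfg : ∀ σ, f σ ≤ g σ) : gibbsAvg θ S h f ≤ gibbsAvg θ S h g :=
  Finset.sum_le_sum fun σ _ => mul_le_mul_of_nonneg_left (hfg σ) (gibbs_nonneg θ S h σ)

theorem gibbsAvg_const {n : ℕ} (θ : ℝ) (S : Finset (Fin n)) (h : Fin n → ℝ) (c : ℝ) :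
    gibbsAvg θ S h (fun _ => c) = c := by
  unfold gibbsAvg
  rw [← Finset.sum_mul, sum_gibbs, one_mul]

theorem gibbsAvg_eq_div {n : ℕ} (θ : ℝ) (S : Finset (Fin n)) (h : Fin n → ℝ)
    (f : Config n → ℝ) :
    gibbsAvg θ S h f = (∑ σ, weight θ S h σ * f σ) / ∑ σ, weight θ S h σ := by
  unfold gibbsAvg gibbs
  rw [Finset.sum_div]
  exact Finset.sum_congr rfl fun σ _ => by ring

theorem integrable_gibbs {n : ℕ} (μ : Measure ℝ) [IsProbabilityMeasure μ] (θ : ℝ)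
    (S : Finset (Fin n)) (σ : Config n) :
    Integrable (fun h => gibbs θ S h σ) (Measure.pi fun _ : Fin n => μ) :=
  Integrable.of_bound (continuous_gibbs θ S σ).aestronglyMeasurable 1
    (ae_of_all _ fun h => by
      rw [Real.norm_of_nonneg (gibbs_nonneg θ S h σ)]; exact gibbs_le_one θ S h σ)

theorem integrable_gibbsAvg {n : ℕ} (μ : Measure ℝ) [IsProbabilityMeasure μ] (θ : ℝ)
    (S : Finset (Fin n)) (f : Config n → ℝ) :
    Integrable (fun h => gibbsAvg θ S h f) (Measure.pi fun _ : Fin n => μ) :=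
  integrable_finsetSum _ fun σ _ => (integrable_gibbs μ θ S σ).mul_const _

theorem integral_plantedLaw {n : ℕ} (μ : Measure ℝ) [IsProbabilityMeasure μ] (θ : ℝ)
    (S : Finset (Fin n)) (f : Config n → ℝ) :
    ∫ σ, f σ ∂(plantedLaw μ θ S) =
      ∫ h, gibbsAvg θ S h f ∂(Measure.pi fun _ : Fin n => μ) := by
  unfold plantedLaw gibbsAvg
  rw [integral_finsetSum_measure, integral_finsetSum]
  · refine Finset.sum_congr rfl fun σ _ => ?_
    rw [integral_smul_measure, integral_dirac, integral_mul_const,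
      ENNReal.toReal_ofReal (integral_nonneg fun h => gibbs_nonneg θ S h σ), smul_eq_mul]
  · exact fun σ _ => (integrable_gibbs μ θ S σ).mul_const _
  · exact fun σ _ => ((integrable_dirac (by simp)).smul_measure ENNReal.ofReal_ne_top)

instance isProbabilityMeasure_plantedLaw {n : ℕ} (μ : Measure ℝ) [IsProbabilityMeasure μ]
    (θ : ℝ) (S : Finset (Fin n)) : IsProbabilityMeasure (plantedLaw μ θ S) := by
  constructor
  have h1 : ∑ σ : Config n, ∫ h, gibbs θ S h σ ∂(Measure.pi fun _ : Fin n => μ) = 1 := by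
    rw [← integral_finsetSum _ fun σ _ => integrable_gibbs μ θ S σ]
    simp [sum_gibbs]
  unfold plantedLaw
  simp only [Measure.coe_finsetSum, Finset.sum_apply, Measure.smul_apply, measure_univ,
    smul_eq_mul, mul_one]
  rw [← ENNReal.ofReal_sum_of_nonneg fun σ _ => integral_nonneg fun h => gibbs_nonneg θ S h σ,
    h1, ENNReal.ofReal_one]

instance isProbabilityMeasure_nullLaw (n : ℕ) (μ : Measure ℝ) [IsProbabilityMeasure μ] :
    IsProbabilityMeasure (nullLaw n μ) := isProbabilityMeasure_plantedLaw μ 0 ∅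

theorem integrable_config {n : ℕ} (P : Measure (Config n)) [IsFiniteMeasure P]
    (f : Config n → ℝ) : Integrable f P := Integrable.of_finite

/-! ### Flipping a spin outside of the clique -/

/-- The configuration with the spin at `j` reversed. -/
def flip {n : ℕ} (j : Fin n) (σ : Config n) : Config n := Function.update σ j (!σ j)

theorem flip_flip {n : ℕ} (j : Fin n) (σ : Config n) : flip j (flip j σ) = σ := by
  ext i
  by_cases hi : i = j
  · subst hi; simp [flip]
  · simp [flip, hi]

theorem spinSum_flip_of_notMem {n : ℕ} {j : Fin n} {S : Finset (Fin n)} (hj : j ∉ S)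
    (σ : Config n) : spinSum S (flip j σ) = spinSum S σ := by
  unfold spinSum
  refine Finset.sum_congr rfl fun i hi => ?_
  have : i ≠ j := fun h => hj (h ▸ hi)
  simp [flip, this]

/-- The field with the value at `j` reversed. -/
def negAt {n : ℕ} (j : Fin n) (h : Fin n → ℝ) : Fin n → ℝ := fun i => if i = j then -h i else h i

theorem weight_flip {n : ℕ} {j : Fin n} {S : Finset (Fin n)} (hj : j ∉ S) (θ : ℝ)
    (h : Fin n → ℝ) (σ : Config n) : weight θ S h (flip j σ) = weight θ S (negAt j h) σ := by
  unfold weight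
  rw [spinSum_flip_of_notMem hj]
  congr 2
  refine Finset.sum_congr rfl fun i _ => ?_
  by_cases hi : i = j
  · subst hi; simp [flip, negAt, spin_not]
  · simp [flip, negAt, hi]

theorem sum_flip {n : ℕ} (j : Fin n) (f : Config n → ℝ) : ∑ σ, f (flip j σ) = ∑ σ, f σ :=
  Equiv.sum_comp (Function.Involutive.toPerm (flip j) (flip_flip j)) f

/-- The quadratic term does not see a spin outside S, so reversing it is the same as reversing its
field. -/
theorem gibbsAvg_flip {n : ℕ} {j : Fin n} {S : Finset (Fin n)} (hj : j ∉ S) (θ : ℝ)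
    (h : Fin n → ℝ) (f : Config n → ℝ) :
    gibbsAvg θ S h (fun σ => f (flip j σ)) = gibbsAvg θ S (negAt j h) f := by
  rw [gibbsAvg_eq_div, gibbsAvg_eq_div]
  congr 1
  · rw [← sum_flip j]
    exact Finset.sum_congr rfl fun σ _ => by rw [weight_flip hj, flip_flip]
  · rw [← sum_flip j]
    exact Finset.sum_congr rfl fun σ _ => weight_flip hj θ h σ

theorem measurePreserving_negAt {n : ℕ} (μ : Measure ℝ) [IsProbabilityMeasure μ]
    (hsymm : μ.map (fun h => -h) = μ) (j : Fin n) :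
    MeasurePreserving (negAt j) (Measure.pi fun _ : Fin n => μ) (Measure.pi fun _ => μ) := by
  refine measurePreserving_pi (fun _ => μ) (fun _ => μ)
    (f := fun i x => if i = j then -x else x) fun i => ?_
  by_cases hi : i = j
  · simp only [hi, if_true]
    exact ⟨measurable_neg, hsymm⟩
  · simp only [hi, if_false]
    exact MeasurePreserving.id μ

/-- After averaging over a symmetric field the sign reversal at j disappears. This is the only
source of independence for the spins outside S. -/
theorem integral_flip {n : ℕ} (μ : Measure ℝ) [IsProbabilityMeasure μ]
    (hsymm : μ.map (fun h => -h) = μ) (θ : ℝ) {S : Finset (Fin n)} {j : Fin n} (hj : j ∉ S)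
    (f : Config n → ℝ) :
    ∫ σ, f (flip j σ) ∂(plantedLaw μ θ S) = ∫ σ, f σ ∂(plantedLaw μ θ S) := by
  rw [integral_plantedLaw, integral_plantedLaw]
  simp only [gibbsAvg_flip hj]
  have hmp := measurePreserving_negAt μ hsymm j
  conv_rhs => rw [← hmp.map_eq]
  rw [integral_map hmp.measurable.aemeasurable]
  exact (continuous_gibbsAvg θ S f).aestronglyMeasurable

/-- Spins outside of the clique may be averaged out. -/
theorem integral_mul_exp_spinSum {n : ℕ} (μ : Measure ℝ) [IsProbabilityMeasure μ]
    (hsymm : μ.map (fun h => -h) = μ) (θ : ℝ) {S T : Finset (Fin n)} (hST : Disjoint S T)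
    (F : ℝ → ℝ) (t : ℝ → ℝ) :
    ∫ σ, F (spinSum S σ) * Real.exp (t (spinSum S σ) * spinSum T σ) ∂(plantedLaw μ θ S) =
      ∫ σ, F (spinSum S σ) * Real.cosh (t (spinSum S σ)) ^ T.card ∂(plantedLaw μ θ S) := by
  induction T using Finset.induction_on generalizing F with
  | empty => simp [spinSum]
  | insert j T hjT ih =>
    have hjS : j ∉ S := fun h => Finset.disjoint_left.1 hST h (Finset.mem_insert_self j T)
    have hST' : Disjoint S T := hST.mono_right (Finset.subset_insert j T)
    set P := plantedLaw μ θ S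
    set G : Config n → ℝ := fun σ =>
      F (spinSum S σ) * Real.exp (t (spinSum S σ) * spinSum (insert j T) σ)
    have hins : ∀ σ : Config n, spinSum (insert j T) σ = spin (σ j) + spinSum T σ :=
      fun σ => Finset.sum_insert hjT
    -- Averaging over the two values of the spin at j turns its exponential into a cosh.
    have h1 : ∫ σ, G σ ∂P = ∫ σ, (G σ + G (flip j σ)) / 2 ∂P := by
      rw [integral_div, integral_add (integrable_config P _) (integrable_config P _),
        integral_flip μ hsymm θ hjS G]
      ring
    rw [h1, Finset.card_insert_of_notMem hjT]
    -- The new cosh factor depends on the clique sum alone, so it is absorbed into F; hence the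
    -- induction is over all F.
    have h2 := ih hST' (fun x => F x * Real.cosh (t x))
    rw [show (fun σ => F (spinSum S σ) * Real.cosh (t (spinSum S σ)) ^ (T.card + 1)) =
      fun σ => F (spinSum S σ) * Real.cosh (t (spinSum S σ)) *
        Real.cosh (t (spinSum S σ)) ^ T.card by ext σ; ring, ← h2]
    congr 1
    ext σ
    have hf : spin (flip j σ j) = -spin (σ j) := by simp [flip, spin_not]
    simp only [G, hins, spinSum_flip_of_notMem hjS, spinSum_flip_of_notMem hjT, hf]
    rw [mul_add, mul_add, Real.exp_add, Real.exp_add, Real.cosh_eq]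
    cases σ j <;> simp [spin] <;> ring

/-! ### Gaussian integrals and the spins outside of the clique -/

theorem neg_half_sq_add_mul (a y : ℝ) :
    Real.exp (-(y ^ 2 / 2) + a * y) = Real.exp (a ^ 2 / 2) * Real.exp (-(1 / 2) * (y - a) ^ 2) := by
  rw [← Real.exp_add]; congr 1; ring

theorem integrable_exp_neg_half_sq_add_mul (a : ℝ) :
    Integrable fun y : ℝ => Real.exp (-(y ^ 2 / 2) + a * y) := by
  simp only [neg_half_sq_add_mul]
  exact ((integrable_exp_neg_mul_sq (b := 1 / 2) (by norm_num)).comp_sub_right a).const_mul _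

theorem integral_exp_neg_half_sq_add_mul (a : ℝ) :
    ∫ y : ℝ, Real.exp (-(y ^ 2 / 2) + a * y) =
      Real.sqrt (2 * Real.pi) * Real.exp (a ^ 2 / 2) := by
  simp only [neg_half_sq_add_mul]
  rw [integral_const_mul, integral_sub_right_eq_self (fun y => Real.exp (-(1 / 2) * y ^ 2)),
    integral_gaussian, mul_comm]
  congr 2
  ring

theorem inv_one_sub_le_exp {x : ℝ} (h0 : 0 ≤ x) (h1 : x ≤ 1 / 2) :
    1 / (1 - x) ≤ Real.exp (x + x ^ 2) := by
  have h := Real.quadratic_le_exp_of_nonneg (x := x + x ^ 2) (by positivity)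
  refine le_trans ?_ h
  rw [div_le_iff₀ (by linarith)]
  have h2 : 0 ≤ x ^ 2 * ((1 - x) * (1 + x) ^ 2 / 2 - x) := by
    apply mul_nonneg (sq_nonneg x)
    nlinarith [mul_nonneg h0 h0, mul_nonneg (mul_nonneg h0 h0) (by linarith : 0 ≤ 1 / 2 - x)]
  nlinarith [h2]

theorem exp_neg_le_quadratic {x : ℝ} (hx : 0 ≤ x) : Real.exp (-x) ≤ 1 - x + x ^ 2 / 2 := by
  have h1 := Real.quadratic_le_exp_of_nonneg hx
  rw [Real.exp_neg, inv_le_comm₀ (Real.exp_pos x) (by nlinarith [sq_nonneg (x - 1)])]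
  refine le_trans ?_ h1
  rw [inv_le_iff_one_le_mul₀ (by nlinarith [sq_nonneg (x - 1)])]
  nlinarith [sq_nonneg (x ^ 2)]

theorem cosh_pow_le_exp (a : ℝ) (d : ℕ) : Real.cosh a ^ d ≤ Real.exp (d * (a ^ 2 / 2)) := by
  rw [Real.exp_nat_mul]
  exact pow_le_pow_left₀ (Real.cosh_pos a).le (Real.cosh_le_exp_half_sq a) d

theorem integral_exp_mul_spinSum {n : ℕ} (μ : Measure ℝ) [IsProbabilityMeasure μ]
    (hsymm : μ.map (fun h => -h) = μ) (θ : ℝ) {S T : Finset (Fin n)} (hST : Disjoint S T)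
    (t : ℝ) :
    ∫ σ, Real.exp (t * spinSum T σ) ∂(plantedLaw μ θ S) = Real.cosh t ^ T.card := by
  simpa using integral_mul_exp_spinSum μ hsymm θ hST (fun _ => 1) (fun _ => t)

/-- The square is linearized by a Gaussian variable y, the signs then contribute cosh(a y)^d ≤ exp(d
a² y²/2), and the remaining Gaussian integral is (1 - 2ld)^(-1/2). The condition on l keeps 2ld at
most 1/2, where this is bounded by an exponential with explicit quadratic error. -/
theorem integral_exp_mul_spinSum_sq_le {n : ℕ} (μ : Measure ℝ) [IsProbabilityMeasure μ]
    (hsymm : μ.map (fun h => -h) = μ) (θ : ℝ) {S T : Finset (Fin n)} (hST : Disjoint S T)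
    {l : ℝ} (h0 : 0 ≤ l) (h1 : l * T.card ≤ 1 / 4) :
    ∫ σ, Real.exp (l * spinSum T σ ^ 2) ∂(plantedLaw μ θ S) ≤
      Real.exp (l * T.card + 2 * (l * T.card) ^ 2) := by
  set P := plantedLaw μ θ S
  set d := T.card
  set a := Real.sqrt (2 * l)
  have ha : a ^ 2 = 2 * l := Real.sq_sqrt (by positivity)
  have hpi : 0 < Real.sqrt (2 * Real.pi) := by positivity
  have hrep : ∀ σ : Config n, Real.exp (l * spinSum T σ ^ 2) =
      (Real.sqrt (2 * Real.pi))⁻¹ *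
        ∫ y : ℝ, Real.exp (-(y ^ 2 / 2) + a * spinSum T σ * y) := by
    intro σ
    rw [integral_exp_neg_half_sq_add_mul, ← mul_assoc, inv_mul_cancel₀ hpi.ne', one_mul, mul_pow,
      ha]
    congr 1
    ring
  have hswap : ∫ σ, Real.exp (l * spinSum T σ ^ 2) ∂P =
      (Real.sqrt (2 * Real.pi))⁻¹ * ∫ y : ℝ, Real.exp (-(y ^ 2 / 2)) * Real.cosh (a * y) ^ d := by
    simp only [hrep]
    rw [integral_const_mul, integral_fintype (integrable_config P _)]
    congr 1
    simp only [smul_eq_mul, ← integral_const_mul]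
    rw [← integral_finsetSum _ fun σ _ =>
      (integrable_exp_neg_half_sq_add_mul (a * spinSum T σ)).const_mul _]
    congr 1
    ext y
    rw [← integral_exp_mul_spinSum μ hsymm θ hST, integral_fintype (integrable_config P _),
      Finset.mul_sum]
    refine Finset.sum_congr rfl fun σ _ => ?_
    rw [Real.exp_add, smul_eq_mul, show a * spinSum T σ * y = a * y * spinSum T σ by ring]
    ring
  have hx : 0 < 1 / 2 - l * d := by linarith
  have hle : ∫ y : ℝ, Real.exp (-(y ^ 2 / 2)) * Real.cosh (a * y) ^ d ≤
      ∫ y : ℝ, Real.exp (-(1 / 2 - l * d) * y ^ 2) := by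
    refine integral_mono_of_nonneg (ae_of_all _ fun y => ?_) (integrable_exp_neg_mul_sq hx)
      (ae_of_all _ fun y => ?_)
    · have := (Real.cosh_pos (a * y)).le
      positivity
    · calc Real.exp (-(y ^ 2 / 2)) * Real.cosh (a * y) ^ d
          ≤ Real.exp (-(y ^ 2 / 2)) * Real.exp (d * ((a * y) ^ 2 / 2)) :=
            mul_le_mul_of_nonneg_left (cosh_pow_le_exp _ _) (Real.exp_pos _).le
        _ = Real.exp (-(1 / 2 - l * d) * y ^ 2) := by
            rw [← Real.exp_add, mul_pow, ha]; congr 1; ring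
  rw [hswap]
  calc (Real.sqrt (2 * Real.pi))⁻¹ * ∫ y : ℝ, Real.exp (-(y ^ 2 / 2)) * Real.cosh (a * y) ^ d
      ≤ (Real.sqrt (2 * Real.pi))⁻¹ * Real.sqrt (Real.pi / (1 / 2 - l * d)) := by
        rw [← integral_gaussian]
        exact mul_le_mul_of_nonneg_left hle (inv_nonneg.2 hpi.le)
    _ = Real.sqrt (1 / (1 - 2 * (l * d))) := by
        rw [← Real.sqrt_inv, ← Real.sqrt_mul (by positivity)]
        congr 1
        have : 1 - 2 * (l * d) ≠ 0 := by linarith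
        have := Real.pi_ne_zero
        field_simp
    _ ≤ Real.sqrt (Real.exp (2 * (l * d) + (2 * (l * d)) ^ 2)) :=
        Real.sqrt_le_sqrt (inv_one_sub_le_exp (by positivity) (by linarith))
    _ = Real.exp (l * d + 2 * (l * d) ^ 2) := by
        rw [Real.sqrt_eq_iff_mul_self_eq (Real.exp_pos _).le (Real.exp_pos _).le, ← Real.exp_add]
        congr 1
        ring

theorem integral_spinSum_sq {n : ℕ} (μ : Measure ℝ) [IsProbabilityMeasure μ]
    (hsymm : μ.map (fun h => -h) = μ) (θ : ℝ) {S T : Finset (Fin n)} (hST : Disjoint S T) :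
    ∫ σ, spinSum T σ ^ 2 ∂(plantedLaw μ θ S) = T.card := by
  set P := plantedLaw μ θ S
  have hcorr : ∀ i ∈ T, ∀ j ∈ T,
      ∫ σ, spin (σ i) * spin (σ j) ∂P = if i = j then 1 else 0 := by
    intro i hi j _
    by_cases hij : i = j
    · subst hij
      simp [← pow_two, spin_sq]
    · have hiS : i ∉ S := fun h => Finset.disjoint_left.1 hST h hi
      have h := integral_flip μ hsymm θ hiS (fun σ => spin (σ i) * spin (σ j))
      have h2 : ∀ σ : Config n, spin (flip i σ i) * spin (flip i σ j) =
          -(spin (σ i) * spin (σ j)) := by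
        intro σ
        simp [flip, spin_not, Ne.symm hij]
      simp only [h2] at h
      rw [integral_neg] at h
      simp only [hij, if_false]
      linarith
  have hexp : ∀ σ : Config n, spinSum T σ ^ 2 = ∑ i ∈ T, ∑ j ∈ T, spin (σ i) * spin (σ j) := by
    intro σ
    rw [pow_two, spinSum, Finset.sum_mul_sum]
  simp only [hexp]
  rw [integral_finsetSum _ fun i _ => integrable_config P _]
  calc ∑ i ∈ T, ∫ σ, ∑ j ∈ T, spin (σ i) * spin (σ j) ∂P
      = ∑ i ∈ T, ∑ j ∈ T, if i = j then (1 : ℝ) else 0 := by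
        refine Finset.sum_congr rfl fun i hi => ?_
        rw [integral_finsetSum _ fun j _ => integrable_config P _]
        exact Finset.sum_congr rfl fun j hj => hcorr i hi j hj
    _ = T.card := by simp

/-- Deduced from the exponential moment at l = 1/(4d): with u = N²/(4d), N the sum over T, one has
N⁴ = 16 d² u² ≤ 32 d² exp u, and the mean of exp u is at most exp(3/8) ≤ 2. -/
theorem integral_spinSum_pow_four_le {n : ℕ} (μ : Measure ℝ) [IsProbabilityMeasure μ]
    (hsymm : μ.map (fun h => -h) = μ) (θ : ℝ) {S T : Finset (Fin n)} (hST : Disjoint S T) :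
    ∫ σ, spinSum T σ ^ 4 ∂(plantedLaw μ θ S) ≤ 64 * (T.card : ℝ) ^ 2 := by
  set P := plantedLaw μ θ S
  set d : ℝ := (T.card : ℝ) with hd
  rcases Nat.eq_zero_or_pos T.card with h0 | hpos
  · have hT : T = ∅ := Finset.card_eq_zero.1 h0
    subst hT
    simp [spinSum]
    positivity
  have hd0 : 0 < d := by rw [hd]; exact_mod_cast hpos
  have hpt : ∀ σ : Config n,
      spinSum T σ ^ 4 ≤ 32 * d ^ 2 * Real.exp (1 / (4 * d) * spinSum T σ ^ 2) := by
    intro σ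
    set u := 1 / (4 * d) * spinSum T σ ^ 2 with hu
    have hu0 : 0 ≤ u := by positivity
    have := Real.quadratic_le_exp_of_nonneg hu0
    have h4 : spinSum T σ ^ 4 = 16 * d ^ 2 * u ^ 2 := by
      rw [hu]; field_simp; ring
    rw [h4]
    have : u ^ 2 ≤ 2 * Real.exp u := by linarith
    nlinarith [mul_le_mul_of_nonneg_left this (by positivity : 0 ≤ 16 * d ^ 2)]
  have hm := integral_exp_mul_spinSum_sq_le μ hsymm θ hST (l := 1 / (4 * d)) (by positivity)
    (by rw [← hd]; field_simp; exact le_refl _)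
  have he : 1 / (4 * d) * d = 1 / 4 := by field_simp
  rw [← hd, he] at hm
  have h2 : Real.exp (1 / 4 + 2 * (1 / 4) ^ 2) ≤ 2 := by
    rw [← Real.le_log_iff_exp_le (by norm_num)]
    have := Real.log_two_gt_d9
    norm_num at this ⊢
    linarith
  calc ∫ σ, spinSum T σ ^ 4 ∂P
      ≤ ∫ σ, 32 * d ^ 2 * Real.exp (1 / (4 * d) * spinSum T σ ^ 2) ∂P :=
        integral_mono (integrable_config P _) (integrable_config P _) hpt
    _ ≤ 32 * d ^ 2 * 2 := by
        rw [integral_const_mul]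
        exact mul_le_mul_of_nonneg_left (hm.trans h2) (by positivity)
    _ = 64 * d ^ 2 := by ring

/-- Laplace transform of the square of the sum of the spins outside of the clique. -/
theorem integral_exp_neg_mul_spinSum_sq_le {n : ℕ} (μ : Measure ℝ) [IsProbabilityMeasure μ]
    (hsymm : μ.map (fun h => -h) = μ) (θ : ℝ) {S T : Finset (Fin n)} (hST : Disjoint S T)
    {l : ℝ} (h0 : 0 ≤ l) :
    ∫ σ, Real.exp (-(l * spinSum T σ ^ 2)) ∂(plantedLaw μ θ S) ≤
      Real.exp (-(l * T.card) + 32 * (l * T.card) ^ 2) := by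
  set P := plantedLaw μ θ S
  calc ∫ σ, Real.exp (-(l * spinSum T σ ^ 2)) ∂P
      ≤ ∫ σ, (1 - l * spinSum T σ ^ 2 + l ^ 2 / 2 * spinSum T σ ^ 4) ∂P := by
        refine integral_mono (integrable_config P _) (integrable_config P _) fun σ => ?_
        have := exp_neg_le_quadratic (x := l * spinSum T σ ^ 2) (by positivity)
        refine this.trans (le_of_eq ?_)
        ring
    _ = 1 - l * T.card + l ^ 2 / 2 * ∫ σ, spinSum T σ ^ 4 ∂P := by
        rw [integral_add (integrable_config P _) (integrable_config P _),
          integral_sub (integrable_config P _) (integrable_config P _), integral_const_mul,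
          integral_const_mul, integral_spinSum_sq μ hsymm θ hST]
        simp
    _ ≤ 1 - l * T.card + l ^ 2 / 2 * (64 * (T.card : ℝ) ^ 2) := by
        have := integral_spinSum_pow_four_le μ hsymm θ hST
        gcongr
    _ ≤ Real.exp (-(l * T.card) + 32 * (l * T.card) ^ 2) := by
        have := Real.add_one_le_exp (-(l * T.card) + 32 * (l * T.card) ^ 2)
        refine le_trans (le_of_eq ?_) this
        ring

/-! ### Chernoff bound for samples -/

/-- Exponential Markov inequality: the exponential moment of a sum over independent samples
factorizes. -/
theorem pi_real_le_exp {n : ℕ} (P : Measure (Config n)) [IsProbabilityMeasure P] (m : ℕ)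
    (f : Config n → ℝ) (a b : ℝ) (hb : ∫ σ, Real.exp (f σ) ∂P ≤ Real.exp b)
    (E : Set (Fin m → Config n)) (hE : ∀ x ∈ E, m * a ≤ ∑ l, f (x l)) :
    (Measure.pi fun _ : Fin m => P).real E ≤ Real.exp (-(m * (a - b))) := by
  set Q := Measure.pi fun _ : Fin m => P
  have h1 : Q.real E ≤ ∫ x, Real.exp (-(m * a)) * ∏ l, Real.exp (f (x l)) ∂Q := by
    rw [← integral_indicator_one (MeasurableSet.of_discrete)]
    refine integral_mono Integrable.of_finite Integrable.of_finite fun x => ?_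
    by_cases hx : x ∈ E
    · rw [Set.indicator_of_mem hx, Pi.one_apply, ← Real.exp_sum, ← Real.exp_add]
      exact Real.one_le_exp (by linarith [hE x hx])
    · rw [Set.indicator_of_notMem hx]
      positivity
  rw [integral_const_mul, integral_fintype_prod_eq_prod (fun _ σ => Real.exp (f σ))] at h1
  refine h1.trans ?_
  rw [Finset.prod_const, Finset.card_univ, Fintype.card_fin]
  calc Real.exp (-(m * a)) * (∫ σ, Real.exp (f σ) ∂P) ^ m
      ≤ Real.exp (-(m * a)) * Real.exp b ^ m := by
        gcongr
    _ = Real.exp (-(m * (a - b))) := by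
        rw [← Real.exp_nat_mul, ← Real.exp_add]; congr 1; ring

/-! ### Error probabilities of the tests -/

theorem pairStat_eq {n : ℕ} (S : Finset (Fin n)) (σ : Config n) :
    pairStat S σ = spinSum S σ ^ 2 / S.card := by
  rw [pairStat, pow_two, spinSum, Finset.sum_mul_sum, one_div_mul_eq_div]

theorem pairStat_nonneg {n : ℕ} (S : Finset (Fin n)) (σ : Config n) : 0 ≤ pairStat S σ := by
  rw [pairStat_eq]; positivity

theorem localStat_eq {n m : ℕ} {S : Finset (Fin n)} (hS : 0 < S.card) (x : Fin m → Config n) :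
    localStat S x = (∑ l, pairStat S (x l)) / m - 1 := by
  have hk : (S.card : ℝ) ≠ 0 := by positivity
  have h : ∑ i ∈ S, ∑ j ∈ S, (1 / (m : ℝ)) * ∑ l, spin (x l i) * spin (x l j) =
      (∑ l, spinSum S (x l) ^ 2) / m := by
    simp only [← Finset.mul_sum]
    rw [one_div_mul_eq_div]
    congr 1
    rw [show ∑ i ∈ S, ∑ j ∈ S, ∑ l, spin (x l i) * spin (x l j) =
      ∑ i ∈ S, ∑ l, ∑ j ∈ S, spin (x l i) * spin (x l j) from
        Finset.sum_congr rfl fun i _ => Finset.sum_comm, Finset.sum_comm]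
    refine Finset.sum_congr rfl fun l _ => ?_
    rw [pow_two, spinSum, Finset.sum_mul_sum]
  rw [localStat, h]
  simp only [pairStat_eq, ← Finset.sum_div]
  field_simp

/-- Along cliques `S` with `|S| → ∞`, a truncated mean of `W_S` eventually exceeds `1 + τ` by a
fixed amount. -/
def TruncatedMeanExceeds (μ : Measure ℝ) (θ τ : ℝ) : Prop :=
  ∃ B η : ℝ, 0 < B ∧ 0 < η ∧ ∃ K : ℕ, ∀ (n : ℕ) (S : Finset (Fin n)), K ≤ S.card →
    1 + τ + 2 * η ≤ ∫ σ, min (pairStat S σ) B ∂(plantedLaw μ θ S)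

/-- Summing out the spins in T replaces the cross term by a power of cosh bounded by exp(2 l c W),
with l = c/R, so it costs only a factor 1 - 2c in front of W. Replacing W by min(W, B) then bounds
the quadratic term of the exponential without any second moment of W. -/
theorem integral_exp_neg_pairStat_le {n : ℕ} (μ : Measure ℝ) [IsProbabilityMeasure μ]
    (hsymm : μ.map (fun h => -h) = μ) (θ : ℝ) {S T : Finset (Fin n)} (hST : Disjoint S T)
    (hS : 0 < S.card) {τ B η R c : ℝ} (hB : 0 < B) (hη : 0 < η) (hR : 1 ≤ R)
    (hT : (T.card : ℝ) ≤ R * S.card) (hc0 : 0 < c) (hc1 : c ≤ 1 / 4)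
    (hc2 : c * (4 * B + B ^ 2) ≤ η)
    (hw : 1 + τ + 2 * η ≤ ∫ σ, min (pairStat S σ) B ∂(plantedLaw μ θ S)) :
    ∫ σ, Real.exp (-(c / R * (pairStat S σ + 2 * spinSum S σ * spinSum T σ / S.card)))
        ∂(plantedLaw μ θ S) ≤
      Real.exp (-(c / R * (1 + τ + η)) - c * η / (2 * R)) := by
  set P := plantedLaw μ θ S
  set k : ℝ := (S.card : ℝ) with hk
  have hk0 : 0 < k := by rw [hk]; exact_mod_cast hS
  have hR0 : 0 < R := by linarith
  set l := c / R with hl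
  have hl0 : 0 < l := by positivity
  have hlc : l ≤ c := div_le_self hc0.le hR
  set w := ∫ σ, min (pairStat S σ) B ∂P
  have hwB : w ≤ B := by
    calc w ≤ ∫ _, B ∂P :=
          integral_mono (integrable_config P _) (integrable_config P _) fun σ => min_le_right _ _
      _ = B := by simp
  have h1 : ∫ σ, Real.exp (-(l * (pairStat S σ + 2 * spinSum S σ * spinSum T σ / k))) ∂P =
      ∫ σ, Real.exp (-(l * (spinSum S σ ^ 2 / k))) *
        Real.cosh (-(2 * l * spinSum S σ / k)) ^ T.card ∂P := by
    rw [← integral_mul_exp_spinSum μ hsymm θ hST (fun x => Real.exp (-(l * (x ^ 2 / k))))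
      (fun x => -(2 * l * x / k))]
    congr 1
    ext σ
    rw [← Real.exp_add, pairStat_eq]
    congr 1
    ring
  rw [h1]
  calc ∫ σ, Real.exp (-(l * (spinSum S σ ^ 2 / k))) *
        Real.cosh (-(2 * l * spinSum S σ / k)) ^ T.card ∂P
      ≤ ∫ σ, (1 - l * (1 - 2 * c) * min (pairStat S σ) B + l ^ 2 * B ^ 2 / 2) ∂P := by
        refine integral_mono (integrable_config P _) (integrable_config P _) fun σ => ?_
        set W := pairStat S σ with hW
        have hW0 : 0 ≤ W := pairStat_nonneg S σ
        have hWeq : W = spinSum S σ ^ 2 / k := pairStat_eq S σ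
        have hcosh : Real.cosh (-(2 * l * spinSum S σ / k)) ^ T.card ≤
            Real.exp (2 * l * c * W) := by
          refine (cosh_pow_le_exp _ _).trans (Real.exp_le_exp.2 ?_)
          calc (T.card : ℝ) * ((-(2 * l * spinSum S σ / k)) ^ 2 / 2)
              ≤ R * k * ((-(2 * l * spinSum S σ / k)) ^ 2 / 2) := by gcongr
            _ = 2 * l * c * W := by
                rw [hWeq, hl]; field_simp
        set v := min W B with hv
        have hv0 : 0 ≤ v := le_min hW0 hB.le
        have hvB : v ≤ B := min_le_right _ _
        have hvW : v ≤ W := min_le_left _ _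
        have h12 : 0 ≤ 1 - 2 * c := by linarith
        set p := l * (1 - 2 * c) with hp
        have hp0 : 0 ≤ p := by positivity
        have hpl : p ≤ l := by rw [hp]; nlinarith
        calc Real.exp (-(l * (spinSum S σ ^ 2 / k))) *
              Real.cosh (-(2 * l * spinSum S σ / k)) ^ T.card
            ≤ Real.exp (-(l * W)) * Real.exp (2 * l * c * W) := by
              rw [← hWeq]; gcongr
          _ = Real.exp (-(p * W)) := by rw [← Real.exp_add, hp]; congr 1; ring
          _ ≤ Real.exp (-(p * v)) := by gcongr
          _ ≤ 1 - p * v + (p * v) ^ 2 / 2 := exp_neg_le_quadratic (by positivity)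
          _ ≤ 1 - p * v + (l * B) ^ 2 / 2 := by gcongr
          _ = 1 - p * v + l ^ 2 * B ^ 2 / 2 := by ring
    _ = 1 - l * (1 - 2 * c) * w + l ^ 2 * B ^ 2 / 2 := by
        rw [integral_add (integrable_config P _) (integrable_config P _),
          integral_sub (integrable_config P _) (integrable_config P _), integral_const_mul]
        simp [w]
    -- Of the surplus 2η in the truncated mean, η goes into the tail level. The errors 2lcB and
    -- lcB²/2 together use at most lη/2 by `hc2`, and lη/2 = cη/(2R) is left as the exponential
    -- rate.
    _ ≤ -(l * (1 + τ + η)) - c * η / (2 * R) + 1 := by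
        have e : c * η / (2 * R) = l * η / 2 := by rw [hl]; field_simp
        rw [e]
        have a1 : l * (1 + τ + 2 * η) ≤ l * w := by gcongr
        have a2 : l * c * w ≤ l * c * B := by gcongr
        have a3 : l ^ 2 * B ^ 2 ≤ l * c * B ^ 2 := by
          rw [pow_two l]; gcongr
        have a4 : l * (c * (4 * B + B ^ 2)) ≤ l * η := by gcongr
        nlinarith
    _ ≤ Real.exp (-(l * (1 + τ + η)) - c * η / (2 * R)) := Real.add_one_le_exp _

/-- Lower tail of `∑ (W_S + 2 M N / k)`, where `M` and `N` are the sums of the spins in the clique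
and in a set outside of it. -/
theorem planted_lower_tail {n : ℕ} (μ : Measure ℝ) [IsProbabilityMeasure μ]
    (hsymm : μ.map (fun h => -h) = μ) (θ : ℝ) {S T : Finset (Fin n)} (hST : Disjoint S T)
    (hS : 0 < S.card) {τ B η R c : ℝ} (hB : 0 < B) (hη : 0 < η) (hR : 1 ≤ R)
    (hT : (T.card : ℝ) ≤ R * S.card) (hc0 : 0 < c) (hc1 : c ≤ 1 / 4)
    (hc2 : c * (4 * B + B ^ 2) ≤ η)
    (hw : 1 + τ + 2 * η ≤ ∫ σ, min (pairStat S σ) B ∂(plantedLaw μ θ S)) (m : ℕ) :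
    (Measure.pi fun _ : Fin m => plantedLaw μ θ S).real
        {x | ∑ l, (pairStat S (x l) + 2 * spinSum S (x l) * spinSum T (x l) / S.card) ≤
          m * (1 + τ + η)} ≤
      Real.exp (-(m * (c * η / (2 * R)))) := by
  have h := pi_real_le_exp (plantedLaw μ θ S) m _ (-(c / R * (1 + τ + η))) _
    (integral_exp_neg_pairStat_le μ hsymm θ hST hS hB hη hR hT hc0 hc1 hc2 hw)
    {x | ∑ l, (pairStat S (x l) + 2 * spinSum S (x l) * spinSum T (x l) / S.card) ≤
          m * (1 + τ + η)} (fun x hx => by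
      rw [Finset.sum_neg_distrib, ← Finset.mul_sum, mul_neg, neg_le_neg_iff]
      have h0 : 0 ≤ c / R := div_nonneg hc0.le (by linarith)
      calc _ ≤ c / R * (m * (1 + τ + η)) := mul_le_mul_of_nonneg_left hx h0
        _ = _ := by ring)
  refine h.trans (le_of_eq ?_)
  congr 1
  ring

/-- Lower tail of the sum of squares of the spin sums outside of the clique. -/
theorem outside_lower_tail {n : ℕ} (μ : Measure ℝ) [IsProbabilityMeasure μ]
    (hsymm : μ.map (fun h => -h) = μ) (θ : ℝ) {S T : Finset (Fin n)} (hST : Disjoint S T)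
    {u l : ℝ} (hl : 0 ≤ l) (m : ℕ) :
    (Measure.pi fun _ : Fin m => plantedLaw μ θ S).real
        {x | ∑ i, spinSum T (x i) ^ 2 ≤ m * (T.card - u)} ≤
      Real.exp (-(m * (l * u - 32 * (l * T.card) ^ 2))) := by
  refine (pi_real_le_exp (plantedLaw μ θ S) m _ (-(l * (T.card - u))) _
    (integral_exp_neg_mul_spinSum_sq_le μ hsymm θ hST hl) _ (fun x hx => ?_)).trans
    (le_of_eq ?_)
  · rw [Finset.sum_neg_distrib, ← Finset.mul_sum, mul_neg, neg_le_neg_iff]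
    calc _ ≤ l * (m * (T.card - u)) := mul_le_mul_of_nonneg_left hx hl
      _ = _ := by ring
  · congr 1
    ring

/-- Upper tail of the sum of squares of the spin sums under the null hypothesis. -/
theorem null_upper_tail {n : ℕ} (μ : Measure ℝ) [IsProbabilityMeasure μ]
    (hsymm : μ.map (fun h => -h) = μ) (T : Finset (Fin n)) {u l : ℝ} (hl : 0 ≤ l)
    (hl1 : l * T.card ≤ 1 / 4) (m : ℕ) :
    (Measure.pi fun _ : Fin m => nullLaw n μ).real
        {x | m * (T.card + u) ≤ ∑ i, spinSum T (x i) ^ 2} ≤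
      Real.exp (-(m * (l * u - 2 * (l * T.card) ^ 2))) := by
  refine (pi_real_le_exp (nullLaw n μ) m _ (l * (T.card + u)) _
    (integral_exp_mul_spinSum_sq_le μ hsymm 0 (Finset.disjoint_empty_left T) hl hl1)
    _ (fun x hx => ?_)).trans (le_of_eq ?_)
  · rw [← Finset.mul_sum]
    calc _ = l * (m * (T.card + u)) := by ring
      _ ≤ _ := mul_le_mul_of_nonneg_left hx hl
  · congr 1
    ring

/-! ### Entropy of the scan and error bounds for the three tests. -/

/-- From n^k/k! = (n/k)^k · k^k/k! ≤ exp(k log(n/k) + k). Since n ≥ 2k, log(n/k) is at least 1/2 and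
the extra k is at most twice the rate. -/
theorem choose_le_exp_localRate {n k : ℕ} (hk : 0 < k) (hkn : 2 * k ≤ n) :
    (n.choose k : ℝ) ≤ Real.exp (3 * localRate n k) := by
  have hk0 : (0 : ℝ) < k := by exact_mod_cast hk
  have hkn' : 2 * (k : ℝ) ≤ n := by exact_mod_cast hkn
  have hn0 : (0 : ℝ) < n := by linarith
  have h1 : (n.choose k : ℝ) ≤ (n : ℝ) ^ k / k.factorial := Nat.choose_le_pow_div k n
  have h2 : (k : ℝ) ^ k / k.factorial ≤ Real.exp k := Real.pow_div_factorial_le_exp _ hk0.le k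
  have hlog : 1 / 2 ≤ Real.log (n / k) := by
    calc (1 : ℝ) / 2 ≤ Real.log 2 := by have := Real.log_two_gt_d9; norm_num at this ⊢; linarith
      _ ≤ _ := Real.log_le_log (by norm_num) (by rw [le_div_iff₀ hk0]; exact hkn')
  calc (n.choose k : ℝ) ≤ (n : ℝ) ^ k / k.factorial := h1
    _ = (n / k : ℝ) ^ k * ((k : ℝ) ^ k / k.factorial) := by
        rw [div_pow]; field_simp
    _ ≤ (n / k : ℝ) ^ k * Real.exp k := by gcongr
    _ = Real.exp (localRate n k + k) := by
        rw [Real.exp_add, localRate, Real.exp_nat_mul, Real.exp_log (by positivity)]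
    _ ≤ Real.exp (3 * localRate n k) := by
        apply Real.exp_le_exp.2
        have : (k : ℝ) * (1 / 2) ≤ localRate n k := by
          unfold localRate; gcongr
        linarith

theorem scanStat_attained {n m : ℕ} (S₀ : Finset (Fin n)) (x : Fin m → Config n) :
    ∃ S : Finset (Fin n), S.card = S₀.card ∧ scanStat S₀.card x = localStat S x := by
  have : Nonempty {S : Finset (Fin n) // S.card = S₀.card} := ⟨⟨S₀, rfl⟩⟩
  obtain ⟨S, hS⟩ := exists_eq_ciSup_of_finite
    (f := fun S : {S : Finset (Fin n) // S.card = S₀.card} => localStat S.1 x)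
  exact ⟨S.1, S.2, hS.symm⟩

theorem localStat_le_scanStat {n m : ℕ} (S₀ : Finset (Fin n)) (x : Fin m → Config n) :
    localStat S₀ x ≤ scanStat S₀.card x :=
  le_ciSup (f := fun S : {S : Finset (Fin n) // S.card = S₀.card} => localStat S.1 x)
    (Set.finite_range _).bddAbove ⟨S₀, rfl⟩

/-- Union bound over the k-sets, each handled by `null_upper_tail` with l = s/k. The exponent is
then sτ - 2s², which is at least sτ/2 because s ≤ τ/4. -/
theorem scan_typeOne_le {n : ℕ} (μ : Measure ℝ) [IsProbabilityMeasure μ]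
    (hsymm : μ.map (fun h => -h) = μ) {τ s : ℝ} (hs0 : 0 < s) (hs1 : s ≤ 1 / 4)
    (hs2 : s ≤ τ / 4) {m : ℕ} (hm : 0 < m) (S₀ : Finset (Fin n)) (hS : 0 < S₀.card) :
    (Measure.pi fun _ : Fin m => nullLaw n μ).real (scanTest n m S₀.card τ) ≤
      n.choose S₀.card * Real.exp (-(m * (s * τ / 2))) := by
  set k := S₀.card
  have hk0 : (0 : ℝ) < k := by exact_mod_cast hS
  have hm0 : (0 : ℝ) < m := by exact_mod_cast hm
  set Q := Measure.pi fun _ : Fin m => nullLaw n μ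
  have hsub : scanTest n m k τ ⊆ ⋃ S ∈ Finset.powersetCard k (Finset.univ : Finset (Fin n)),
      {x : Fin m → Config n | m * (S.card + k * τ) ≤ ∑ i, spinSum S (x i) ^ 2} := by
    intro x hx
    obtain ⟨S, hSc, hS'⟩ := scanStat_attained S₀ x
    simp only [Set.mem_iUnion]
    refine ⟨S, Finset.mem_powersetCard.2 ⟨Finset.subset_univ _, hSc⟩, ?_⟩
    have h1 : τ ≤ localStat S x := hS' ▸ hx
    rw [localStat_eq (by rw [hSc]; exact hS)] at h1
    simp only [pairStat_eq, ← Finset.sum_div, hSc] at h1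
    change (m : ℝ) * (S.card + k * τ) ≤ _
    rw [hSc]
    have h2 : 1 + τ ≤ (∑ l, spinSum S (x l) ^ 2) / k / m := by linarith
    rw [le_div_iff₀ hm0, le_div_iff₀ hk0] at h2
    linarith
  calc Q.real (scanTest n m k τ)
      ≤ Q.real (⋃ S ∈ Finset.powersetCard k (Finset.univ : Finset (Fin n)),
          {x : Fin m → Config n | m * (S.card + k * τ) ≤ ∑ i, spinSum S (x i) ^ 2}) :=
        measureReal_mono hsub (measure_ne_top _ _)
    _ ≤ ∑ S ∈ Finset.powersetCard k (Finset.univ : Finset (Fin n)),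
          Q.real {x : Fin m → Config n | m * (S.card + k * τ) ≤ ∑ i, spinSum S (x i) ^ 2} :=
        measureReal_biUnion_finset_le _ _
    _ ≤ ∑ S ∈ Finset.powersetCard k (Finset.univ : Finset (Fin n)),
          Real.exp (-(m * (s * τ / 2))) := by
        refine Finset.sum_le_sum fun S hS => ?_
        have hSc : S.card = k := (Finset.mem_powersetCard.1 hS).2
        have e : s / k * k = s := by field_simp
        refine (null_upper_tail μ hsymm S (l := s / k) (by positivity)
          (by rw [hSc, e]; exact hs1) m).trans (Real.exp_le_exp.2 ?_)
        rw [hSc, e, neg_le_neg_iff, ← mul_assoc, e]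
        gcongr
        nlinarith
    _ = n.choose k * Real.exp (-(m * (s * τ / 2))) := by
        rw [Finset.sum_const, Finset.card_powersetCard, Finset.card_univ, Fintype.card_fin,
          nsmul_eq_mul]

theorem exists_forall_exp_neg_le {a δ : ℝ} (ha : 0 < a) (hδ : 0 < δ) :
    ∃ C : ℝ, 0 < C ∧ ∀ x, C ≤ x → Real.exp (-(a * x)) ≤ δ := by
  refine ⟨max 1 (-Real.log δ / a), lt_of_lt_of_le one_pos (le_max_left _ _), fun x hx => ?_⟩
  rw [← Real.le_log_iff_exp_le hδ]
  have := (le_max_right _ _).trans hx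
  rw [div_le_iff₀ ha] at this
  linarith

theorem exists_truncation_rate {B η : ℝ} (hB : 0 < B) (hη : 0 < η) :
    ∃ c : ℝ, 0 < c ∧ c ≤ 1 / 4 ∧ c * (4 * B + B ^ 2) ≤ η := by
  refine ⟨min (1 / 4) (η / (4 * B + B ^ 2)), by positivity, min_le_left _ _, ?_⟩
  rw [← le_div_iff₀ (by positivity)]
  exact min_le_right _ _

theorem scanTestSucceeds_of_truncatedMeanExceeds (μ : Measure ℝ) [IsProbabilityMeasure μ]
    (hsymm : μ.map (fun h => -h) = μ) {θ τ : ℝ} (hτ : 0 < τ)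
    (h : TruncatedMeanExceeds μ θ τ) : ScanTestSucceeds μ θ τ := by
  obtain ⟨B, η, hB, hη, K, hK⟩ := h
  obtain ⟨c, hc0, hc1, hc2⟩ := exists_truncation_rate hB hη
  set s := min (1 / 4) (τ / 4)
  have hs0 : 0 < s := by positivity
  -- With this C the Chernoff exponent is at least 4 k log(n/k): three units pay for the binomial
  -- coefficient and one remains.
  set C := 4 / (s * τ / 2) with hC
  have hC0 : 0 < C := by positivity
  refine ⟨C, hC0, fun δ hδ => ?_⟩
  obtain ⟨K₁, hK₁0, hK₁⟩ := exists_forall_exp_neg_le (a := 1 / 2) (δ := δ / 2) (by norm_num)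
    (by positivity)
  obtain ⟨K₂, hK₂0, hK₂⟩ := exists_forall_exp_neg_le (a := c * η / (2 * 1) * (C * (1 / 2)))
    (δ := δ / 2) (by positivity) (by positivity)
  refine ⟨max K (max 1 (max ⌈K₁⌉₊ ⌈K₂⌉₊)), fun n m S₀ hcard hkn hm => ?_⟩
  simp only [max_le_iff, Nat.ceil_le] at hcard
  obtain ⟨hcK, hc1', hcK₁, hcK₂⟩ := hcard
  set k := S₀.card
  have hk0 : (0 : ℝ) < k := by exact_mod_cast hc1'
  have hlog : 1 / 2 ≤ Real.log ((n : ℝ) / k) := by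
    calc (1 : ℝ) / 2 ≤ Real.log 2 := by have := Real.log_two_gt_d9; norm_num at this ⊢; linarith
      _ ≤ _ := Real.log_le_log (by norm_num) (by rw [le_div_iff₀ hk0]; exact_mod_cast hkn)
  -- The rate is at least k/2, so both errors vanish as k grows and C need not depend on δ.
  have hrate : (k : ℝ) * (1 / 2) ≤ localRate n k := by
    unfold localRate; gcongr
  have hm0 : (0 : ℝ) < m := lt_of_lt_of_le (by positivity : 0 < C * ((k : ℝ) * (1 / 2)))
    ((mul_le_mul_of_nonneg_left hrate hC0.le).trans hm)
  have hmN : 0 < m := by exact_mod_cast hm0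
  have h1 : (Measure.pi fun _ : Fin m => nullLaw n μ).real (scanTest n m k τ) ≤ δ / 2 := by
    refine (scan_typeOne_le μ hsymm hs0 (min_le_left _ _) (min_le_right _ _) hmN S₀ hc1').trans ?_
    calc (n.choose k : ℝ) * Real.exp (-(m * (s * τ / 2)))
        ≤ Real.exp (3 * localRate n k) * Real.exp (-(C * localRate n k * (s * τ / 2))) := by
          gcongr
          exact choose_le_exp_localRate hc1' hkn
      _ = Real.exp (-localRate n k) := by
          rw [← Real.exp_add, hC]; congr 1; field_simp; ring
      _ ≤ Real.exp (-(1 / 2 * k)) := by gcongr; linarith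
      _ ≤ δ / 2 := hK₁ _ hcK₁
  have h2 : (Measure.pi fun _ : Fin m => plantedLaw μ θ S₀).real (scanTest n m k τ)ᶜ ≤ δ / 2 := by
    -- The scan dominates the statistic of the true clique, so the tail bound is used with T = ∅ and
    -- R = 1.
    refine (measureReal_mono ?_ (measure_ne_top _ _)).trans ((planted_lower_tail μ hsymm θ
      (Finset.disjoint_empty_right S₀) hc1' hB hη le_rfl (by simp) hc0 hc1 hc2 (hK n S₀ hcK)
      m).trans ?_)
    · intro x hx
      have hx' : scanStat k x < τ := not_le.1 hx
      have hx2 := (localStat_le_scanStat S₀ x).trans_lt hx'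
      rw [localStat_eq hc1'] at hx2
      have hx3 : (∑ l, pairStat S₀ (x l)) / m < 1 + τ := by linarith
      rw [div_lt_iff₀ hm0] at hx3
      have : ∀ l, spinSum ∅ (x l) = 0 := fun l => by simp [spinSum]
      simp only [Set.mem_ofPred_eq, this, mul_zero, zero_div, add_zero]
      nlinarith
    · refine le_trans ?_ (hK₂ k hcK₂)
      apply Real.exp_le_exp.2
      rw [neg_le_neg_iff]
      calc c * η / (2 * 1) * (C * (1 / 2)) * k = C * (k * (1 / 2)) * (c * η / (2 * 1)) := by ring
        _ ≤ m * (c * η / (2 * 1)) := by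
          gcongr
          exact (mul_le_mul_of_nonneg_left hrate hC0.le).trans hm
  unfold risk
  linarith

theorem globalTestSucceeds_of_truncatedMeanExceeds (μ : Measure ℝ) [IsProbabilityMeasure μ]
    (hsymm : μ.map (fun h => -h) = μ) {θ τ : ℝ} (hτ : 0 < τ)
    (h : TruncatedMeanExceeds μ θ τ) : GlobalTestSucceeds μ θ τ := by
  obtain ⟨B, η, hB, hη, K, hK⟩ := h
  obtain ⟨c, hc0, hc1, hc2⟩ := exists_truncation_rate hB hη
  set s := min (1 / 4) (τ / 4)
  have hs0 : 0 < s := by positivity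
  have hs1 : s ≤ 1 / 4 := min_le_left _ _
  have hs2 : s ≤ τ / 4 := min_le_right _ _
  intro δ hδ
  obtain ⟨C₁, hC₁0, hC₁⟩ := exists_forall_exp_neg_le (a := s * τ / 2) (δ := δ / 3)
    (by positivity) (by positivity)
  obtain ⟨C₂, hC₂0, hC₂⟩ := exists_forall_exp_neg_le (a := c * η / 2) (δ := δ / 3)
    (by positivity) (by positivity)
  obtain ⟨C₃, hC₃0, hC₃⟩ := exists_forall_exp_neg_le (a := η ^ 2 / 128) (δ := δ / 3)
    (by positivity) (by positivity)
  refine ⟨max C₁ (max C₂ C₃), by positivity, max K 1, fun n m S₀ hcard hm => ?_⟩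
  simp only [max_le_iff] at hcard
  obtain ⟨hcK, hc1'⟩ := hcard
  set k := S₀.card with hkdef
  set C := max C₁ (max C₂ C₃)
  have hC0 : 0 < C := by positivity
  have hk0 : (0 : ℝ) < k := by exact_mod_cast hc1'
  have hkn : (k : ℝ) ≤ n := by
    have := Finset.card_le_univ S₀
    rw [Fintype.card_fin] at this
    exact_mod_cast this
  have hn0 : (0 : ℝ) < n := by linarith
  -- All exponents are expressed through R = n/k; the sample condition reads m/R² ≥ C.
  obtain ⟨R, hR⟩ : ∃ R : ℝ, R = n / k := ⟨_, rfl⟩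
  have hR1 : 1 ≤ R := by rw [hR, le_div_iff₀ hk0]; linarith
  have hR0 : 0 < R := by linarith
  have hnR : (n : ℝ) = R * k := by rw [hR]; field_simp
  have hm' : C * R ^ 2 ≤ m := by
    refine le_trans (le_of_eq ?_) hm
    rw [globalRate, hR, div_pow]
  have hCR : ∀ x : ℝ, C ≤ x / R ^ 2 ↔ C * R ^ 2 ≤ x := fun x => le_div_iff₀ (by positivity)
  have hmR : C ≤ m / R ^ 2 := (hCR _).2 hm'
  have hm0 : (0 : ℝ) < m := lt_of_lt_of_le (by positivity) hm'
  have hstat : ∀ x : Fin m → Config n, globalStat k x =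
      ((∑ l, spinSum Finset.univ (x l) ^ 2) / m - n) / k := by
    intro x
    rw [globalStat, one_div_mul_eq_div, one_div_mul_eq_div]
  have h1 : (Measure.pi fun _ : Fin m => nullLaw n μ).real (globalTest n m k τ) ≤ δ / 3 := by
    have hu : ((Finset.univ : Finset (Fin n)).card : ℝ) = n := by simp
    have e : s / (R * n) * n = s / R := by field_simp
    have hsR : s / R ≤ 1 / 4 := (div_le_self hs0.le hR1).trans hs1
    -- With l = s/(Rn) the gain l k τ = sτ/R² and the loss 2(ln)² = 2s²/R² have the same order.
    refine (measureReal_mono ?_ (measure_ne_top _ _)).trans ((null_upper_tail μ hsymm Finset.univ (u := k * τ)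
      (l := s / (R * n)) (by positivity) (by rw [hu, e]; exact hsR) m).trans ?_)
    · intro x hx
      have hx' : τ ≤ globalStat k x := hx
      rw [hstat, le_div_iff₀ hk0, le_sub_iff_add_le, le_div_iff₀ hm0] at hx'
      simp only [Set.mem_ofPred_eq, hu]
      linarith
    · rw [hu, e]
      refine le_trans (Real.exp_le_exp.2 ?_) (hC₁ (m / R ^ 2) ((le_max_left _ _).trans hmR))
      rw [neg_le_neg_iff]
      have e2 : s / (R * n) * (k * τ) = s * τ / R ^ 2 := by
        rw [hnR]; field_simp
      rw [e2]
      calc s * τ / 2 * (m / R ^ 2) = m * (s * (τ / 2) / R ^ 2) := by ring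
        _ ≤ m * (s * (τ - 2 * s) / R ^ 2) := by gcongr; linarith
        _ = m * (s * τ / R ^ 2 - 2 * (s / R) ^ 2) := by
          rw [div_pow]; ring
  have h2 : (Measure.pi fun _ : Fin m => plantedLaw μ θ S₀).real (globalTest n m k τ)ᶜ ≤
      δ / 3 + δ / 3 := by
    set T := S₀ᶜ with hT
    have hST : Disjoint S₀ T := disjoint_compl_right
    have hsplit : ∀ σ : Config n, spinSum Finset.univ σ = spinSum S₀ σ + spinSum T σ :=
      fun σ => (Finset.sum_add_sum_compl S₀ _).symm
    have hTc : (T.card : ℝ) = n - k := by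
      rw [hT, Finset.card_compl, Fintype.card_fin, Nat.cast_sub (by exact_mod_cast hkn)]
    -- Expanding (M + N)² for the sums inside and outside the clique: if the test fails, either W +
    -- 2MN/k averages at most 1 + τ + η, or N² averages at most (n - k) - kη. The two margins η
    -- cancel.
    refine (measureReal_mono (s₂ := {x | ∑ l, (pairStat S₀ (x l) +
        2 * spinSum S₀ (x l) * spinSum T (x l) / S₀.card) ≤ m * (1 + τ + η)} ∪
        {x | ∑ i, spinSum T (x i) ^ 2 ≤ m * (T.card - k * η)}) ?_ (measure_ne_top _ _)).trans
      ((measureReal_union_le _ _).trans (add_le_add ?_ ?_))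
    · intro x hx
      have hx' : globalStat k x < τ := not_le.1 hx
      rw [hstat, div_lt_iff₀ hk0, sub_lt_iff_lt_add, div_lt_iff₀ hm0] at hx'
      by_contra hcon
      simp only [Set.mem_union, Set.mem_ofPred_eq, not_or, not_le] at hcon
      obtain ⟨ha, hb⟩ := hcon
      have hsum : ∑ l, spinSum Finset.univ (x l) ^ 2 =
          k * ∑ l, (pairStat S₀ (x l) + 2 * spinSum S₀ (x l) * spinSum T (x l) / k) +
            ∑ l, spinSum T (x l) ^ 2 := by
        rw [Finset.mul_sum, ← Finset.sum_add_distrib]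
        refine Finset.sum_congr rfl fun l _ => ?_
        rw [hsplit, pairStat_eq, ← hkdef, mul_add, mul_div_cancel₀ _ hk0.ne',
          mul_div_cancel₀ _ hk0.ne']
        ring
      rw [hTc] at hb
      have := mul_lt_mul_of_pos_left ha hk0
      rw [hsum] at hx'
      nlinarith
    · refine (planted_lower_tail μ hsymm θ hST hc1' hB hη hR1 ?_ hc0 hc1 hc2 (hK n S₀ hcK)
        m).trans ?_
      · rw [hTc, ← hkdef, ← hnR]; linarith
      · refine le_trans (Real.exp_le_exp.2 ?_) (hC₂ (m / R ^ 2)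
          (((le_max_left _ _).trans (le_max_right _ _)).trans hmR))
        rw [neg_le_neg_iff]
        calc c * η / 2 * (m / R ^ 2) = m * (c * η / 2) / R ^ 2 := by ring
          _ ≤ m * (c * η / 2) / R := by
            apply div_le_div_of_nonneg_left (by positivity) hR0
            nlinarith
          _ = m * (c * η / (2 * R)) := by field_simp
    -- With l = η/(64Rn) the gain is η²/(64R²) and the quadratic loss at most half of it.
    · have hl0 : 0 ≤ η / (64 * (R * n)) := by positivity
      refine (outside_lower_tail μ hsymm θ hST hl0 m).trans ?_
      refine le_trans (Real.exp_le_exp.2 ?_) (hC₃ (m / R ^ 2)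
          (((le_max_right _ _).trans (le_max_right _ _)).trans hmR))
      rw [neg_le_neg_iff]
      have hle : η / (64 * (R * n)) * T.card ≤ η / (64 * R) := by
        calc η / (64 * (R * n)) * T.card ≤ η / (64 * (R * n)) * n := by
              exact mul_le_mul_of_nonneg_left (by rw [hTc]; linarith) hl0
          _ = η / (64 * R) := by field_simp
      have e2 : η / (64 * (R * n)) * (k * η) = η ^ 2 / (64 * R ^ 2) := by
        rw [hnR]; field_simp
      rw [e2]
      calc η ^ 2 / 128 * (m / R ^ 2) = m * (η ^ 2 / (64 * R ^ 2) - 32 * (η / (64 * R)) ^ 2) := by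
            ring
        _ ≤ _ := mul_le_mul_of_nonneg_left (sub_le_sub_left (mul_le_mul_of_nonneg_left
            (pow_le_pow_left₀ (mul_nonneg hl0 (Nat.cast_nonneg _)) hle 2) (by norm_num)) _) hm0.le
  unfold risk
  linarith

theorem combinedTestSucceeds_of_scan_global {μ : Measure ℝ} {θ τ : ℝ}
    (hs : ScanTestSucceeds μ θ τ) (hg : GlobalTestSucceeds μ θ τ) :
    CombinedTestSucceeds μ θ τ := by
  intro δ hδ
  obtain ⟨C₁, hC₁0, hs⟩ := hs
  obtain ⟨K₁, hK₁⟩ := hs δ hδ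
  obtain ⟨C₂, hC₂0, K₂, hK₂⟩ := hg δ hδ
  refine ⟨max C₁ C₂, by positivity, max 4 (max K₁ K₂), fun n m S₀ hcard hm => ?_⟩
  simp only [max_le_iff] at hcard
  obtain ⟨h4, hk1, hk2⟩ := hcard
  unfold combinedTest
  split_ifs at hm ⊢ with hlt
  -- If n < 2k, then n² < 4k² ≤ k³ for k ≥ 4, contrary to k³ < n²; so the scan regime lies within k
  -- ≤ n/2.
  · have hkn : 2 * S₀.card ≤ n := by
      by_contra hcon
      have h1 : n ^ 2 < (2 * S₀.card) ^ 2 := Nat.pow_lt_pow_left (not_le.1 hcon) (by norm_num)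
      have h2 : 4 * S₀.card ^ 2 ≤ S₀.card ^ 3 := by
        rw [pow_succ S₀.card 2, mul_comm]; gcongr
      nlinarith
    refine hK₁ n m S₀ hk1 hkn (le_trans ?_ hm)
    have h0 : 0 ≤ localRate n S₀.card := by
      have : (0 : ℝ) < S₀.card := by exact_mod_cast (by omega : 0 < S₀.card)
      refine mul_nonneg this.le (Real.log_nonneg ?_)
      rw [le_div_iff₀ this]
      exact_mod_cast (by omega : 1 * S₀.card ≤ n)
    gcongr
    exact le_max_left _ _
  · refine hK₂ n m S₀ hk2 (le_trans ?_ hm)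
    have h0 : 0 ≤ globalRate n S₀.card := by unfold globalRate; positivity
    gcongr
    exact le_max_right _ _

/-! ### Tilted Gaussian densities -/

/-- The density of the standard Gaussian measure (without its constant) tilted by `exp L`. -/
def tiltedDensity (L : ℝ → ℝ) (y : ℝ) : ℝ := Real.exp (-(y ^ 2 / 2) + L y)

/-- `L` vanishes at `0` and has a continuous bounded derivative `L'`. -/
structure IsTilt (L L' : ℝ → ℝ) (a : ℝ) : Prop where
  hasDerivAt : ∀ y, HasDerivAt L (L' y) y
  continuous_deriv : Continuous L'
  abs_deriv_le : ∀ y, |L' y| ≤ a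
  map_zero : L 0 = 0

theorem isTilt_linear (a : ℝ) : IsTilt (fun y => a * y) (fun _ => a) |a| where
  hasDerivAt y := by simpa using (hasDerivAt_id y).const_mul a
  continuous_deriv := continuous_const
  abs_deriv_le _ := le_rfl
  map_zero := mul_zero a

theorem tiltedDensity_pos (L : ℝ → ℝ) (y : ℝ) : 0 < tiltedDensity L y := Real.exp_pos _

theorem one_add_pow_four_le_exp_abs (y : ℝ) : 1 + y ^ 4 ≤ 25 * Real.exp |y| := by
  have h := Real.pow_div_factorial_le_exp |y| (abs_nonneg y) 4
  have h1 : 1 ≤ Real.exp |y| := Real.one_le_exp (abs_nonneg y)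
  have e : |y| ^ 4 = y ^ 4 := by
    rw [show (4 : ℕ) = 2 * 2 by norm_num, pow_mul, sq_abs, pow_mul]
  rw [e, show ((Nat.factorial 4 : ℕ) : ℝ) = 24 by norm_num [Nat.factorial]] at h
  linarith

namespace IsTilt

variable {L L' : ℝ → ℝ} {a : ℝ}

theorem le_mul_abs (h : IsTilt L L' a) (y : ℝ) : L y ≤ a * |y| := by
  have := Convex.norm_image_sub_le_of_norm_hasDerivWithin_le (f := L) (f' := L') (C := a)
    (s := Set.univ) (fun x _ => (h.hasDerivAt x).hasDerivWithinAt)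
    (fun x _ => h.abs_deriv_le x) convex_univ (Set.mem_univ 0) (Set.mem_univ y)
  rw [h.map_zero, sub_zero, sub_zero] at this
  exact (le_abs_self _).trans this

theorem continuous (h : IsTilt L L' a) : Continuous L :=
  continuous_iff_continuousAt.2 fun y => (h.hasDerivAt y).continuousAt

theorem continuous_density (h : IsTilt L L' a) : Continuous (tiltedDensity L) := by
  have := h.continuous
  unfold tiltedDensity
  fun_prop

theorem integrable_mul (h : IsTilt L L' a) {g : ℝ → ℝ} (hg : Continuous g) (C : ℝ)
    (hC : ∀ y, |g y| ≤ C * (1 + y ^ 4)) : Integrable fun y => g y * tiltedDensity L y := by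
  have hC0 : 0 ≤ C := by
    have := (abs_nonneg _).trans (hC 0)
    simpa using this
  refine Integrable.mono' (((integrable_exp_neg_half_sq_add_mul (a + 1)).add
    (integrable_exp_neg_half_sq_add_mul (-(a + 1)))).const_mul (C * 25))
    (hg.mul h.continuous_density).aestronglyMeasurable (ae_of_all _ fun y => ?_)
  rw [norm_mul, Real.norm_eq_abs, Real.norm_of_nonneg (tiltedDensity_pos L y).le]
  have h1 : Real.exp |y| * tiltedDensity L y ≤
      Real.exp (-(y ^ 2 / 2) + (a + 1) * y) + Real.exp (-(y ^ 2 / 2) + -(a + 1) * y) := by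
    have h2 : Real.exp |y| * tiltedDensity L y ≤ Real.exp (-(y ^ 2 / 2) + (a + 1) * |y|) := by
      rw [tiltedDensity, ← Real.exp_add]
      apply Real.exp_le_exp.2
      linarith [h.le_mul_abs y]
    refine h2.trans ?_
    rcases abs_cases y with ⟨hy, _⟩ | ⟨hy, _⟩ <;> rw [hy]
    · exact le_add_of_nonneg_right (Real.exp_pos _).le
    · rw [show (a + 1) * -y = -(a + 1) * y by ring]
      exact le_add_of_nonneg_left (Real.exp_pos _).le
  calc |g y| * tiltedDensity L y ≤ C * (25 * Real.exp |y|) * tiltedDensity L y := by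
        have := tiltedDensity_pos L y
        gcongr
        exact (hC y).trans (mul_le_mul_of_nonneg_left (one_add_pow_four_le_exp_abs y) hC0)
    _ = C * 25 * (Real.exp |y| * tiltedDensity L y) := by ring
    _ ≤ _ := mul_le_mul_of_nonneg_left h1 (by positivity)

theorem abs_pow_le (y : ℝ) {n : ℕ} (hn : n ≤ 4) : |y| ^ n ≤ 1 + y ^ 4 := by
  have e : |y| ^ 4 = y ^ 4 := by
    rw [show (4 : ℕ) = 2 * 2 by norm_num, pow_mul, sq_abs, pow_mul]
  have h4 : 0 ≤ y ^ 4 := by positivity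
  rcases le_total |y| 1 with h | h
  · linarith [pow_le_one₀ (n := n) (abs_nonneg y) h]
  · have := pow_le_pow_right₀ h hn
    linarith

theorem integrable_pow (h : IsTilt L L' a) {n : ℕ} (hn : n ≤ 4) :
    Integrable fun y => y ^ n * tiltedDensity L y :=
  h.integrable_mul (by fun_prop) 1 fun y => by
    rw [abs_pow, one_mul]; exact abs_pow_le y hn

theorem integrable_density (h : IsTilt L L' a) : Integrable (tiltedDensity L) := by
  simpa using h.integrable_pow (n := 0) (by norm_num)

theorem integrable_pow_mul_deriv (h : IsTilt L L' a) {n : ℕ} (hn : n ≤ 4) :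
    Integrable fun y => y ^ n * L' y * tiltedDensity L y := by
  have := h.continuous_deriv
  refine h.integrable_mul (by fun_prop) a fun y => ?_
  rw [abs_mul, abs_pow, mul_comm]
  have h0 : 0 ≤ a := (abs_nonneg _).trans (h.abs_deriv_le 0)
  exact mul_le_mul (h.abs_deriv_le y) (abs_pow_le y hn) (by positivity) h0

/-- Integration by parts against a tilted Gaussian density. -/
theorem integral_pow_succ (h : IsTilt L L' a) {n : ℕ} (hn : n ≤ 3) :
    ∫ y, y ^ (n + 1) * tiltedDensity L y =
      n * (∫ y, y ^ (n - 1) * tiltedDensity L y) + ∫ y, y ^ n * L' y * tiltedDensity L y := by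
  have hd : ∀ y, HasDerivAt (fun y => y ^ n * tiltedDensity L y)
      (n * (y ^ (n - 1) * tiltedDensity L y) + y ^ n * L' y * tiltedDensity L y -
        y ^ (n + 1) * tiltedDensity L y) y := by
    intro y
    have h1 : HasDerivAt (fun y : ℝ => -(y ^ 2 / 2) + L y) (-y + L' y) y := by
      have := (((hasDerivAt_pow 2 y).div_const 2).neg).add (h.hasDerivAt y)
      refine this.congr_deriv ?_
      norm_num
    have h2 := (hasDerivAt_pow n y).mul h1.exp
    refine h2.congr_deriv ?_
    simp only [tiltedDensity]
    ring
  have i1 := h.integrable_pow (n := n) (by omega)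
  have i2 := (h.integrable_pow (n := n - 1) (by omega)).const_mul (n : ℝ)
  have i3 := h.integrable_pow_mul_deriv (n := n) (by omega)
  have i4 := h.integrable_pow (n := n + 1) (by omega)
  have := integral_eq_zero_of_hasDerivAt_of_integrable hd ((i2.add i3).sub i4) i1
  have i23 : Integrable fun y => n * (y ^ (n - 1) * tiltedDensity L y) +
      y ^ n * L' y * tiltedDensity L y := i2.add i3
  rw [integral_sub i23 i4, integral_add i2 i3, integral_const_mul] at this
  linarith

end IsTilt

theorem integral_tiltedDensity_linear (a : ℝ) :
    ∫ y, tiltedDensity (fun y => a * y) y = Real.sqrt (2 * Real.pi) * Real.exp (a ^ 2 / 2) :=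
  integral_exp_neg_half_sq_add_mul a

theorem integral_moments_linear (a : ℝ) :
    ∫ y, y ^ 2 * tiltedDensity (fun y => a * y) y =
        (1 + a ^ 2) * ∫ y, tiltedDensity (fun y => a * y) y ∧
      ∫ y, y ^ 4 * tiltedDensity (fun y => a * y) y =
        (3 + 6 * a ^ 2 + a ^ 4) * ∫ y, tiltedDensity (fun y => a * y) y := by
  have hL := isTilt_linear a
  have hmul : ∀ n : ℕ, ∫ y, y ^ n * a * tiltedDensity (fun y => a * y) y =
      a * ∫ y, y ^ n * tiltedDensity (fun y => a * y) y := by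
    intro n
    rw [← integral_const_mul]
    congr 1
    ext y
    ring
  have h0 := hL.integral_pow_succ (n := 0) (by norm_num)
  have h1 := hL.integral_pow_succ (n := 1) (by norm_num)
  have h2 := hL.integral_pow_succ (n := 2) (by norm_num)
  have h3 := hL.integral_pow_succ (n := 3) (by norm_num)
  rw [hmul] at h0 h1 h2 h3
  norm_num at h0 h1 h2 h3
  constructor
  · rw [h1, h0]; ring
  · rw [h3, h2, h1, h0]; ring

/-! ### The auxiliary Gaussian variable -/

/-- `log (cosh x)`. -/
def logCosh (x : ℝ) : ℝ := Real.log (Real.cosh x)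

theorem hasDerivAt_logCosh (x : ℝ) : HasDerivAt logCosh (Real.tanh x) x := by
  have := (Real.hasDerivAt_cosh x).log (Real.cosh_pos x).ne'
  rwa [← Real.tanh_eq_sinh_div_cosh] at this

theorem abs_tanh_le_one (x : ℝ) : |Real.tanh x| ≤ 1 := (Real.abs_tanh_lt_one x).le

/-- The exponent in the density of the auxiliary Gaussian variable given the field. -/
def fieldTilt {n : ℕ} (S : Finset (Fin n)) (h : Fin n → ℝ) (s y : ℝ) : ℝ :=
  ∑ i ∈ S, (logCosh (h i + s * y) - logCosh (h i))

/-- The derivative of `fieldTilt`. -/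
def fieldTiltDeriv {n : ℕ} (S : Finset (Fin n)) (h : Fin n → ℝ) (s y : ℝ) : ℝ :=
  s * ∑ i ∈ S, Real.tanh (h i + s * y)

theorem continuous_tanh : Continuous Real.tanh := by
  have : Real.tanh = fun x => Real.sinh x / Real.cosh x := by
    ext x; exact Real.tanh_eq_sinh_div_cosh x
  rw [this]
  exact Real.continuous_sinh.div Real.continuous_cosh fun x => (Real.cosh_pos x).ne'

theorem isTilt_fieldTilt {n : ℕ} (S : Finset (Fin n)) (h : Fin n → ℝ) {s : ℝ} (hs : 0 ≤ s) :
    IsTilt (fieldTilt S h s) (fieldTiltDeriv S h s) (s * S.card) where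
  hasDerivAt y := by
    unfold fieldTiltDeriv
    rw [Finset.mul_sum]
    refine HasDerivAt.fun_sum fun i _ => ?_
    have h1 : HasDerivAt (fun y => h i + s * y) s y := by
      simpa using ((hasDerivAt_id y).const_mul s).const_add (h i)
    have h2 := ((hasDerivAt_logCosh (h i + s * y)).comp y h1).sub_const (logCosh (h i))
    rw [mul_comm]
    exact h2
  continuous_deriv := by
    have := continuous_tanh
    unfold fieldTiltDeriv
    fun_prop
  abs_deriv_le y := by
    unfold fieldTiltDeriv
    rw [abs_mul, abs_of_nonneg hs]
    refine mul_le_mul_of_nonneg_left ?_ hs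
    calc |∑ i ∈ S, Real.tanh (h i + s * y)| ≤ ∑ i ∈ S, |Real.tanh (h i + s * y)| :=
          Finset.abs_sum_le_sum_abs _ _
      _ ≤ ∑ i ∈ S, (1 : ℝ) := Finset.sum_le_sum fun i _ => abs_tanh_le_one _
      _ = S.card := by simp
  map_zero := by simp [fieldTilt]

theorem sum_config_prod {n : ℕ} (f : Fin n → Bool → ℝ) :
    ∑ σ : Config n, ∏ i, f i (σ i) = ∏ i, (f i true + f i false) := by
  have h := Finset.prod_univ_sum (fun _ : Fin n => (Finset.univ : Finset Bool)) f
  rw [Fintype.piFinset_univ] at h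
  rw [← h]
  exact Finset.prod_congr rfl fun i _ => Fintype.sum_bool _

/-- For fixed y the interaction is linear, so it only shifts the fields in S by s y and the sum over
configurations factorizes. -/
theorem sum_exp_spinSum {n : ℕ} (S : Finset (Fin n)) (h : Fin n → ℝ) (s y : ℝ) :
    ∑ σ : Config n, Real.exp (s * spinSum S σ * y) * Real.exp (∑ i, h i * spin (σ i)) =
      (∏ i, (2 * Real.cosh (h i))) * Real.exp (fieldTilt S h s y) := by
  have h1 : ∀ σ : Config n,
      Real.exp (s * spinSum S σ * y) * Real.exp (∑ i, h i * spin (σ i)) =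
        ∏ i, Real.exp ((h i + if i ∈ S then s * y else 0) * spin (σ i)) := by
    intro σ
    rw [← Real.exp_add, ← Real.exp_sum]
    congr 1
    simp only [add_mul, Finset.sum_add_distrib, ite_mul, zero_mul]
    rw [Finset.sum_ite_mem, Finset.univ_inter, ← Finset.mul_sum, spinSum]
    ring
  simp only [h1]
  rw [sum_config_prod (fun i b => Real.exp ((h i + if i ∈ S then s * y else 0) * spin b))]
  have h2 : Real.exp (fieldTilt S h s y) =
      ∏ i, if i ∈ S then Real.cosh (h i + s * y) / Real.cosh (h i) else 1 := by
    rw [Finset.prod_ite_mem, Finset.univ_inter, fieldTilt, Real.exp_sum]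
    refine Finset.prod_congr rfl fun i _ => ?_
    rw [Real.exp_sub, logCosh, logCosh, Real.exp_log (Real.cosh_pos _),
      Real.exp_log (Real.cosh_pos _)]
  rw [h2, ← Finset.prod_mul_distrib]
  refine Finset.prod_congr rfl fun i _ => ?_
  have hc := (Real.cosh_pos (h i)).ne'
  by_cases hi : i ∈ S
  · simp only [hi, if_true, spin, Bool.false_eq_true, if_false]
    rw [mul_one, mul_neg_one, Real.cosh_eq (h i + s * y)]
    field_simp
  · simp only [hi, if_false, spin, Bool.false_eq_true, if_true]
    rw [mul_one, mul_neg_one, Real.cosh_eq (h i), add_zero]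
    ring

/-- Averages over the auxiliary Gaussian variable are Gibbs averages. -/
theorem integral_mul_tiltedDensity_fieldTilt {n : ℕ} {θ : ℝ} (hθ : 0 ≤ θ) {S : Finset (Fin n)}
    (h : Fin n → ℝ) (g G : ℝ → ℝ)
    (hgi : ∀ a, Integrable fun y => g y * tiltedDensity (fun y => a * y) y)
    (hg : ∀ a, ∫ y, g y * tiltedDensity (fun y => a * y) y =
      G a * ∫ y, tiltedDensity (fun y => a * y) y) :
    (∏ i, (2 * Real.cosh (h i))) *
        ∫ y, g y * tiltedDensity (fieldTilt S h (Real.sqrt (θ / S.card))) y =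
      Real.sqrt (2 * Real.pi) *
        ∑ σ, weight θ S h σ * G (Real.sqrt (θ / S.card) * spinSum S σ) := by
  set s := Real.sqrt (θ / S.card)
  have hs : s ^ 2 = θ / S.card := Real.sq_sqrt (by positivity)
  -- The tilted density is a positive mixture, over configurations, of linearly tilted Gaussians
  -- with slope s times the clique sum; each component supplies the factor exp(θM²/(2k)) of the
  -- Gibbs weight.
  have h1 : ∀ y, (∏ i, (2 * Real.cosh (h i))) * (g y * tiltedDensity (fieldTilt S h s) y) =
      ∑ σ : Config n, Real.exp (∑ i, h i * spin (σ i)) *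
        (g y * tiltedDensity (fun y => s * spinSum S σ * y) y) := by
    intro y
    rw [tiltedDensity, Real.exp_add]
    calc _ = g y * Real.exp (-(y ^ 2 / 2)) *
          ((∏ i, (2 * Real.cosh (h i))) * Real.exp (fieldTilt S h s y)) := by ring
      _ = _ := by
        rw [← sum_exp_spinSum, Finset.mul_sum]
        refine Finset.sum_congr rfl fun σ _ => ?_
        rw [tiltedDensity, Real.exp_add]
        ring
  rw [← integral_const_mul]
  simp only [h1]
  rw [integral_finsetSum _ fun σ _ => (hgi _).const_mul _, Finset.mul_sum]
  refine Finset.sum_congr rfl fun σ _ => ?_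
  rw [integral_const_mul, hg, integral_tiltedDensity_linear, weight, Real.exp_add, mul_pow, hs,
    show θ / S.card * spinSum S σ ^ 2 / 2 = θ / (2 * S.card) * spinSum S σ ^ 2 by ring]
  ring

theorem prod_two_mul_cosh_pos {n : ℕ} (h : Fin n → ℝ) : 0 < ∏ i, (2 * Real.cosh (h i)) :=
  Finset.prod_pos fun i _ => by have := Real.cosh_pos (h i); positivity

theorem integral_tiltedDensity_fieldTilt {n : ℕ} {θ : ℝ} (hθ : 0 ≤ θ) {S : Finset (Fin n)}
    (h : Fin n → ℝ) :
    (∏ i, (2 * Real.cosh (h i))) * ∫ y, tiltedDensity (fieldTilt S h (Real.sqrt (θ / S.card))) y =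
      Real.sqrt (2 * Real.pi) * ∑ σ, weight θ S h σ := by
  have := integral_mul_tiltedDensity_fieldTilt hθ (S := S) h (fun _ => 1) (fun _ => 1)
    (fun a => by simpa using (isTilt_linear a).integrable_density) (fun a => by simp)
  simpa using this

/-- Dropping the nonnegative quadratic energy leaves the product of the 2 cosh h_i, a lower bound
for the partition function. This bound lets error terms not carrying the normalization be absorbed.
-/
theorem one_le_integral_tiltedDensity {n : ℕ} {θ : ℝ} (hθ : 0 ≤ θ) (S : Finset (Fin n))
    (h : Fin n → ℝ) : 1 ≤ ∫ y, tiltedDensity (fieldTilt S h (Real.sqrt (θ / S.card))) y := by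
  have hp := prod_two_mul_cosh_pos h
  have h1 : ∏ i, (2 * Real.cosh (h i)) ≤ ∑ σ, weight θ S h σ := by
    have h0 := sum_exp_spinSum S h 0 0
    have : fieldTilt S h 0 0 = 0 := by simp [fieldTilt]
    rw [this, Real.exp_zero, mul_one] at h0
    rw [← h0]
    refine Finset.sum_le_sum fun σ _ => ?_
    rw [mul_zero, Real.exp_zero, one_mul]
    apply Real.exp_le_exp.2
    have : 0 ≤ θ / (2 * S.card) * spinSum S σ ^ 2 := by positivity
    linarith
  have h2 : 1 ≤ Real.sqrt (2 * Real.pi) := by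
    rw [Real.one_le_sqrt]
    linarith [Real.pi_gt_three]
  have h3 := integral_tiltedDensity_fieldTilt hθ (S := S) h
  have h4 : (∏ i, (2 * Real.cosh (h i))) * 1 ≤
      (∏ i, (2 * Real.cosh (h i))) *
        ∫ y, tiltedDensity (fieldTilt S h (Real.sqrt (θ / S.card))) y := by
    rw [h3, mul_one]
    nlinarith
  exact le_of_mul_le_mul_left h4 hp

/-- Given the spins, the auxiliary variable is Gaussian with mean a = √(θ/k) M and variance 1; G(a)
is the conditional mean of g. -/
theorem integral_mul_tiltedDensity_eq_gibbsAvg {n : ℕ} {θ : ℝ} (hθ : 0 ≤ θ) {S : Finset (Fin n)}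
    (h : Fin n → ℝ) (g G : ℝ → ℝ)
    (hgi : ∀ a, Integrable fun y => g y * tiltedDensity (fun y => a * y) y)
    (hg : ∀ a, ∫ y, g y * tiltedDensity (fun y => a * y) y =
      G a * ∫ y, tiltedDensity (fun y => a * y) y) :
    ∫ y, g y * tiltedDensity (fieldTilt S h (Real.sqrt (θ / S.card))) y =
      gibbsAvg θ S h (fun σ => G (Real.sqrt (θ / S.card) * spinSum S σ)) *
        ∫ y, tiltedDensity (fieldTilt S h (Real.sqrt (θ / S.card))) y := by
  have hp := prod_two_mul_cosh_pos h
  have h1 := integral_mul_tiltedDensity_fieldTilt hθ (S := S) h g G hgi hg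
  have h2 := integral_tiltedDensity_fieldTilt hθ (S := S) h
  have hZ := partition_pos θ S h
  rw [gibbsAvg_eq_div]
  apply mul_left_cancel₀ hp.ne'
  rw [h1, mul_left_comm, h2]
  field_simp

/-- Gibbs average of the fourth moment of the auxiliary Gaussian variable given the spins. -/
def fourthMoment {n : ℕ} (θ : ℝ) (S : Finset (Fin n)) (h : Fin n → ℝ) : ℝ :=
  gibbsAvg θ S h fun σ => 3 + 6 * (θ * pairStat S σ) + (θ * pairStat S σ) ^ 2

theorem sq_sqrt_mul_spinSum {n : ℕ} {θ : ℝ} (hθ : 0 ≤ θ) (S : Finset (Fin n)) (σ : Config n) :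
    (Real.sqrt (θ / S.card) * spinSum S σ) ^ 2 = θ * pairStat S σ := by
  rw [mul_pow, Real.sq_sqrt (by positivity), pairStat_eq]
  ring

theorem integral_sq_tiltedDensity {n : ℕ} {θ : ℝ} (hθ : 0 ≤ θ) (S : Finset (Fin n))
    (h : Fin n → ℝ) :
    ∫ y, y ^ 2 * tiltedDensity (fieldTilt S h (Real.sqrt (θ / S.card))) y =
      gibbsAvg θ S h (fun σ => 1 + θ * pairStat S σ) *
        ∫ y, tiltedDensity (fieldTilt S h (Real.sqrt (θ / S.card))) y := by
  rw [integral_mul_tiltedDensity_eq_gibbsAvg hθ h (fun y => y ^ 2) (fun a => 1 + a ^ 2)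
    (fun a => (isTilt_linear a).integrable_pow (by norm_num))
    (fun a => (integral_moments_linear a).1)]
  simp only [sq_sqrt_mul_spinSum hθ]

theorem integral_pow_four_tiltedDensity {n : ℕ} {θ : ℝ} (hθ : 0 ≤ θ) (S : Finset (Fin n))
    (h : Fin n → ℝ) :
    ∫ y, y ^ 4 * tiltedDensity (fieldTilt S h (Real.sqrt (θ / S.card))) y =
      fourthMoment θ S h * ∫ y, tiltedDensity (fieldTilt S h (Real.sqrt (θ / S.card))) y := by
  rw [integral_mul_tiltedDensity_eq_gibbsAvg hθ h (fun y => y ^ 4)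
    (fun a => 3 + 6 * a ^ 2 + a ^ 4) (fun a => (isTilt_linear a).integrable_pow le_rfl)
    (fun a => (integral_moments_linear a).2)]
  have e : ∀ a : ℝ, a ^ 4 = (a ^ 2) ^ 2 := fun a => by ring
  simp only [e, sq_sqrt_mul_spinSum hθ, fourthMoment]

/-! ### Estimates for a given field -/

/-- `1 / cosh² x`. -/
def sechSq (x : ℝ) : ℝ := 1 / Real.cosh x ^ 2

theorem sechSq_eq (x : ℝ) : sechSq x = 1 - Real.tanh x ^ 2 := by
  have := (Real.cosh_pos x).ne'
  rw [sechSq, Real.tanh_eq_sinh_div_cosh, div_pow, Real.sinh_sq]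
  field_simp
  ring

theorem sechSq_pos (x : ℝ) : 0 < sechSq x := by
  have := Real.cosh_pos x
  unfold sechSq
  positivity

theorem sechSq_le_one (x : ℝ) : sechSq x ≤ 1 := by
  rw [sechSq_eq]; linarith [sq_nonneg (Real.tanh x)]

theorem continuous_sechSq : Continuous sechSq := by
  have := continuous_tanh
  have e : sechSq = fun x => 1 - Real.tanh x ^ 2 := funext sechSq_eq
  rw [e]
  fun_prop

theorem hasDerivAt_tanh (x : ℝ) : HasDerivAt Real.tanh (sechSq x) x := by
  have h := (Real.hasDerivAt_sinh x).div (Real.hasDerivAt_cosh x) (Real.cosh_pos x).ne'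
  have e : Real.tanh = fun x => Real.sinh x / Real.cosh x := by
    ext x; exact Real.tanh_eq_sinh_div_cosh x
  rw [e]
  refine h.congr_deriv ?_
  rw [sechSq, ← pow_two, ← pow_two, Real.cosh_sq']
  ring

theorem abs_tanh_sub_tanh_le (x z : ℝ) : |Real.tanh x - Real.tanh z| ≤ |x - z| := by
  have := Convex.norm_image_sub_le_of_norm_hasDerivWithin_le (f := Real.tanh) (f' := sechSq)
    (C := 1) (s := Set.univ) (fun x _ => (hasDerivAt_tanh x).hasDerivWithinAt)
    (fun x _ => by
      rw [Real.norm_of_nonneg (sechSq_pos x).le]; exact sechSq_le_one x)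
    convex_univ (Set.mem_univ z) (Set.mem_univ x)
  simpa using this

theorem abs_sechSq_sub_sechSq_le (x z : ℝ) : |sechSq x - sechSq z| ≤ 2 * |x - z| := by
  rw [sechSq_eq, sechSq_eq,
    show 1 - Real.tanh x ^ 2 - (1 - Real.tanh z ^ 2) =
      -((Real.tanh x + Real.tanh z) * (Real.tanh x - Real.tanh z)) by ring, abs_neg, abs_mul]
  refine mul_le_mul ?_ (abs_tanh_sub_tanh_le x z) (abs_nonneg _) (by norm_num)
  have := abs_add_le (Real.tanh x) (Real.tanh z)
  linarith [abs_tanh_le_one x, abs_tanh_le_one z]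

theorem abs_tanh_taylor_le (x a : ℝ) :
    |Real.tanh (x + a) - Real.tanh x - a * sechSq x| ≤ 2 * a ^ 2 := by
  have hd : ∀ b : ℝ, HasDerivAt (fun b => Real.tanh (x + b) - b * sechSq x)
      (sechSq (x + b) - sechSq x) b := by
    intro b
    have h1 : HasDerivAt (fun b => x + b) 1 b := (hasDerivAt_id b).const_add x
    have h2 := ((hasDerivAt_tanh (x + b)).comp b h1).sub ((hasDerivAt_id b).mul_const (sechSq x))
    refine h2.congr_deriv ?_
    ring
  have := Convex.norm_image_sub_le_of_norm_hasDerivWithin_le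
    (f := fun b => Real.tanh (x + b) - b * sechSq x)
    (f' := fun b => sechSq (x + b) - sechSq x) (C := 2 * |a|) (s := Set.Icc (-|a|) |a|)
    (fun b _ => (hd b).hasDerivWithinAt)
    (fun b hb => by
      have h := abs_sechSq_sub_sechSq_le (x + b) x
      rw [add_sub_cancel_left] at h
      exact h.trans (mul_le_mul_of_nonneg_left (abs_le.2 hb) (by norm_num)))
    (convex_Icc _ _) (x := 0) (y := a) ⟨by simp, abs_nonneg a⟩ ⟨neg_abs_le a, le_abs_self a⟩
  simp only [add_zero, zero_mul, sub_zero, Real.norm_eq_abs] at this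
  rw [mul_assoc, ← pow_two, sq_abs] at this
  rwa [show Real.tanh (x + a) - Real.tanh x - a * sechSq x =
    Real.tanh (x + a) - a * sechSq x - Real.tanh x by ring]

/-- The normalized sum of `tanh h_i` over the clique. -/
def tanhSum {n : ℕ} (S : Finset (Fin n)) (h : Fin n → ℝ) : ℝ :=
  (∑ i ∈ S, Real.tanh (h i)) / Real.sqrt S.card

/-- The mean of `sech² h_i` over the clique. -/
def sechSqMean {n : ℕ} (S : Finset (Fin n)) (h : Fin n → ℝ) : ℝ :=
  (∑ i ∈ S, sechSq (h i)) / S.card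

theorem sqrt_div_mul_sum_tanh {n : ℕ} {θ : ℝ} (hθ : 0 ≤ θ) (S : Finset (Fin n))
    (h : Fin n → ℝ) :
    Real.sqrt (θ / S.card) * ∑ i ∈ S, Real.tanh (h i) = Real.sqrt θ * tanhSum S h := by
  rw [Real.sqrt_div hθ, tanhSum]
  ring

/-- Taylor expansion of each tanh: the k remainders of size 2(sy)², times the prefactor s, sum to 2θ
s y² because s²k = θ, and s = √θ/√k. -/
theorem abs_fieldTiltDeriv_sub_le {n : ℕ} {θ : ℝ} (hθ : 0 ≤ θ) {S : Finset (Fin n)}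
    (hS : 0 < S.card) (h : Fin n → ℝ) (y : ℝ) :
    |fieldTiltDeriv S h (Real.sqrt (θ / S.card)) y - Real.sqrt θ * tanhSum S h -
        θ * sechSqMean S h * y| ≤ 2 * Real.sqrt θ ^ 3 * y ^ 2 / Real.sqrt S.card := by
  have hk : (0 : ℝ) < S.card := by exact_mod_cast hS
  set s := Real.sqrt (θ / S.card) with hs
  have hs0 : 0 ≤ s := Real.sqrt_nonneg _
  have hs2 : s ^ 2 * S.card = θ := by
    rw [hs, Real.sq_sqrt (by positivity)]; field_simp
  have hsk : s = Real.sqrt θ / Real.sqrt S.card := Real.sqrt_div hθ _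
  have e : fieldTiltDeriv S h s y - Real.sqrt θ * tanhSum S h - θ * sechSqMean S h * y =
      s * ∑ i ∈ S, (Real.tanh (h i + s * y) - Real.tanh (h i) - s * y * sechSq (h i)) := by
    rw [← sqrt_div_mul_sum_tanh hθ, fieldTiltDeriv, Finset.sum_sub_distrib,
      Finset.sum_sub_distrib, ← Finset.mul_sum, sechSqMean]
    have : θ * ((∑ i ∈ S, sechSq (h i)) / S.card) * y = s ^ 2 * (∑ i ∈ S, sechSq (h i)) * y := by
      rw [← hs2]; field_simp
    rw [this]
    ring
  rw [e, abs_mul, abs_of_nonneg hs0]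
  calc s * |∑ i ∈ S, (Real.tanh (h i + s * y) - Real.tanh (h i) - s * y * sechSq (h i))|
      ≤ s * ∑ i ∈ S, 2 * (s * y) ^ 2 := by
        refine mul_le_mul_of_nonneg_left ?_ hs0
        exact (Finset.abs_sum_le_sum_abs _ _).trans
          (Finset.sum_le_sum fun i _ => abs_tanh_taylor_le _ _)
    _ = 2 * (s ^ 2 * S.card) * s * y ^ 2 := by
        rw [Finset.sum_const, nsmul_eq_mul]; ring
    _ = 2 * Real.sqrt θ ^ 3 * y ^ 2 / Real.sqrt S.card := by
        rw [hs2, hsk]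
        have : Real.sqrt θ ^ 3 = θ * Real.sqrt θ := by
          rw [pow_succ, Real.sq_sqrt hθ]
        rw [this]; ring

/-- In the application t = √θ, a = |ξ|, b = |y|, r = √k, and D is the deviation of the empirical
mean of sech² from q. Young's inequality reduces everything to fourth powers; as D is typically of
order 1/r, the term r D² is also of order 1/r. -/
theorem remainder_le {t a b r D R : ℝ} (ht : 0 ≤ t) (ha : 0 ≤ a) (hb : 0 ≤ b) (hr : 0 < r)
    (hR : R ≤ 2 * t ^ 3 * b ^ 2 / r + t ^ 2 * b * D) :
    (t * a + b) * R ≤ (2 * t ^ 4 + 3 * t ^ 3 + t ^ 2) * ((1 + a ^ 4 + b ^ 4) / r + r * D ^ 2) := by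
  have h1 : a * b ^ 2 ≤ 1 + a ^ 4 + b ^ 4 := by
    nlinarith [sq_nonneg (a - b ^ 2), sq_nonneg (a ^ 2 - 1), sq_nonneg (b ^ 2), sq_nonneg a]
  have h2 : b ^ 3 ≤ 1 + a ^ 4 + b ^ 4 := by
    nlinarith [sq_nonneg (b ^ 2 - b), sq_nonneg (b ^ 2 - 1), sq_nonneg (a ^ 2), sq_nonneg (b - 1)]
  have hyoung : ∀ p : ℝ, p * D ≤ (p ^ 2 / r + r * D ^ 2) / 2 := by
    intro p
    have := sq_nonneg (p - r * D)
    rw [show p ^ 2 / r + r * D ^ 2 = (p ^ 2 + r ^ 2 * D ^ 2) / r by field_simp, div_div,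
      le_div_iff₀ (by positivity)]
    nlinarith
  have h3 : a * b * D ≤ (1 + a ^ 4 + b ^ 4) / r + r * D ^ 2 := by
    refine (hyoung (a * b)).trans ?_
    have : (a * b) ^ 2 / r ≤ (1 + a ^ 4 + b ^ 4) / r := by
      gcongr
      nlinarith [sq_nonneg (a ^ 2 - b ^ 2), sq_nonneg (a ^ 2), sq_nonneg (b ^ 2)]
    have : 0 ≤ (1 + a ^ 4 + b ^ 4) / r := by positivity
    have : 0 ≤ r * D ^ 2 := by positivity
    linarith
  have h4 : b ^ 2 * D ≤ (1 + a ^ 4 + b ^ 4) / r + r * D ^ 2 := by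
    refine (hyoung (b ^ 2)).trans ?_
    have : (b ^ 2) ^ 2 / r ≤ (1 + a ^ 4 + b ^ 4) / r := by
      gcongr
      nlinarith [sq_nonneg (a ^ 2)]
    have : 0 ≤ (1 + a ^ 4 + b ^ 4) / r := by positivity
    have : 0 ≤ r * D ^ 2 := by positivity
    linarith
  set A := (1 + a ^ 4 + b ^ 4) / r with hA
  have h1' : a * b ^ 2 / r ≤ A := by rw [hA]; gcongr
  have h2' : b ^ 3 / r ≤ A := by rw [hA]; gcongr
  have hX : 0 ≤ r * D ^ 2 := by positivity
  calc (t * a + b) * R ≤ (t * a + b) * (2 * t ^ 3 * b ^ 2 / r + t ^ 2 * b * D) := by gcongr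
    _ = 2 * t ^ 4 * (a * b ^ 2 / r) + 2 * t ^ 3 * (b ^ 3 / r) + t ^ 3 * (a * b * D) +
        t ^ 2 * (b ^ 2 * D) := by ring
    _ ≤ 2 * t ^ 4 * (A + r * D ^ 2) + 2 * t ^ 3 * (A + r * D ^ 2) + t ^ 3 * (A + r * D ^ 2) +
        t ^ 2 * (A + r * D ^ 2) := by
        gcongr <;> linarith
    _ = _ := by ring

/-- Approximate formula for the second moment of the auxiliary Gaussian variable. -/
theorem abs_secondMoment_sub_le {n : ℕ} {θ q : ℝ} (hθ : 0 ≤ θ) (hq : 0 ≤ q) (hθq : θ * q ≤ 1)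
    {S : Finset (Fin n)} (hS : 0 < S.card) (h : Fin n → ℝ) :
    |(1 - θ * q) ^ 2 * gibbsAvg θ S h (fun σ => 1 + θ * pairStat S σ) - (1 - θ * q) -
        θ * tanhSum S h ^ 2| ≤
      (2 * Real.sqrt θ ^ 4 + 3 * Real.sqrt θ ^ 3 + Real.sqrt θ ^ 2) *
        ((1 + tanhSum S h ^ 4 + fourthMoment θ S h) / Real.sqrt S.card +
          Real.sqrt S.card * (sechSqMean S h - q) ^ 2) := by
  have hk : (0 : ℝ) < S.card := by exact_mod_cast hS
  set s := Real.sqrt (θ / S.card) with hs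
  have hs0 : 0 ≤ s := Real.sqrt_nonneg _
  set t := Real.sqrt θ with htdef
  have ht : 0 ≤ t := Real.sqrt_nonneg _
  have ht2 : t ^ 2 = θ := Real.sq_sqrt hθ
  set r := Real.sqrt S.card with hrdef
  have hr : 0 < r := Real.sqrt_pos.2 hk
  set ξ := tanhSum S h
  set ρ := tiltedDensity (fieldTilt S h s) with hρ
  set L' := fieldTiltDeriv S h s with hL'
  have hT := isTilt_fieldTilt S h hs0
  have hZ1 : 1 ≤ ∫ y, ρ y := one_le_integral_tiltedDensity hθ S h
  set Z := ∫ y, ρ y with hZdef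
  have hZ : 0 < Z := by linarith
  have m2 : ∫ y, y ^ 2 * ρ y = _ := integral_sq_tiltedDensity hθ S h
  have m4 : ∫ y, y ^ 4 * ρ y = _ := integral_pow_four_tiltedDensity hθ S h
  rw [← hs, ← hρ, ← hZdef] at m2 m4
  set A := gibbsAvg θ S h (fun σ => 1 + θ * pairStat S σ)
  set Q := fourthMoment θ S h
  have p0 := hT.integral_pow_succ (n := 0) (by norm_num)
  have p1 := hT.integral_pow_succ (n := 1) (by norm_num)
  rw [← hρ, ← hL'] at p0 p1
  norm_num at p0 p1
  rw [← hZdef, m2] at p1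
  have i0 : Integrable ρ := hT.integrable_density
  have i1 : Integrable fun y => y * ρ y := by simpa using hT.integrable_pow (n := 1) (by norm_num)
  have i2 : Integrable fun y => y ^ 2 * ρ y := hT.integrable_pow (by norm_num)
  have i4 : Integrable fun y => y ^ 4 * ρ y := hT.integrable_pow le_rfl
  have j0 : Integrable fun y => L' y * ρ y := by
    simpa using hT.integrable_pow_mul_deriv (n := 0) (by norm_num)
  have j1 : Integrable fun y => y * L' y * ρ y := by
    simpa using hT.integrable_pow_mul_deriv (n := 1) (by norm_num)
  set R : ℝ → ℝ := fun y => L' y - t * ξ - θ * q * y with hR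
  set c := 1 - θ * q with hc
  have hc0 : 0 ≤ c := by rw [hc]; linarith
  have hc1 : c ≤ 1 := by
    have : 0 ≤ θ * q := mul_nonneg hθ hq
    rw [hc]; linarith
  -- Here R is the error in the linear approximation of L'. Weighting it by tξ and by c y combines
  -- the two integrations by parts so that the first moment of y cancels, leaving c² E[y²] - c -
  -- θξ².
  have hsplit : ∀ y, (t * ξ * R y + c * (y * R y)) * ρ y =
      t * ξ * (L' y * ρ y) - t * ξ * (t * ξ) * ρ y - t * ξ * (θ * q) * (y * ρ y) +
        c * (y * L' y * ρ y) - c * (t * ξ) * (y * ρ y) - c * (θ * q) * (y ^ 2 * ρ y) := by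
    intro y
    simp only [hR]
    ring
  have k1 : Integrable fun y => t * ξ * (L' y * ρ y) - t * ξ * (t * ξ) * ρ y :=
    (j0.const_mul _).sub (i0.const_mul _)
  have k2 : Integrable fun y => t * ξ * (L' y * ρ y) - t * ξ * (t * ξ) * ρ y -
      t * ξ * (θ * q) * (y * ρ y) := k1.sub (i1.const_mul _)
  have k3 : Integrable fun y => t * ξ * (L' y * ρ y) - t * ξ * (t * ξ) * ρ y -
      t * ξ * (θ * q) * (y * ρ y) + c * (y * L' y * ρ y) := k2.add (j1.const_mul _)
  have k4 : Integrable fun y => t * ξ * (L' y * ρ y) - t * ξ * (t * ξ) * ρ y -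
      t * ξ * (θ * q) * (y * ρ y) + c * (y * L' y * ρ y) - c * (t * ξ) * (y * ρ y) :=
    k3.sub (i1.const_mul _)
  have h_int : ∫ y, (t * ξ * R y + c * (y * R y)) * ρ y = (c ^ 2 * A - c - θ * ξ ^ 2) * Z := by
    simp only [hsplit]
    rw [integral_sub k4 (i2.const_mul _), integral_sub k3 (i1.const_mul _),
      integral_add k2 (j1.const_mul _), integral_sub k1 (i1.const_mul _),
      integral_sub (j0.const_mul _) (i0.const_mul _)]
    simp only [integral_const_mul]
    rw [← hZdef, m2, ← p0, show ∫ y, y * L' y * ρ y = A * Z - Z by linarith]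
    rw [← ht2] at hc ⊢
    rw [hc]
    ring
  set D := |sechSqMean S h - q| with hD
  have hD2 : (sechSqMean S h - q) ^ 2 = D ^ 2 := (sq_abs _).symm
  set E := 2 * t ^ 4 + 3 * t ^ 3 + t ^ 2 with hE
  have hE0 : 0 ≤ E := by positivity
  have hRle : ∀ y, |R y| ≤ 2 * t ^ 3 * |y| ^ 2 / r + t ^ 2 * |y| * D := by
    intro y
    have e : R y = (L' y - t * ξ - θ * sechSqMean S h * y) +
        θ * y * (sechSqMean S h - q) := by simp only [hR]; ring
    rw [e]
    refine (abs_add_le _ _).trans (add_le_add ?_ ?_)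
    · rw [sq_abs]; exact abs_fieldTiltDeriv_sub_le hθ hS h y
    · rw [abs_mul, abs_mul, abs_of_nonneg hθ, ht2]
  have hpt : ∀ y, ‖(t * ξ * R y + c * (y * R y)) * ρ y‖ ≤
      (E * ((1 + ξ ^ 4) / r + r * D ^ 2)) * ρ y + E / r * (y ^ 4 * ρ y) := by
    intro y
    have hρ0 : 0 < ρ y := tiltedDensity_pos _ y
    have e4 : ∀ x : ℝ, |x| ^ 4 = x ^ 4 := fun x => by
      rw [show (4 : ℕ) = 2 * 2 by norm_num, pow_mul, sq_abs, pow_mul]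
    have h1 := remainder_le ht (abs_nonneg ξ) (abs_nonneg y) hr (hRle y)
    rw [norm_mul, Real.norm_of_nonneg hρ0.le, Real.norm_eq_abs]
    have h2 : |t * ξ * R y + c * (y * R y)| ≤ (t * |ξ| + |y|) * |R y| := by
      refine (abs_add_le _ _).trans ?_
      rw [abs_mul, abs_mul, abs_mul, abs_mul, abs_of_nonneg ht, abs_of_nonneg hc0, add_mul]
      have : c * (|y| * |R y|) ≤ |y| * |R y| :=
        mul_le_of_le_one_left (by positivity) hc1
      linarith
    rw [e4, e4] at h1
    calc |t * ξ * R y + c * (y * R y)| * ρ y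
        ≤ (E * ((1 + ξ ^ 4 + y ^ 4) / r + r * D ^ 2)) * ρ y :=
          mul_le_mul_of_nonneg_right (h2.trans h1) hρ0.le
      _ = _ := by ring
  have k6 : Integrable fun y => (E * ((1 + ξ ^ 4) / r + r * D ^ 2)) * ρ y +
      E / r * (y ^ 4 * ρ y) := (i0.const_mul _).add (i4.const_mul _)
  have hfin := norm_integral_le_of_norm_le k6 (ae_of_all _ hpt)
  have hadd : ∫ y, ((E * ((1 + ξ ^ 4) / r + r * D ^ 2)) * ρ y + E / r * (y ^ 4 * ρ y)) =
      (E * ((1 + ξ ^ 4) / r + r * D ^ 2)) * Z + E / r * (Q * Z) := by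
    rw [integral_add (i0.const_mul _) (i4.const_mul _), integral_const_mul, integral_const_mul,
      ← hZdef, m4]
  rw [hadd, h_int, norm_mul, Real.norm_of_nonneg hZ.le, Real.norm_eq_abs] at hfin
  rw [hD2]
  refine le_of_mul_le_mul_right (hfin.trans (le_of_eq ?_)) hZ
  ring

/-! ### The fourth moment for a good field -/

theorem integrable_pow_four_mul_exp_neg {δ : ℝ} (hδ : 0 < δ) :
    Integrable fun y : ℝ => y ^ 4 * Real.exp (-δ * y ^ 2) := by
  have := integrable_rpow_mul_exp_neg_mul_sq hδ (s := (4 : ℕ)) (by norm_num)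
  simpa only [Real.rpow_natCast] using this

theorem cube_mul_le {b u ε : ℝ} (hb : 0 ≤ b) (hu : 0 ≤ u) (hε : 0 < ε) :
    b ^ 3 * u ≤ ε * b ^ 4 + u ^ 4 / ε ^ 3 := by
  rcases le_total u (ε * b) with h | h
  · have h1 : b ^ 3 * u ≤ b ^ 3 * (ε * b) := by gcongr
    have : 0 ≤ u ^ 4 / ε ^ 3 := by positivity
    nlinarith
  · have h1 : (ε * b) ^ 3 * u ≤ u ^ 3 * u := by gcongr
    have h2 : b ^ 3 * u ≤ u ^ 4 / ε ^ 3 := by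
      rw [le_div_iff₀ (by positivity)]
      nlinarith
    have : 0 ≤ ε * b ^ 4 := by positivity
    linarith

/-- Integration by parts gives E[y⁴] = 3 E[y²] + E[y³ L'(y)]. In the window |y| ≤ r√k the slope
bound 1 - c lets y⁴ be absorbed on the left; outside it |L'| ≤ √θ √k ≤ (√θ/r)|y|, and the density is
at most exp(-δy²). All constants are independent of k. -/
theorem fourthMoment_le_of_good {θ c r δ : ℝ} (hθ : 0 ≤ θ) (hc0 : 0 < c) (hc1 : c ≤ 1)
    (hr : 0 < r) (hδ : 0 < δ) :
    ∃ C : ℝ, 0 ≤ C ∧ ∀ (n : ℕ) (S : Finset (Fin n)) (h : Fin n → ℝ), 0 < S.card →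
      (∀ y, |y| ≤ r * Real.sqrt S.card →
        y * fieldTiltDeriv S h (Real.sqrt (θ / S.card)) y ≤
          Real.sqrt θ * |tanhSum S h| * |y| + (1 - c) * y ^ 2) →
      (∀ y, r * Real.sqrt S.card ≤ |y| →
        fieldTilt S h (Real.sqrt (θ / S.card)) y ≤ (1 / 2 - δ) * y ^ 2) →
      fourthMoment θ S h ≤ C * (1 + tanhSum S h ^ 4) := by
  set t := Real.sqrt θ with ht
  have ht0 : 0 ≤ t := Real.sqrt_nonneg _
  set I := ∫ y : ℝ, y ^ 4 * Real.exp (-δ * y ^ 2) with hI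
  have hI0 : 0 ≤ I := integral_nonneg fun y => by positivity
  set C₂ := 9 / c + t ^ 4 / (c / 4) ^ 3 with hC₂
  have hC₂0 : 0 ≤ C₂ := by positivity
  refine ⟨2 / c * (C₂ + t / r * I), by positivity, fun n S h hS hin hout => ?_⟩
  have hk : (0 : ℝ) < S.card := by exact_mod_cast hS
  set s := Real.sqrt (θ / S.card) with hs
  have hs0 : 0 ≤ s := Real.sqrt_nonneg _
  have hsk : s * S.card = t * Real.sqrt S.card := by
    rw [hs, Real.sqrt_div hθ, ← ht]
    have h1 : Real.sqrt S.card ≠ 0 := (Real.sqrt_pos.2 hk).ne'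
    field_simp
    rw [Real.sq_sqrt hk.le]
  have hT := isTilt_fieldTilt S h hs0
  set ξ := tanhSum S h
  set ρ := tiltedDensity (fieldTilt S h s) with hρ
  set L' := fieldTiltDeriv S h s
  have hZ1 : 1 ≤ ∫ y, ρ y := one_le_integral_tiltedDensity hθ S h
  have m4 : ∫ y, y ^ 4 * ρ y = _ := integral_pow_four_tiltedDensity hθ S h
  rw [← hs, ← hρ] at m4
  set Z := ∫ y, ρ y with hZdef
  have hZ : 0 < Z := by linarith
  set Q := fourthMoment θ S h
  have p3 := hT.integral_pow_succ (n := 3) le_rfl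
  rw [← hρ] at p3
  norm_num at p3
  have i0 : Integrable ρ := hT.integrable_density
  have i2 : Integrable fun y => y ^ 2 * ρ y := hT.integrable_pow (by norm_num)
  have i4 : Integrable fun y => y ^ 4 * ρ y := hT.integrable_pow le_rfl
  have j3 : Integrable fun y => y ^ 3 * L' y * ρ y := hT.integrable_pow_mul_deriv (by norm_num)
  have iI := integrable_pow_four_mul_exp_neg hδ
  have e4 : ∀ x : ℝ, |x| ^ 4 = x ^ 4 := fun x => by
    rw [show (4 : ℕ) = 2 * 2 by norm_num, pow_mul, sq_abs, pow_mul]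
  have hyoung : ∀ y : ℝ, 3 * y ^ 2 ≤ c / 4 * y ^ 4 + 9 / c := by
    intro y
    have : 0 ≤ (c * y ^ 2 / 2 - 3) ^ 2 / c := by positivity
    have e : (c * y ^ 2 / 2 - 3) ^ 2 / c = c / 4 * y ^ 4 - 3 * y ^ 2 + 9 / c := by
      field_simp; ring
    linarith
  -- Young's inequality spends c/4 on 3y² and c/4 on the cubic term in ξ, leaving the coefficient 1
  -- - c/2 of y⁴.
  have hpt : ∀ y, 3 * (y ^ 2 * ρ y) + y ^ 3 * L' y * ρ y ≤
      (1 - c / 2) * (y ^ 4 * ρ y) + C₂ * (1 + ξ ^ 4) * ρ y +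
        t / r * (y ^ 4 * Real.exp (-δ * y ^ 2)) := by
    intro y
    have hρ0 : 0 < ρ y := tiltedDensity_pos _ y
    have hy4 : 0 ≤ y ^ 4 := by positivity
    have hξ4 : 0 ≤ ξ ^ 4 := by positivity
    have ht4 : 0 ≤ t ^ 4 / (c / 4) ^ 3 := by positivity
    have hC : 9 / c + ξ ^ 4 * (t ^ 4 / (c / 4) ^ 3) ≤ C₂ * (1 + ξ ^ 4) := by
      have : 0 ≤ 9 / c * ξ ^ 4 := by positivity
      rw [hC₂]; linarith
    rcases le_total |y| (r * Real.sqrt S.card) with hy | hy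
    · have h1 := mul_le_mul_of_nonneg_left (hin y hy) (sq_nonneg y)
      have h2 := cube_mul_le (abs_nonneg y) (u := t * |ξ|) (by positivity)
        (by positivity : 0 < c / 4)
      rw [mul_pow, e4, e4] at h2
      have h3 : y ^ 2 * (t * |ξ| * |y|) = |y| ^ 3 * (t * |ξ|) := by
        rw [pow_succ |y| 2, sq_abs]; ring
      have h4 : 3 * y ^ 2 + y ^ 3 * L' y ≤ (1 - c / 2) * y ^ 4 + C₂ * (1 + ξ ^ 4) := by
        have e5 : t ^ 4 * ξ ^ 4 / (c / 4) ^ 3 = ξ ^ 4 * (t ^ 4 / (c / 4) ^ 3) := by ring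
        have := hyoung y
        linarith
      have h5 : 0 ≤ t / r * (y ^ 4 * Real.exp (-δ * y ^ 2)) := by positivity
      linarith [mul_le_mul_of_nonneg_right h4 hρ0.le]
    · have h1 : ρ y ≤ Real.exp (-δ * y ^ 2) := by
        apply Real.exp_le_exp.2
        linarith [hout y hy]
      have h2 : y ^ 3 * L' y ≤ t / r * y ^ 4 := by
        calc y ^ 3 * L' y ≤ |y ^ 3 * L' y| := le_abs_self _
          _ = |y| ^ 3 * |L' y| := by rw [abs_mul, abs_pow]
          _ ≤ |y| ^ 3 * (t * Real.sqrt S.card) := by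
              rw [← hsk]; gcongr; exact hT.abs_deriv_le y
          _ ≤ |y| ^ 3 * (t * (|y| / r)) := by
              gcongr; rw [le_div_iff₀ hr]; linarith
          _ = t / r * |y| ^ 4 := by ring
          _ = t / r * y ^ 4 := by rw [e4]
      have h3 : y ^ 3 * L' y * ρ y ≤ t / r * (y ^ 4 * Real.exp (-δ * y ^ 2)) := by
        calc y ^ 3 * L' y * ρ y ≤ t / r * y ^ 4 * ρ y := by gcongr
          _ ≤ t / r * y ^ 4 * Real.exp (-δ * y ^ 2) := by gcongr
          _ = _ := by ring
      have h4 : 3 * y ^ 2 ≤ (1 - c / 2) * y ^ 4 + C₂ * (1 + ξ ^ 4) := by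
        have h6 := hyoung y
        have h7 : 0 ≤ ξ ^ 4 * (t ^ 4 / (c / 4) ^ 3) := by positivity
        have h8 := mul_nonneg (by linarith : 0 ≤ 1 - 3 * c / 4) hy4
        linarith
      linarith [mul_le_mul_of_nonneg_right h4 hρ0.le]
  have l1 : Integrable fun y => 3 * (y ^ 2 * ρ y) + y ^ 3 * L' y * ρ y := (i2.const_mul _).add j3
  have l2 : Integrable fun y => (1 - c / 2) * (y ^ 4 * ρ y) + C₂ * (1 + ξ ^ 4) * ρ y :=
    (i4.const_mul _).add (i0.const_mul _)
  have l3 : Integrable fun y => (1 - c / 2) * (y ^ 4 * ρ y) + C₂ * (1 + ξ ^ 4) * ρ y +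
      t / r * (y ^ 4 * Real.exp (-δ * y ^ 2)) := l2.add (iI.const_mul _)
  have hmono := integral_mono l1 l3 hpt
  rw [integral_add (i2.const_mul _) j3, integral_add l2 (iI.const_mul _),
    integral_add (i4.const_mul _) (i0.const_mul _)] at hmono
  simp only [integral_const_mul] at hmono
  rw [← p3, m4, ← hI, ← hZdef] at hmono
  have hξ4 : 0 ≤ ξ ^ 4 := by positivity
  -- The contribution from outside the window lacks the normalization Z; it is inserted using Z ≥ 1.
  have h8 : t / r * I ≤ t / r * I * (1 + ξ ^ 4) * Z := by
    have : 0 ≤ t / r * I := by positivity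
    have h9 : t / r * I ≤ t / r * I * (1 + ξ ^ 4) := le_mul_of_one_le_right this (by linarith)
    exact h9.trans (le_mul_of_one_le_right (by positivity) hZ1)
  have h10 : c / 2 * Q * Z ≤ (C₂ + t / r * I) * (1 + ξ ^ 4) * Z := by linarith
  have h11 := le_of_mul_le_mul_right h10 hZ
  calc Q = 2 / c * (c / 2 * Q) := by field_simp
    _ ≤ 2 / c * ((C₂ + t / r * I) * (1 + ξ ^ 4)) := by gcongr
    _ = _ := by ring

/-- Inside the window |y| ≤ r√k the Taylor error y²/√k is at most r|y|, so it only raises the slope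
by a multiple of r. -/
theorem mul_fieldTiltDeriv_le {n : ℕ} {θ p r : ℝ} (hθ : 0 ≤ θ) {S : Finset (Fin n)}
    (hS : 0 < S.card) (h : Fin n → ℝ) (hp : sechSqMean S h ≤ p) {y : ℝ}
    (hy : |y| ≤ r * Real.sqrt S.card) :
    y * fieldTiltDeriv S h (Real.sqrt (θ / S.card)) y ≤
      Real.sqrt θ * |tanhSum S h| * |y| + θ * (p + 2 * Real.sqrt θ * r) * y ^ 2 := by
  have hk : (0 : ℝ) < S.card := by exact_mod_cast hS
  have hr0 : 0 < Real.sqrt S.card := Real.sqrt_pos.2 hk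
  have h1 := abs_fieldTiltDeriv_sub_le hθ hS h y
  set t := Real.sqrt θ with ht
  have ht0 : 0 ≤ t := Real.sqrt_nonneg _
  have ht2 : t ^ 2 = θ := Real.sq_sqrt hθ
  set L := fieldTiltDeriv S h (Real.sqrt (θ / S.card)) y
  set ξ := tanhSum S h
  have e : y * L = y * (L - t * ξ - θ * sechSqMean S h * y) + t * (ξ * y) +
      θ * sechSqMean S h * y ^ 2 := by ring
  have h2 : y * (L - t * ξ - θ * sechSqMean S h * y) ≤ θ * (2 * t * r) * y ^ 2 := by
    calc y * (L - t * ξ - θ * sechSqMean S h * y)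
        ≤ |y| * |L - t * ξ - θ * sechSqMean S h * y| := by rw [← abs_mul]; exact le_abs_self _
      _ ≤ (r * Real.sqrt S.card) * (2 * t ^ 3 * y ^ 2 / Real.sqrt S.card) := by
          gcongr
          exact (abs_nonneg y).trans hy
      _ = θ * (2 * t * r) * y ^ 2 := by
          rw [← ht2]; field_simp
  have h3 : t * (ξ * y) ≤ t * |ξ| * |y| := by
    rw [mul_assoc, ← abs_mul]
    exact mul_le_mul_of_nonneg_left (le_abs_self _) ht0
  have h4 : θ * sechSqMean S h * y ^ 2 ≤ θ * p * y ^ 2 := by gcongr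
  rw [e]
  linarith

/-! ### Concentration of the field -/

/-- The sum of the centered variables `g (h_i)` over the clique. -/
def centeredSum {n : ℕ} (μ : Measure ℝ) (g : ℝ → ℝ) (S : Finset (Fin n)) (h : Fin n → ℝ) : ℝ :=
  ∑ i ∈ S, (g (h i) - ∫ x, g x ∂μ)

theorem continuous_centeredSum {n : ℕ} (μ : Measure ℝ) {g : ℝ → ℝ} (hg : Continuous g)
    (S : Finset (Fin n)) : Continuous (centeredSum μ g S) := by
  unfold centeredSum
  fun_prop

theorem integrable_of_abs_le {μ : Measure ℝ} [IsProbabilityMeasure μ] {g : ℝ → ℝ}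
    (hg : Continuous g) {b : ℝ} (hb : ∀ x, |g x| ≤ b) : Integrable g μ :=
  Integrable.of_bound hg.aestronglyMeasurable b (ae_of_all _ hb)

theorem abs_integral_le_of_abs_le {μ : Measure ℝ} [IsProbabilityMeasure μ] {g : ℝ → ℝ} {b : ℝ}
    (hb : ∀ x, |g x| ≤ b) : |∫ x, g x ∂μ| ≤ b := by
  have := norm_integral_le_of_norm_le_const (μ := μ) (f := g) (C := b) (ae_of_all _ hb)
  simpa using this

theorem abs_centeredSum_le {n : ℕ} {μ : Measure ℝ} [IsProbabilityMeasure μ] {g : ℝ → ℝ} {b : ℝ}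
    (hb : ∀ x, |g x| ≤ b) (S : Finset (Fin n)) (h : Fin n → ℝ) :
    |centeredSum μ g S h| ≤ S.card * (2 * b) := by
  refine (Finset.abs_sum_le_sum_abs _ _).trans ?_
  rw [← nsmul_eq_mul]
  refine Finset.sum_le_card_nsmul _ _ _ fun i _ => ?_
  have h1 := abs_sub (g (h i)) (∫ x, g x ∂μ)
  linarith [hb (h i), abs_integral_le_of_abs_le (μ := μ) hb]

theorem integrable_exp_mul_centeredSum {n : ℕ} {μ : Measure ℝ} [IsProbabilityMeasure μ]
    {g : ℝ → ℝ} (hg : Continuous g) {b : ℝ} (hb : ∀ x, |g x| ≤ b) (S : Finset (Fin n)) (u : ℝ) :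
    Integrable (fun h => Real.exp (u * centeredSum μ g S h)) (Measure.pi fun _ : Fin n => μ) := by
  refine Integrable.of_bound (Real.continuous_exp.comp
    ((continuous_centeredSum μ hg S).const_mul u)).aestronglyMeasurable
    (Real.exp (|u| * (S.card * (2 * b)))) (ae_of_all _ fun h => ?_)
  rw [Real.norm_of_nonneg (Real.exp_pos _).le]
  apply Real.exp_le_exp.2
  refine (le_abs_self _).trans ?_
  rw [abs_mul]
  exact mul_le_mul_of_nonneg_left (abs_centeredSum_le hb S h) (abs_nonneg u)

theorem integral_pi_prod {n : ℕ} (μ : Measure ℝ) [IsProbabilityMeasure μ] (f : ℝ → ℝ)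
    (S : Finset (Fin n)) :
    ∫ h, ∏ i ∈ S, f (h i) ∂(Measure.pi fun _ : Fin n => μ) = (∫ x, f x ∂μ) ^ S.card := by
  have h1 : ∀ h : Fin n → ℝ, ∏ i ∈ S, f (h i) = ∏ i, (if i ∈ S then f else fun _ => 1) (h i) := by
    intro h
    rw [← Finset.univ_inter S, ← Finset.prod_ite_mem]
    refine Finset.prod_congr rfl fun i _ => ?_
    by_cases hi : i ∈ S <;> simp [hi]
  simp only [h1]
  rw [integral_fintype_prod_eq_prod (fun i => if i ∈ S then f else fun _ => 1)]
  have h2 : ∀ i, ∫ x, (if i ∈ S then f else fun _ => (1 : ℝ)) x ∂μ =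
      if i ∈ S then ∫ x, f x ∂μ else 1 := by
    intro i
    by_cases hi : i ∈ S <;> simp [hi]
  simp only [h2]
  rw [Finset.prod_ite_mem, Finset.univ_inter, Finset.prod_const]

theorem integral_exp_mul_centeredSum_le {n : ℕ} {μ : Measure ℝ} [IsProbabilityMeasure μ]
    {g : ℝ → ℝ} (hg : Continuous g) {b : ℝ} (hb : ∀ x, |g x| ≤ b) (S : Finset (Fin n)) {u : ℝ}
    (hu : |u| * (2 * b) ≤ 1) :
    ∫ h, Real.exp (u * centeredSum μ g S h) ∂(Measure.pi fun _ : Fin n => μ) ≤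
      Real.exp (S.card * (2 * u * b) ^ 2) := by
  have hprod : ∀ h : Fin n → ℝ, Real.exp (u * centeredSum μ g S h) =
      ∏ i ∈ S, Real.exp (u * (g (h i) - ∫ x, g x ∂μ)) := by
    intro h
    rw [← Real.exp_sum, centeredSum, Finset.mul_sum]
  simp only [hprod]
  rw [integral_pi_prod μ (fun x => Real.exp (u * (g x - ∫ x, g x ∂μ))), Real.exp_nat_mul]
  refine pow_le_pow_left₀ (integral_nonneg fun x => (Real.exp_pos _).le) ?_ _
  set e := ∫ x, g x ∂μ with he
  have hX : ∀ x, |u * (g x - e)| ≤ |u| * (2 * b) := by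
    intro x
    rw [abs_mul]
    have h1 := abs_sub (g x) e
    refine mul_le_mul_of_nonneg_left ?_ (abs_nonneg u)
    linarith [hb x, abs_integral_le_of_abs_le (μ := μ) hb]
  have hi := integrable_of_abs_le (μ := μ) hg hb
  have hlin : Integrable (fun x => u * (g x - e)) μ := (hi.sub (integrable_const e)).const_mul u
  calc ∫ x, Real.exp (u * (g x - e)) ∂μ
      ≤ ∫ x, (1 + (2 * u * b) ^ 2 + u * (g x - e)) ∂μ := by
        refine integral_mono_of_nonneg (ae_of_all _ fun x => (Real.exp_pos _).le)
          ((integrable_const _).add hlin) (ae_of_all _ fun x => ?_)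
        have h1 := (abs_le.1 (Real.abs_exp_sub_one_sub_id_le ((hX x).trans hu))).2
        have h2 : (u * (g x - e)) ^ 2 ≤ (2 * u * b) ^ 2 := by
          rw [← sq_abs]
          calc |u * (g x - e)| ^ 2 ≤ (|u| * (2 * b)) ^ 2 :=
                pow_le_pow_left₀ (abs_nonneg _) (hX x) 2
            _ = (2 * u * b) ^ 2 := by rw [mul_pow, sq_abs]; ring
        simp only
        linarith
    _ = 1 + (2 * u * b) ^ 2 := by
        rw [integral_add (integrable_const _) hlin, integral_const_mul,
          integral_sub hi (integrable_const e)]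
        simp [← he]
    _ ≤ Real.exp ((2 * u * b) ^ 2) := by
        linarith [Real.add_one_le_exp ((2 * u * b) ^ 2)]

theorem pow_four_le_exp (z : ℝ) : z ^ 4 ≤ 24 * (Real.exp z + Real.exp (-z)) := by
  have h4 := Real.pow_div_factorial_le_exp |z| (abs_nonneg z) 4
  have e : |z| ^ 4 = z ^ 4 := by
    rw [show (4 : ℕ) = 2 * 2 by norm_num, pow_mul, sq_abs, pow_mul]
  rw [e, show ((Nat.factorial 4 : ℕ) : ℝ) = 24 by norm_num [Nat.factorial]] at h4
  have : Real.exp |z| ≤ Real.exp z + Real.exp (-z) := by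
    rcases abs_cases z with ⟨hz, _⟩ | ⟨hz, _⟩ <;> rw [hz] <;>
      linarith [Real.exp_pos z, Real.exp_pos (-z)]
  linarith

theorem integrable_centeredSum_pow {n : ℕ} {μ : Measure ℝ} [IsProbabilityMeasure μ]
    {g : ℝ → ℝ} (hg : Continuous g) {b : ℝ} (hb : ∀ x, |g x| ≤ b) (S : Finset (Fin n)) (c : ℝ)
    (p : ℕ) : Integrable (fun h => (centeredSum μ g S h / c) ^ p)
      (Measure.pi fun _ : Fin n => μ) := by
  refine Integrable.of_bound (((continuous_centeredSum μ hg S).div_const c).pow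
    p).aestronglyMeasurable ((S.card * (2 * b) / |c|) ^ p) (ae_of_all _ fun h => ?_)
  rw [norm_pow, norm_div, Real.norm_eq_abs, Real.norm_eq_abs]
  have := abs_centeredSum_le (μ := μ) hb S h
  gcongr

theorem integral_centeredSum_pow_four_le {n : ℕ} {μ : Measure ℝ} [IsProbabilityMeasure μ]
    {g : ℝ → ℝ} (hg : Continuous g) (hb : ∀ x, |g x| ≤ 1) {S : Finset (Fin n)}
    (hS : 0 < S.card) :
    ∫ h, (centeredSum μ g S h / Real.sqrt S.card) ^ 4 ∂(Measure.pi fun _ : Fin n => μ) ≤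
      768 * Real.exp 1 := by
  have hk : (1 : ℝ) ≤ S.card := by exact_mod_cast hS
  have hr1 : 1 ≤ Real.sqrt S.card := by rwa [Real.one_le_sqrt]
  set r := Real.sqrt S.card with hr
  have hr2 : r ^ 2 = S.card := Real.sq_sqrt (by linarith)
  have hr0 : 0 < r := by linarith
  -- This u makes the exponent k(2u)² of the moment generating function equal to 1; since z⁴ ≤
  -- 24(e^z + e^(-z)), it also gives the constant 16 · 24 = 384.
  set u := 1 / (2 * r) with hu
  have hu0 : 0 < u := by positivity
  have hmgf : ∀ v : ℝ, |v| = u →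
      ∫ h, Real.exp (v * centeredSum μ g S h) ∂(Measure.pi fun _ : Fin n => μ) ≤ Real.exp 1 := by
    intro v hv
    refine (integral_exp_mul_centeredSum_le hg hb S ?_).trans (Real.exp_le_exp.2 ?_)
    · rw [hv, hu, show 1 / (2 * r) * (2 * 1) = 1 / r by field_simp, div_le_one hr0]
      exact hr1
    · rw [← hr2, mul_one, mul_pow, ← sq_abs v, hv, hu]
      apply le_of_eq
      field_simp
  have hi : ∀ v : ℝ, Integrable (fun h => Real.exp (v * centeredSum μ g S h))
      (Measure.pi fun _ : Fin n => μ) := integrable_exp_mul_centeredSum hg hb S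
  calc ∫ h, (centeredSum μ g S h / r) ^ 4 ∂(Measure.pi fun _ : Fin n => μ)
      ≤ ∫ h, 384 * (Real.exp (u * centeredSum μ g S h) + Real.exp (-u * centeredSum μ g S h))
          ∂(Measure.pi fun _ : Fin n => μ) := by
        refine integral_mono (integrable_centeredSum_pow hg hb S r 4)
          (((hi u).add (hi (-u))).const_mul 384) fun h => ?_
        have h1 := pow_four_le_exp (u * centeredSum μ g S h)
        have h2 : (centeredSum μ g S h / r) ^ 4 = 16 * (u * centeredSum μ g S h) ^ 4 := by
          rw [hu]; field_simp; norm_num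
        rw [neg_mul]
        simp only
        linarith
    _ ≤ 384 * (Real.exp 1 + Real.exp 1) := by
        rw [integral_const_mul, integral_add (hi u) (hi (-u))]
        have h1 := hmgf u (abs_of_pos hu0)
        have h2 := hmgf (-u) (by rw [abs_neg, abs_of_pos hu0])
        gcongr
    _ = 768 * Real.exp 1 := by ring

/-- Chernoff bound kept as an integral: the integrand majorizes the indicator of the deviation event
and can be summed directly. The choice of u makes the quadratic term k(2ub)² at most half of ukε. -/
theorem integral_exp_deviation_le {μ : Measure ℝ} [IsProbabilityMeasure μ]
    {g : ℝ → ℝ} (hg : Continuous g) {b ε : ℝ} (hb0 : 0 < b) (hb : ∀ x, |g x| ≤ b) (hε : 0 < ε) :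
    ∃ u w : ℝ, 0 < u ∧ 0 < w ∧ ∀ (n : ℕ) (S : Finset (Fin n)),
      (∫ h, Real.exp (u * centeredSum μ g S h) ∂(Measure.pi fun _ : Fin n => μ)) *
        Real.exp (-(u * (S.card * ε))) ≤ Real.exp (-(w * S.card)) := by
  set u := min (1 / (2 * b)) (ε / (8 * b ^ 2)) with hu
  have hu0 : 0 < u := by positivity
  have hu1 : u * (2 * b) ≤ 1 := by
    rw [← le_div_iff₀ (by positivity)]; exact min_le_left _ _
  have hu2 : u * (8 * b ^ 2) ≤ ε := by
    rw [← le_div_iff₀ (by positivity)]; exact min_le_right _ _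
  refine ⟨u, u * ε / 2, hu0, by positivity, fun n S => ?_⟩
  have h1 := integral_exp_mul_centeredSum_le (μ := μ) hg hb S (u := u)
    (by rwa [abs_of_pos hu0])
  calc _ ≤ Real.exp (S.card * (2 * u * b) ^ 2) * Real.exp (-(u * (S.card * ε))) :=
        mul_le_mul_of_nonneg_right h1 (Real.exp_pos _).le
    _ ≤ Real.exp (-(u * ε / 2 * S.card)) := by
        rw [← Real.exp_add]
        apply Real.exp_le_exp.2
        have h2 : u * (u * (8 * b ^ 2)) ≤ u * ε := by gcongr
        have h3 : (S.card : ℝ) * (u * (u * (8 * b ^ 2))) ≤ S.card * (u * ε) := by gcongr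
        linarith

/-! ### The normalized sums of `tanh h_i` and `sech² h_i` -/

theorem integral_tanh_eq_zero (μ : Measure ℝ) (hsymm : μ.map (fun h => -h) = μ) :
    ∫ x, Real.tanh x ∂μ = 0 := by
  have h1 : ∫ x, Real.tanh x ∂μ = ∫ x, Real.tanh (-x) ∂μ := by
    conv_lhs => rw [← hsymm]
    exact integral_map measurable_neg.aemeasurable continuous_tanh.aestronglyMeasurable
  simp only [Real.tanh_neg] at h1
  rw [integral_neg] at h1
  linarith

theorem tanhSum_eq {n : ℕ} (μ : Measure ℝ) (hsymm : μ.map (fun h => -h) = μ)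
    (S : Finset (Fin n)) (h : Fin n → ℝ) :
    tanhSum S h = centeredSum μ Real.tanh S h / Real.sqrt S.card := by
  rw [tanhSum, centeredSum, integral_tanh_eq_zero μ hsymm]
  simp

/-- Off-diagonal terms vanish by reversing one field, and the diagonal ones equal E[tanh²] = 1 -
E[sech²]. -/
theorem integral_tanhSum_sq {n : ℕ} (μ : Measure ℝ) [IsProbabilityMeasure μ]
    (hsymm : μ.map (fun h => -h) = μ) {S : Finset (Fin n)} (hS : 0 < S.card) :
    ∫ h, tanhSum S h ^ 2 ∂(Measure.pi fun _ : Fin n => μ) = 1 - meanSechSq μ := by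
  have hk : (0 : ℝ) < S.card := by exact_mod_cast hS
  set π := Measure.pi fun _ : Fin n => μ
  have hcont : ∀ i j : Fin n, Continuous fun h : Fin n → ℝ => Real.tanh (h i) * Real.tanh (h j) :=
    fun i j => by have := continuous_tanh; fun_prop
  have h_int : ∀ i j : Fin n, Integrable (fun h => Real.tanh (h i) * Real.tanh (h j)) π := by
    intro i j
    refine Integrable.of_bound (hcont i j).aestronglyMeasurable 1 (ae_of_all _ fun h => ?_)
    rw [norm_mul, Real.norm_eq_abs, Real.norm_eq_abs]
    exact mul_le_one₀ (abs_tanh_le_one _) (abs_nonneg _) (abs_tanh_le_one _)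
  have hsq : ∫ x, Real.tanh x * Real.tanh x ∂μ = 1 - meanSechSq μ := by
    have h1 : ∀ x, Real.tanh x * Real.tanh x = 1 - sechSq x := fun x => by
      rw [sechSq_eq]; ring
    simp only [h1]
    rw [integral_sub (integrable_const _) (integrable_of_abs_le continuous_sechSq (b := 1)
      fun x => by rw [abs_of_pos (sechSq_pos x)]; exact sechSq_le_one x)]
    simp [meanSechSq, sechSq]
  have hcorr : ∀ i j : Fin n, ∫ h, Real.tanh (h i) * Real.tanh (h j) ∂π =
      if i = j then 1 - meanSechSq μ else 0 := by
    intro i j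
    by_cases hij : i = j
    · subst hij
      simp only [if_true]
      rw [← hsq]
      have hmp := measurePreserving_eval (fun _ : Fin n => μ) i
      conv_rhs => rw [← hmp.map_eq]
      exact (integral_map hmp.measurable.aemeasurable
        (continuous_tanh.mul continuous_tanh).aestronglyMeasurable).symm
    · have hmp := measurePreserving_negAt μ hsymm i
      have h1 : ∫ h, Real.tanh (h i) * Real.tanh (h j) ∂π =
          ∫ h, Real.tanh (negAt i h i) * Real.tanh (negAt i h j) ∂π := by
        change ∫ h, _ ∂(Measure.pi fun _ : Fin n => μ) = _
        conv_lhs => rw [← hmp.map_eq]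
        exact integral_map hmp.measurable.aemeasurable (hcont i j).aestronglyMeasurable
      simp only [negAt, if_true, Ne.symm hij, if_false, Real.tanh_neg, neg_mul] at h1
      rw [integral_neg] at h1
      simp only [hij, if_false]
      linarith
  have hexp : ∀ h : Fin n → ℝ, tanhSum S h ^ 2 =
      (∑ i ∈ S, ∑ j ∈ S, Real.tanh (h i) * Real.tanh (h j)) / S.card := by
    intro h
    rw [tanhSum, div_pow, Real.sq_sqrt hk.le, pow_two, Finset.sum_mul_sum]
  simp only [hexp]
  rw [integral_div, integral_finsetSum _ fun i _ => integrable_finsetSum _ fun j _ => h_int i j]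
  have h2 : ∀ i ∈ S, ∫ h, ∑ j ∈ S, Real.tanh (h i) * Real.tanh (h j) ∂π = 1 - meanSechSq μ := by
    intro i hi
    rw [integral_finsetSum _ fun j _ => h_int i j]
    simp [hcorr, hi]
  rw [Finset.sum_congr rfl h2, Finset.sum_const, nsmul_eq_mul]
  field_simp

theorem sechSqMean_sub_eq {n : ℕ} (μ : Measure ℝ) {S : Finset (Fin n)} (hS : 0 < S.card)
    (h : Fin n → ℝ) : sechSqMean S h - meanSechSq μ = centeredSum μ sechSq S h / S.card := by
  have hk : (0 : ℝ) < S.card := by exact_mod_cast hS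
  rw [sechSqMean, centeredSum, Finset.sum_sub_distrib, Finset.sum_const, nsmul_eq_mul,
    show meanSechSq μ = ∫ x, sechSq x ∂μ from rfl]
  field_simp

/-! ### The free energy and its empirical version -/

/-- The integrand of the mean-field free energy. -/
def energyGain (θ x h : ℝ) : ℝ := logCosh (Real.sqrt θ * x + h) - logCosh h

theorem freeEnergy_eq (μ : Measure ℝ) (θ x : ℝ) :
    freeEnergy μ θ x = x ^ 2 / 2 - ∫ h, energyGain θ x h ∂μ := rfl

theorem freeEnergy_zero (μ : Measure ℝ) (θ : ℝ) : freeEnergy μ θ 0 = 0 := by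
  simp [freeEnergy]

theorem continuous_logCosh : Continuous logCosh :=
  continuous_iff_continuousAt.2 fun x => (hasDerivAt_logCosh x).continuousAt

theorem abs_logCosh_sub_le (x z : ℝ) : |logCosh x - logCosh z| ≤ |x - z| := by
  have := Convex.norm_image_sub_le_of_norm_hasDerivWithin_le (f := logCosh) (f' := Real.tanh)
    (C := 1) (s := Set.univ) (fun x _ => (hasDerivAt_logCosh x).hasDerivWithinAt)
    (fun x _ => abs_tanh_le_one x) convex_univ (Set.mem_univ z) (Set.mem_univ x)
  simpa using this

theorem continuous_energyGain (θ x : ℝ) : Continuous (energyGain θ x) := by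
  have := continuous_logCosh
  unfold energyGain
  fun_prop

theorem abs_energyGain_sub_le (θ x z h : ℝ) :
    |energyGain θ x h - energyGain θ z h| ≤ Real.sqrt θ * |x - z| := by
  rw [energyGain, energyGain, sub_sub_sub_cancel_right]
  refine (abs_logCosh_sub_le _ _).trans (le_of_eq ?_)
  rw [add_sub_add_right_eq_sub, ← mul_sub, abs_mul, abs_of_nonneg (Real.sqrt_nonneg _)]

theorem abs_energyGain_le (θ x h : ℝ) : |energyGain θ x h| ≤ Real.sqrt θ * |x| := by
  have := abs_energyGain_sub_le θ x 0 h
  simpa [energyGain] using this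

theorem integrable_energyGain (μ : Measure ℝ) [IsProbabilityMeasure μ] (θ x : ℝ) :
    Integrable (energyGain θ x) μ :=
  integrable_of_abs_le (continuous_energyGain θ x) (abs_energyGain_le θ x)

theorem abs_integral_energyGain_sub_le (μ : Measure ℝ) [IsProbabilityMeasure μ] (θ x z : ℝ) :
    |∫ h, energyGain θ x h ∂μ - ∫ h, energyGain θ z h ∂μ| ≤ Real.sqrt θ * |x - z| := by
  rw [← integral_sub (integrable_energyGain μ θ x) (integrable_energyGain μ θ z)]
  exact abs_integral_le_of_abs_le (abs_energyGain_sub_le θ x z)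

theorem continuous_freeEnergy (μ : Measure ℝ) [IsProbabilityMeasure μ] (θ : ℝ) :
    Continuous (freeEnergy μ θ) := by
  have h1 : Continuous fun x => ∫ h, energyGain θ x h ∂μ := by
    refine (LipschitzWith.of_dist_le_mul (K := ⟨Real.sqrt θ, Real.sqrt_nonneg θ⟩)
      fun x z => ?_).continuous
    exact abs_integral_energyGain_sub_le μ θ x z
  have : freeEnergy μ θ = fun x => x ^ 2 / 2 - ∫ h, energyGain θ x h ∂μ :=
    funext (freeEnergy_eq μ θ)
  rw [this]
  fun_prop

theorem exists_freeEnergy_gap (μ : Measure ℝ) [IsProbabilityMeasure μ] {θ : ℝ}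
    (hmin : ZeroUniqueMinimizer μ θ) {r : ℝ} (hr : 0 < r) (R : ℝ) :
    ∃ ε : ℝ, 0 < ε ∧ ∀ x, r ≤ |x| → |x| ≤ R → ε ≤ freeEnergy μ θ x := by
  set K : Set ℝ := {x | r ≤ |x|} ∩ Metric.closedBall 0 R
  have hK : IsCompact K := (isCompact_closedBall 0 R).inter_left
    (isClosed_le continuous_const continuous_abs)
  rcases K.eq_empty_or_nonempty with hE | hne
  · refine ⟨1, one_pos, fun x h1 h2 => ?_⟩
    have : x ∈ K := ⟨h1, by simpa using h2⟩
    rw [hE] at this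
    exact this.elim
  · obtain ⟨z, hz, hzmin⟩ := hK.exists_isMinOn hne (continuous_freeEnergy μ θ).continuousOn
    have hz0 : z ≠ 0 := by
      rintro rfl
      have : r ≤ |(0 : ℝ)| := hz.1
      rw [abs_zero] at this
      linarith
    refine ⟨freeEnergy μ θ z, ?_, fun x h1 h2 => hzmin ⟨h1, by simpa using h2⟩⟩
    have := hmin z hz0
    rwa [freeEnergy_zero] at this

theorem fieldTilt_eq_sum_energyGain {n : ℕ} {θ : ℝ} (hθ : 0 ≤ θ) (S : Finset (Fin n))
    (h : Fin n → ℝ) (y : ℝ) :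
    fieldTilt S h (Real.sqrt (θ / S.card)) y =
      ∑ i ∈ S, energyGain θ (y / Real.sqrt S.card) (h i) := by
  unfold fieldTilt energyGain
  refine Finset.sum_congr rfl fun i _ => ?_
  rw [Real.sqrt_div hθ, add_comm (h i), div_mul_eq_mul_div, mul_div_assoc]

/-- Away from `0`, the empirical free energy grows quadratically as soon as finitely many
empirical means do not exceed their expectations by much. -/
theorem exists_net_fieldTilt_le (μ : Measure ℝ) [IsProbabilityMeasure μ] {θ : ℝ} (hθ : 0 < θ)
    (hmin : ZeroUniqueMinimizer μ θ) {r : ℝ} (hr : 0 < r) :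
    ∃ (N : Finset ℝ) (ε δ : ℝ), 0 < ε ∧ 0 < δ ∧ ∀ (n : ℕ) (S : Finset (Fin n)) (h : Fin n → ℝ),
      0 < S.card → (∀ x ∈ N, centeredSum μ (energyGain θ x) S h ≤ S.card * ε) →
      ∀ y, r * Real.sqrt S.card ≤ |y| →
        fieldTilt S h (Real.sqrt (θ / S.card)) y ≤ (1 / 2 - δ) * y ^ 2 := by
  set t := Real.sqrt θ with ht
  have ht0 : 0 < t := Real.sqrt_pos.2 hθ
  -- Beyond |x| = 4√θ the trivial bound √θ|x| on the energy gain is at most x²/4, so a finite net is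
  -- needed only on a compact set.
  set R := 4 * t with hR
  have hR0 : 0 < R := by positivity
  obtain ⟨e, he0, he⟩ := exists_freeEnergy_gap μ hmin hr R
  -- The gap e = 4ε is spent as one ε for the empirical deviation, two for replacing x by a net
  -- point (in the empirical mean and in the expectation), and one for δx².
  set ε := e / 4 with hε
  have hε0 : 0 < ε := by positivity
  obtain ⟨N, -, hNfin, hN⟩ := (isCompact_closedBall (0 : ℝ) R).finite_cover_balls
    (e := ε / t) (by positivity)
  refine ⟨hNfin.toFinset, ε, min (1 / 4) (ε / R ^ 2), hε0, by positivity,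
    fun n S h hS hdev y hy => ?_⟩
  have hk : (0 : ℝ) < S.card := by exact_mod_cast hS
  have hr0 : 0 < Real.sqrt S.card := Real.sqrt_pos.2 hk
  set δ := min (1 / 4) (ε / R ^ 2)
  rw [fieldTilt_eq_sum_energyGain hθ.le]
  set x := y / Real.sqrt S.card with hx
  have hyx : y ^ 2 = S.card * x ^ 2 := by
    rw [hx, div_pow, Real.sq_sqrt hk.le]; field_simp
  have hrx : r ≤ |x| := by
    rw [hx, abs_div, abs_of_pos hr0, le_div_iff₀ hr0]; exact hy
  suffices hs : ∑ i ∈ S, energyGain θ x (h i) ≤ S.card * ((1 / 2 - δ) * x ^ 2) by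
    rw [hyx]; linarith
  rcases le_total |x| R with hxR | hxR
  · have hmem : x ∈ Metric.closedBall (0 : ℝ) R := by simpa using hxR
    obtain ⟨z, hzN, hxz⟩ := Set.mem_iUnion₂.1 (hN hmem)
    have hd : t * |x - z| ≤ ε := by
      have h1 : |x - z| < ε / t := hxz
      rw [lt_div_iff₀ ht0] at h1
      linarith
    have h1 : ∑ i ∈ S, energyGain θ x (h i) ≤ ∑ i ∈ S, (energyGain θ z (h i) + ε) := by
      refine Finset.sum_le_sum fun i _ => ?_
      have := (abs_le.1 (abs_energyGain_sub_le θ x z (h i))).2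
      linarith
    rw [Finset.sum_add_distrib, Finset.sum_const, nsmul_eq_mul] at h1
    have h2 := hdev z (hNfin.mem_toFinset.2 hzN)
    rw [centeredSum, Finset.sum_sub_distrib, Finset.sum_const, nsmul_eq_mul] at h2
    have h3 := (abs_le.1 (abs_integral_energyGain_sub_le μ θ x z)).1
    have h4 := he x hrx hxR
    rw [freeEnergy_eq] at h4
    have h5 : ∫ h, energyGain θ z h ∂μ ≤ x ^ 2 / 2 - 3 * ε := by
      have : e = 4 * ε := by rw [hε]; ring
      linarith
    have h6 : δ * x ^ 2 ≤ ε := by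
      have h7 : x ^ 2 ≤ R ^ 2 := by rw [← sq_abs x]; gcongr
      calc δ * x ^ 2 ≤ ε / R ^ 2 * R ^ 2 := by
            gcongr
            exact min_le_right _ _
        _ = ε := by field_simp
    have h8 : (S.card : ℝ) * (∫ h, energyGain θ z h ∂μ + 2 * ε) ≤
        S.card * ((1 / 2 - δ) * x ^ 2) := by
      gcongr
      linarith
    linarith
  · have h1 : ∑ i ∈ S, energyGain θ x (h i) ≤ ∑ i ∈ S, t * |x| :=
      Finset.sum_le_sum fun i _ => (le_abs_self _).trans (abs_energyGain_le θ x (h i))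
    rw [Finset.sum_const, nsmul_eq_mul] at h1
    refine h1.trans (mul_le_mul_of_nonneg_left ?_ hk.le)
    have h2 : δ ≤ 1 / 4 := min_le_left _ _
    have h3 : t * |x| ≤ 1 / 4 * x ^ 2 := by
      rw [← sq_abs x]
      nlinarith [abs_nonneg x]
    nlinarith [sq_nonneg x]

/-! ### Crude bounds for bad fields and the uniform fourth-moment estimate. -/

theorem spinSum_sq_le {n : ℕ} (S : Finset (Fin n)) (σ : Config n) :
    spinSum S σ ^ 2 ≤ (S.card : ℝ) ^ 2 := by
  have h1 : |spinSum S σ| ≤ S.card := by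
    refine (Finset.abs_sum_le_sum_abs _ _).trans (le_of_eq ?_)
    simp [abs_spin]
  rw [← sq_abs]
  gcongr

theorem pairStat_le {n : ℕ} (S : Finset (Fin n)) (σ : Config n) : pairStat S σ ≤ S.card := by
  rw [pairStat_eq]
  refine div_le_of_le_mul₀ (by positivity) (by positivity) ?_
  rw [← pow_two]
  exact spinSum_sq_le S σ

theorem fourthMoment_le {n : ℕ} {θ : ℝ} (hθ : 0 ≤ θ) (S : Finset (Fin n)) (h : Fin n → ℝ) :
    fourthMoment θ S h ≤ 3 + 6 * (θ * S.card) + (θ * S.card) ^ 2 := by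
  rw [← gibbsAvg_const θ S h (3 + 6 * (θ * S.card) + (θ * S.card) ^ 2)]
  refine gibbsAvg_mono θ S h fun σ => ?_
  have h1 := pairStat_le S σ
  have h0 := pairStat_nonneg S σ
  gcongr

theorem exists_quadratic_mul_exp_neg_le {θ w : ℝ} (hθ : 0 ≤ θ) (hw : 0 < w) :
    ∃ C : ℝ, 0 ≤ C ∧ ∀ x : ℝ, 0 ≤ x →
      (3 + 6 * (θ * x) + (θ * x) ^ 2) * Real.exp (-(w * x)) ≤ C := by
  refine ⟨3 + 6 * (θ / w) + 2 * (θ / w) ^ 2, by positivity, fun x hx => ?_⟩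
  have h1 := Real.quadratic_le_exp_of_nonneg (x := w * x) (by positivity)
  have h2 : 3 + 6 * (θ * x) + (θ * x) ^ 2 ≤
      (3 + 6 * (θ / w) + 2 * (θ / w) ^ 2) * Real.exp (w * x) := by
    have e : θ * x = θ / w * (w * x) := by field_simp
    have hy : 0 ≤ w * x := by positivity
    have hb : 0 ≤ θ / w := by positivity
    rw [e]
    set y := w * x
    set b := θ / w
    have a1 : 1 ≤ Real.exp y := Real.one_le_exp hy
    have a2 : y ≤ Real.exp y := by nlinarith [sq_nonneg y]
    have a3 : y ^ 2 ≤ 2 * Real.exp y := by nlinarith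
    have a4 : b * y ≤ b * Real.exp y := by gcongr
    have a5 : b ^ 2 * y ^ 2 ≤ b ^ 2 * (2 * Real.exp y) := by gcongr
    nlinarith
  rw [Real.exp_neg, ← div_eq_mul_inv, div_le_iff₀ (Real.exp_pos _)]
  exact h2

/-- Controls a bad event: the crude fourth-moment bound, quadratic in k, multiplied by an
exponential that is at least 1 on the event, stays bounded on average. -/
theorem exists_deviation_const {μ : Measure ℝ} [IsProbabilityMeasure μ] {g : ℝ → ℝ}
    (hg : Continuous g) {b : ℝ} (hb : ∀ x, |g x| ≤ b) {θ ε : ℝ} (hθ : 0 ≤ θ) (hε : 0 < ε) :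
    ∃ u C : ℝ, 0 < u ∧ 0 ≤ C ∧ ∀ (n : ℕ) (S : Finset (Fin n)),
      ∫ h, (3 + 6 * (θ * S.card) + (θ * S.card) ^ 2) *
        Real.exp (u * centeredSum μ g S h - u * (S.card * ε))
          ∂(Measure.pi fun _ : Fin n => μ) ≤ C := by
  have hb0 : 0 ≤ b := (abs_nonneg _).trans (hb 0)
  -- The bound b may vanish, as for the energy gain at x = 0, while a positive bound is required;
  -- hence b + 1.
  obtain ⟨u, w, hu, hw, huw⟩ := integral_exp_deviation_le (μ := μ) hg (b := b + 1)
    (by linarith) (fun x => (hb x).trans (by linarith)) hε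
  obtain ⟨C, hC0, hC⟩ := exists_quadratic_mul_exp_neg_le hθ hw
  refine ⟨u, C, hu, hC0, fun n S => ?_⟩
  refine le_trans ?_ (hC S.card (by positivity))
  rw [integral_const_mul]
  refine mul_le_mul_of_nonneg_left ?_ (by positivity)
  simp only [sub_eq_add_neg, Real.exp_add]
  rw [integral_mul_const]
  exact huw n S

theorem abs_sechSq_le_one (x : ℝ) : |sechSq x| ≤ 1 := by
  rw [abs_of_pos (sechSq_pos x)]; exact sechSq_le_one x

theorem integral_tanhSum_pow_four_le {n : ℕ} (μ : Measure ℝ) [IsProbabilityMeasure μ]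
    (hsymm : μ.map (fun h => -h) = μ) {S : Finset (Fin n)} (hS : 0 < S.card) :
    ∫ h, tanhSum S h ^ 4 ∂(Measure.pi fun _ : Fin n => μ) ≤ 768 * Real.exp 1 := by
  simp only [tanhSum_eq μ hsymm]
  exact integral_centeredSum_pow_four_le continuous_tanh abs_tanh_le_one hS

theorem integrable_tanhSum_pow {n : ℕ} (μ : Measure ℝ) [IsProbabilityMeasure μ]
    (hsymm : μ.map (fun h => -h) = μ) (S : Finset (Fin n)) (p : ℕ) :
    Integrable (fun h => tanhSum S h ^ p) (Measure.pi fun _ : Fin n => μ) := by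
  simp only [tanhSum_eq μ hsymm]
  exact integrable_centeredSum_pow continuous_tanh abs_tanh_le_one S _ p

/-- The fourth moment of the auxiliary Gaussian variable is bounded uniformly in the clique. -/
theorem exists_integral_fourthMoment_le (μ : Measure ℝ) [IsProbabilityMeasure μ]
    (hsymm : μ.map (fun h => -h) = μ) {θ : ℝ} (hθ : 0 < θ) (hθq : θ * meanSechSq μ < 1)
    (hq : 0 ≤ meanSechSq μ) (hmin : ZeroUniqueMinimizer μ θ) :
    ∃ C : ℝ, 0 ≤ C ∧ ∀ (n : ℕ) (S : Finset (Fin n)), 0 < S.card →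
      ∫ h, fourthMoment θ S h ∂(Measure.pi fun _ : Fin n => μ) ≤ C := by
  set q := meanSechSq μ with hqdef
  set t := Real.sqrt θ with ht
  have ht0 : 0 < t := Real.sqrt_pos.2 hθ
  set a := 1 - θ * q with ha
  have ha0 : 0 < a := by linarith
  have ha1 : a ≤ 1 := by
    have : 0 ≤ θ * q := by positivity
    linarith
  -- The choices of r and ε' each raise the slope by a/4, so on good fields it is at most θq + a/2 =
  -- 1 - a/2.
  set r := a / (8 * θ * t) with hr
  have hr0 : 0 < r := by positivity
  set ε' := a / (4 * θ) with hε'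
  have hε'0 : 0 < ε' := by positivity
  obtain ⟨N, ε, δ, hε, hδ, hN⟩ := exists_net_fieldTilt_le μ hθ hmin hr0
  obtain ⟨C₀, hC₀0, hC₀⟩ := fourthMoment_le_of_good hθ.le (c := a / 2) (by positivity)
    (by linarith) hr0 hδ
  choose u C hu hC0 hC using fun x : ℝ => exists_deviation_const (μ := μ)
    (continuous_energyGain θ x) (abs_energyGain_le θ x) hθ.le hε
  obtain ⟨u', C', hu', hC'0, hC'⟩ := exists_deviation_const (μ := μ) continuous_sechSq
    abs_sechSq_le_one hθ.le hε'0
  refine ⟨C₀ * (1 + 768 * Real.exp 1) + ((∑ x ∈ N, C x) + C'), ?_, fun n S hS => ?_⟩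
  · have : 0 ≤ ∑ x ∈ N, C x := Finset.sum_nonneg fun x _ => hC0 x
    positivity
  set π := Measure.pi fun _ : Fin n => μ with hπ
  have hk : (0 : ℝ) < S.card := by exact_mod_cast hS
  set P := 3 + 6 * (θ * S.card) + (θ * S.card) ^ 2 with hP
  have hP0 : 0 ≤ P := by positivity
  set F : ℝ → (Fin n → ℝ) → ℝ := fun x h =>
    P * Real.exp (u x * centeredSum μ (energyGain θ x) S h - u x * (S.card * ε)) with hF
  set F' : (Fin n → ℝ) → ℝ := fun h =>
    P * Real.exp (u' * centeredSum μ sechSq S h - u' * (S.card * ε')) with hF'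
  have hF0 : ∀ x h, 0 ≤ F x h := fun x h => mul_nonneg hP0 (Real.exp_pos _).le
  have hF'0 : ∀ h, 0 ≤ F' h := fun h => mul_nonneg hP0 (Real.exp_pos _).le
  have hFi : ∀ x, Integrable (F x) π := by
    intro x
    simp only [hF, sub_eq_add_neg, Real.exp_add]
    exact ((integrable_exp_mul_centeredSum (continuous_energyGain θ x) (abs_energyGain_le θ x) S
      (u x)).mul_const _).const_mul _
  have hF'i : Integrable F' π := by
    simp only [hF', sub_eq_add_neg, Real.exp_add]
    exact ((integrable_exp_mul_centeredSum continuous_sechSq abs_sechSq_le_one S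
      u').mul_const _).const_mul _
  -- Either the field is good, or one of finitely many deviations occurs and the corresponding
  -- majorant exceeds the crude bound P.
  have hpt : ∀ h, fourthMoment θ S h ≤
      C₀ * (1 + tanhSum S h ^ 4) + ((∑ x ∈ N, F x h) + F' h) := by
    intro h
    have hs0 : 0 ≤ ∑ x ∈ N, F x h := Finset.sum_nonneg fun x _ => hF0 x h
    have h4 : 0 ≤ C₀ * (1 + tanhSum S h ^ 4) := by positivity
    by_cases hg1 : ∀ x ∈ N, centeredSum μ (energyGain θ x) S h ≤ S.card * ε
    · by_cases hg2 : centeredSum μ sechSq S h ≤ S.card * ε'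
      · have hmean : sechSqMean S h ≤ q + ε' := by
          have h5 := sechSqMean_sub_eq μ hS h
          have h6 : centeredSum μ sechSq S h / S.card ≤ ε' := by
            rw [div_le_iff₀ hk]; linarith
          linarith
        have h7 := hC₀ n S h hS (fun y hy => by
          have h8 := mul_fieldTiltDeriv_le hθ.le hS h hmean hy
          have h9 : θ * (q + ε' + 2 * Real.sqrt θ * r) = 1 - a / 2 := by
            rw [← ht, hε', hr, show θ * (q + a / (4 * θ) + 2 * t * (a / (8 * θ * t))) =
              θ * q + a / 2 by field_simp; ring]
            linarith
          rwa [h9] at h8) (hN n S h hS hg1)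
        linarith [hF'0 h]
      · have h5 : P ≤ F' h := by
          refine le_mul_of_one_le_right hP0 (Real.one_le_exp ?_)
          have := mul_le_mul_of_nonneg_left (not_le.1 hg2).le hu'.le
          linarith
        linarith [fourthMoment_le hθ.le S h]
    · push Not at hg1
      obtain ⟨x, hxN, hx⟩ := hg1
      have h5 : P ≤ F x h := by
        refine le_mul_of_one_le_right hP0 (Real.one_le_exp ?_)
        have := mul_le_mul_of_nonneg_left hx.le (hu x).le
        linarith
      have h6 : F x h ≤ ∑ x ∈ N, F x h :=
        Finset.single_le_sum (f := fun x => F x h) (fun x _ => hF0 x h) hxN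
      linarith [fourthMoment_le hθ.le S h, hF'0 h]
  have iξ : Integrable (fun h => 1 + tanhSum S h ^ 4) π :=
    (integrable_const _).add (integrable_tanhSum_pow μ hsymm S 4)
  have iN : Integrable (fun h => ∑ x ∈ N, F x h) π := integrable_finsetSum _ fun x _ => hFi x
  have iNF : Integrable (fun h => (∑ x ∈ N, F x h) + F' h) π := iN.add hF'i
  calc ∫ h, fourthMoment θ S h ∂π
      ≤ ∫ h, (C₀ * (1 + tanhSum S h ^ 4) + ((∑ x ∈ N, F x h) + F' h)) ∂π :=
        integral_mono (integrable_gibbsAvg μ θ S _) ((iξ.const_mul _).add iNF) hpt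
    _ = C₀ * (1 + ∫ h, tanhSum S h ^ 4 ∂π) + ((∑ x ∈ N, ∫ h, F x h ∂π) + ∫ h, F' h ∂π) := by
        rw [integral_add (iξ.const_mul _) iNF, integral_const_mul,
          integral_add (integrable_const _) (integrable_tanhSum_pow μ hsymm S 4),
          integral_add iN hF'i, integral_finsetSum _ fun x _ => hFi x, integral_const,
          probReal_univ, one_smul]
    _ ≤ C₀ * (1 + 768 * Real.exp 1) + ((∑ x ∈ N, C x) + C') := by
        have h1 := integral_tanhSum_pow_four_le μ hsymm hS
        have h2 : ∑ x ∈ N, ∫ h, F x h ∂π ≤ ∑ x ∈ N, C x :=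
          Finset.sum_le_sum fun x _ => hC x n S
        have h3 : ∫ h, F' h ∂π ≤ C' := hC' n S
        gcongr

/-! ### The limit of the second moment -/

theorem meanSechSq_le_one (μ : Measure ℝ) [IsProbabilityMeasure μ] : meanSechSq μ ≤ 1 :=
  (le_abs_self _).trans (abs_integral_le_of_abs_le (g := sechSq) abs_sechSq_le_one)

theorem meanSechSq_nonneg (μ : Measure ℝ) : 0 ≤ meanSechSq μ :=
  integral_nonneg fun x => (sechSq_pos x).le

/-- The numerator exceeds the denominator by θq(2 - q - θq), positive because q ≤ 1 and θq < 1. -/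
theorem one_lt_limitSecondMoment (μ : Measure ℝ) [IsProbabilityMeasure μ] {θ : ℝ} (hθ : 0 < θ)
    (hq : 0 < meanSechSq μ) (hθq : θ * meanSechSq μ < 1) : 1 < limitSecondMoment μ θ := by
  have hq1 := meanSechSq_le_one μ
  unfold limitSecondMoment
  set q := meanSechSq μ
  have hc : 0 < 1 - θ * q := by linarith
  rw [one_lt_div (by positivity)]
  nlinarith [mul_pos (mul_pos hθ hq) (by linarith : 0 < 2 - q - θ * q)]

theorem integrable_fourthMoment {n : ℕ} (μ : Measure ℝ) [IsProbabilityMeasure μ] (θ : ℝ)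
    (S : Finset (Fin n)) : Integrable (fourthMoment θ S) (Measure.pi fun _ : Fin n => μ) :=
  integrable_gibbsAvg μ θ S _

/-- The mean of `W_S` converges at rate `|S| ^ (-1 / 2)`. -/
theorem exists_abs_integral_pairStat_sub_le (μ : Measure ℝ) [IsProbabilityMeasure μ]
    (hsymm : μ.map (fun h => -h) = μ) {θ : ℝ} (hθ : 0 < θ) (hθq : θ * meanSechSq μ < 1)
    (hmin : ZeroUniqueMinimizer μ θ) :
    ∃ C : ℝ, 0 ≤ C ∧ ∀ (n : ℕ) (S : Finset (Fin n)), 0 < S.card →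
      |∫ σ, pairStat S σ ∂(plantedLaw μ θ S) - limitSecondMoment μ θ| ≤
        C / Real.sqrt S.card := by
  have hq := meanSechSq_nonneg μ
  obtain ⟨C₄, hC₄0, hC₄⟩ := exists_integral_fourthMoment_le μ hsymm hθ hθq hq hmin
  set q := meanSechSq μ with hqdef
  set c := 1 - θ * q with hc
  have hc0 : 0 < c := by linarith
  set E := 2 * Real.sqrt θ ^ 4 + 3 * Real.sqrt θ ^ 3 + Real.sqrt θ ^ 2 with hE
  have hE0 : 0 ≤ E := by positivity
  set M := 768 * Real.exp 1 with hM
  refine ⟨E * ((1 + M + C₄) + (1 + M)) / (θ * c ^ 2), by positivity, fun n S hS => ?_⟩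
  have hk : (0 : ℝ) < S.card := by exact_mod_cast hS
  set r := Real.sqrt S.card with hr
  have hr0 : 0 < r := Real.sqrt_pos.2 hk
  have hr2 : r ^ 2 = S.card := Real.sq_sqrt hk.le
  set π := Measure.pi fun _ : Fin n => μ with hπ
  set W := ∫ σ, pairStat S σ ∂(plantedLaw μ θ S) with hW
  have iA : Integrable (fun h => gibbsAvg θ S h (fun σ => 1 + θ * pairStat S σ)) π :=
    integrable_gibbsAvg μ θ S _
  have hA : ∫ h, gibbsAvg θ S h (fun σ => 1 + θ * pairStat S σ) ∂π = 1 + θ * W := by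
    rw [← integral_plantedLaw, integral_add (integrable_const _) (integrable_config _ _),
      integral_const_mul]
    simp [hW]
  have i2 : Integrable (fun h => tanhSum S h ^ 2) π := integrable_tanhSum_pow μ hsymm S 2
  have i4 : Integrable (fun h => tanhSum S h ^ 4) π := integrable_tanhSum_pow μ hsymm S 4
  have iQ : Integrable (fourthMoment θ S) π := integrable_fourthMoment μ θ S
  set X : (Fin n → ℝ) → ℝ := fun h => centeredSum μ sechSq S h / r with hX
  have iX : Integrable (fun h => X h ^ 4) π :=
    integrable_centeredSum_pow continuous_sechSq abs_sechSq_le_one S r 4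
  have iL1 : Integrable (fun h => c ^ 2 * gibbsAvg θ S h (fun σ => 1 + θ * pairStat S σ) - c) π :=
    (iA.const_mul _).sub (integrable_const _)
  -- With E[ξ²] = 1 - q, this is the identity (1 - θq) + θ(1 - q) - (1 - θq)² = θ(1 - θq²), the
  -- numerator of V up to θ.
  have hL : ∫ h, (c ^ 2 * gibbsAvg θ S h (fun σ => 1 + θ * pairStat S σ) - c -
      θ * tanhSum S h ^ 2) ∂π = θ * c ^ 2 * (W - limitSecondMoment μ θ) := by
    rw [integral_sub iL1 (i2.const_mul _), integral_sub (iA.const_mul _) (integrable_const _),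
      integral_const_mul, integral_const_mul, hA, integral_tanhSum_sq μ hsymm hS, integral_const,
      probReal_univ, one_smul, limitSecondMoment, ← hqdef, ← hc, mul_assoc θ (c ^ 2),
      mul_sub (c ^ 2), mul_div_cancel₀ _ (by positivity : c ^ 2 ≠ 0), hc]
    ring
  have i14 : Integrable (fun h => 1 + tanhSum S h ^ 4) π := (integrable_const _).add i4
  have i14Q : Integrable (fun h => 1 + tanhSum S h ^ 4 + fourthMoment θ S h) π := i14.add iQ
  have i1X : Integrable (fun h => 1 + X h ^ 4) π := (integrable_const _).add iX
  have iR : Integrable (fun h => E / r * ((1 + tanhSum S h ^ 4 + fourthMoment θ S h) +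
      (1 + X h ^ 4))) π := (i14Q.add i1X).const_mul _
  have hpt : ∀ h, ‖c ^ 2 * gibbsAvg θ S h (fun σ => 1 + θ * pairStat S σ) - c -
      θ * tanhSum S h ^ 2‖ ≤
      E / r * ((1 + tanhSum S h ^ 4 + fourthMoment θ S h) + (1 + X h ^ 4)) := by
    intro h
    refine (abs_secondMoment_sub_le hθ.le hq hθq.le hS h).trans ?_
    -- The deviation of the mean of sech² is X/√k with X of bounded fourth moment, so √k times its
    -- square is again of order k^(-1/2).
    have h1 : r * (sechSqMean S h - q) ^ 2 = X h ^ 2 / r := by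
      rw [sechSqMean_sub_eq μ hS h, hX, ← hr2]
      field_simp
    have h2 : X h ^ 2 ≤ 1 + X h ^ 4 := by nlinarith [sq_nonneg (X h ^ 2 - 1), sq_nonneg (X h)]
    rw [← hE, ← hr, h1, ← add_div, mul_div_assoc', div_mul_eq_mul_div]
    gcongr
  have hfin := norm_integral_le_of_norm_le iR (ae_of_all _ hpt)
  rw [hL, integral_const_mul, integral_add i14Q i1X, integral_add i14 iQ,
    integral_add (integrable_const _) i4, integral_add (integrable_const _) iX, integral_const,
    probReal_univ, one_smul, norm_mul, Real.norm_eq_abs, Real.norm_eq_abs,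
    abs_of_pos (by positivity : 0 < θ * c ^ 2)] at hfin
  have b1 : ∫ h, tanhSum S h ^ 4 ∂π ≤ M := integral_tanhSum_pow_four_le μ hsymm hS
  have b2 : ∫ h, fourthMoment θ S h ∂π ≤ C₄ := hC₄ n S hS
  have b3 : ∫ h, X h ^ 4 ∂π ≤ M :=
    integral_centeredSum_pow_four_le continuous_sechSq abs_sechSq_le_one hS
  have hfin2 : θ * c ^ 2 * |W - limitSecondMoment μ θ| ≤
      E / r * ((1 + M + C₄) + (1 + M)) := hfin.trans (by gcongr)
  rw [div_right_comm, le_div_iff₀ (by positivity)]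
  calc |W - limitSecondMoment μ θ| * (θ * c ^ 2) = θ * c ^ 2 * |W - limitSecondMoment μ θ| := by
        ring
    _ ≤ E / r * ((1 + M + C₄) + (1 + M)) := hfin2
    _ = E * ((1 + M + C₄) + (1 + M)) / r := by ring

theorem tendsto_integral_pairStat (μ : Measure ℝ) [IsProbabilityMeasure μ]
    (hsymm : μ.map (fun h => -h) = μ) {θ : ℝ} (hθ : 0 < θ) (hθq : θ * meanSechSq μ < 1)
    (hmin : ZeroUniqueMinimizer μ θ) (n : ℕ → ℕ) (S : ∀ j, Finset (Fin (n j)))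
    (hS : Tendsto (fun j => (S j).card) atTop atTop) :
    Tendsto (fun j => ∫ σ, pairStat (S j) σ ∂(plantedLaw μ θ (S j))) atTop
      (𝓝 (limitSecondMoment μ θ)) := by
  obtain ⟨C, -, hC⟩ := exists_abs_integral_pairStat_sub_le μ hsymm hθ hθq hmin
  rw [tendsto_iff_dist_tendsto_zero]
  have hlim : Tendsto (fun j => C / Real.sqrt ((S j).card : ℝ)) atTop (𝓝 0) :=
    Tendsto.const_div_atTop
      (Real.tendsto_sqrt_atTop.comp (tendsto_natCast_atTop_atTop.comp hS)) C
  refine squeeze_zero' (Eventually.of_forall fun j => dist_nonneg) ?_ hlim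
  filter_upwards [hS.eventually_gt_atTop 0] with j hj
  exact hC (n j) (S j) hj

/-- Truncation at B loses at most E[W²]/B, and θ² E[W²] is below the bounded fourth moment of the
auxiliary variable. The gap V - 1 - τ = 4η pays η for convergence and η for truncation, leaving 2η.
-/
theorem truncatedMeanExceeds_of_zeroUniqueMinimizer (μ : Measure ℝ) [IsProbabilityMeasure μ]
    (hsymm : μ.map (fun h => -h) = μ) {θ : ℝ} (hθ : 0 < θ) (hθq : θ * meanSechSq μ < 1)
    (hmin : ZeroUniqueMinimizer μ θ) {τ : ℝ} (hτ : τ < limitSecondMoment μ θ - 1) :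
    TruncatedMeanExceeds μ θ τ := by
  obtain ⟨C, hC0, hC⟩ := exists_abs_integral_pairStat_sub_le μ hsymm hθ hθq hmin
  obtain ⟨C₄, hC₄0, hC₄⟩ :=
    exists_integral_fourthMoment_le μ hsymm hθ hθq (meanSechSq_nonneg μ) hmin
  set V := limitSecondMoment μ θ
  set η := (V - 1 - τ) / 4 with hη
  have hη0 : 0 < η := by rw [hη]; linarith
  set B := (C₄ / θ ^ 2 + 1) / η with hB
  have hB0 : 0 < B := by positivity
  refine ⟨B, η, hB0, hη0, max 1 ⌈(C / η) ^ 2⌉₊, fun n S hcard => ?_⟩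
  simp only [max_le_iff, Nat.ceil_le] at hcard
  obtain ⟨hS, hkC⟩ := hcard
  have hk : (0 : ℝ) < S.card := by exact_mod_cast hS
  set P := plantedLaw μ θ S with hP
  have h1 : V - η ≤ ∫ σ, pairStat S σ ∂P := by
    have h2 := (abs_le.1 (hC n S hS)).1
    have h3 : C / Real.sqrt S.card ≤ η := by
      rw [div_le_iff₀ (Real.sqrt_pos.2 hk), mul_comm, ← div_le_iff₀ hη0]
      exact Real.le_sqrt_of_sq_le hkC
    linarith
  have h4 : ∫ σ, pairStat S σ ^ 2 ∂P ≤ C₄ / θ ^ 2 := by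
    rw [le_div_iff₀ (by positivity), mul_comm, ← integral_const_mul, integral_plantedLaw]
    refine (integral_mono (integrable_gibbsAvg μ θ S _) (integrable_fourthMoment μ θ S)
      fun h => ?_).trans (hC₄ n S hS)
    refine gibbsAvg_mono θ S h fun σ => ?_
    have := mul_nonneg hθ.le (pairStat_nonneg S σ)
    rw [mul_pow]
    linarith
  have h5 : ∫ σ, pairStat S σ ∂P ≤
      ∫ σ, min (pairStat S σ) B ∂P + (∫ σ, pairStat S σ ^ 2 ∂P) / B := by
    rw [← integral_div, ← integral_add (integrable_config P _) (integrable_config P _)]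
    refine integral_mono (integrable_config P _) (integrable_config P _) fun σ => ?_
    have h0 := pairStat_nonneg S σ
    simp only
    rcases le_total (pairStat S σ) B with h | h
    · rw [min_eq_left h]
      have : 0 ≤ pairStat S σ ^ 2 / B := by positivity
      linarith
    · rw [min_eq_right h]
      have : pairStat S σ ≤ pairStat S σ ^ 2 / B := by
        rw [le_div_iff₀ hB0, pow_two]; gcongr
      linarith
  have h6 : (∫ σ, pairStat S σ ^ 2 ∂P) / B ≤ η := by
    rw [div_le_iff₀ hB0, hB, mul_div_cancel₀ _ hη0.ne']
    linarith
  have h7 : V = 1 + τ + 4 * η := by rw [hη]; ring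
  linarith

/-! ### Monotonicity in the interaction strength -/

/-- Raising θ reweights by exp((θ₂ - θ₁)W/2), which is nondecreasing in W. By Chebyshev's
association inequality it is nonnegatively correlated with F(W), as seen by symmetrizing over two
independent configurations. -/
theorem gibbsAvg_mono_theta {n : ℕ} {θ₁ θ₂ : ℝ} (hθ : θ₁ ≤ θ₂) (S : Finset (Fin n))
    (h : Fin n → ℝ) {F : ℝ → ℝ} (hF : Monotone F) :
    gibbsAvg θ₁ S h (fun σ => F (pairStat S σ)) ≤ gibbsAvg θ₂ S h (fun σ => F (pairStat S σ)) := by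
  set w : Config n → ℝ := weight θ₁ S h
  set f : Config n → ℝ := fun σ => F (pairStat S σ)
  set φ : Config n → ℝ := fun σ => Real.exp ((θ₂ - θ₁) / 2 * pairStat S σ)
  have hw : ∀ σ, weight θ₂ S h σ = w σ * φ σ := by
    intro σ
    simp only [w, φ, weight, pairStat_eq]
    rw [← Real.exp_add]
    congr 1
    ring
  have hvary : ∀ σ τ, 0 ≤ w σ * w τ * ((φ σ - φ τ) * (f σ - f τ)) := by
    intro σ τ
    refine mul_nonneg (mul_nonneg (weight_pos _ _ _ _).le (weight_pos _ _ _ _).le) ?_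
    have hd : 0 ≤ (θ₂ - θ₁) / 2 := by linarith
    rcases le_total (pairStat S σ) (pairStat S τ) with hle | hle
    · refine mul_nonneg_of_nonpos_of_nonpos (sub_nonpos.2 ?_) (sub_nonpos.2 (hF hle))
      exact Real.exp_le_exp.2 (mul_le_mul_of_nonneg_left hle hd)
    · refine mul_nonneg (sub_nonneg.2 ?_) (sub_nonneg.2 (hF hle))
      exact Real.exp_le_exp.2 (mul_le_mul_of_nonneg_left hle hd)
  have hsum : 0 ≤ ∑ σ, ∑ τ, w σ * w τ * ((φ σ - φ τ) * (f σ - f τ)) :=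
    Finset.sum_nonneg fun σ _ => Finset.sum_nonneg fun τ _ => hvary σ τ
  have hexp : ∑ σ, ∑ τ, w σ * w τ * ((φ σ - φ τ) * (f σ - f τ)) =
      2 * ((∑ σ, w σ * φ σ * f σ) * ∑ σ, w σ) - 2 * ((∑ σ, w σ * f σ) * ∑ σ, w σ * φ σ) := by
    have e : ∀ σ τ, w σ * w τ * ((φ σ - φ τ) * (f σ - f τ)) =
        (w σ * φ σ * f σ) * w τ + w σ * (w τ * φ τ * f τ) -
          ((w σ * f σ) * (w τ * φ τ) + (w σ * φ σ) * (w τ * f τ)) := fun σ τ => by ring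
    simp only [e, Finset.sum_sub_distrib, Finset.sum_add_distrib]
    rw [← Finset.sum_mul_sum, ← Finset.sum_mul_sum, ← Finset.sum_mul_sum, ← Finset.sum_mul_sum]
    ring
  rw [hexp] at hsum
  have hZ₁ := partition_pos θ₁ S h
  have hZ₂ := partition_pos θ₂ S h
  rw [gibbsAvg_eq_div, gibbsAvg_eq_div, div_le_div_iff₀ hZ₁ hZ₂]
  simp only [hw]
  linarith

theorem TruncatedMeanExceeds.mono_theta {μ : Measure ℝ} [IsProbabilityMeasure μ] {θ₁ θ₂ τ : ℝ}
    (hθ : θ₁ ≤ θ₂) (h : TruncatedMeanExceeds μ θ₁ τ) : TruncatedMeanExceeds μ θ₂ τ := by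
  obtain ⟨B, η, hB, hη, K, hK⟩ := h
  refine ⟨B, η, hB, hη, K, fun n S hS => (hK n S hS).trans ?_⟩
  rw [integral_plantedLaw, integral_plantedLaw]
  refine integral_mono (integrable_gibbsAvg μ θ₁ S _) (integrable_gibbsAvg μ θ₂ S _) fun h => ?_
  exact gibbsAvg_mono_theta hθ S h (F := fun x => min x B) fun x y hxy => min_le_min_right B hxy

/-! ### Uniqueness of the minimizer for θ < 1, and the tests combined. -/

theorem logCosh_neg (x : ℝ) : logCosh (-x) = logCosh x := by
  rw [logCosh, Real.cosh_neg, logCosh]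

/-- From cosh(a + h) cosh(a - h) = cosh²a cosh²h - sinh²a sinh²h ≤ cosh²a cosh²h and cosh a ≤
exp(a²/2). The bound is uniform in h. -/
theorem logCosh_add_add_logCosh_sub_le (a h : ℝ) :
    logCosh (a + h) + logCosh (a - h) - 2 * logCosh h ≤ a ^ 2 := by
  have c1 := Real.cosh_pos (a + h)
  have c2 := Real.cosh_pos (a - h)
  have c3 := Real.cosh_pos h
  have c4 := Real.cosh_pos a
  have h1 : Real.cosh (a + h) * Real.cosh (a - h) ≤ Real.cosh a ^ 2 * Real.cosh h ^ 2 := by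
    rw [Real.cosh_add, Real.cosh_sub]
    nlinarith [sq_nonneg (Real.sinh a * Real.sinh h)]
  have h2 := Real.log_le_log (by positivity) h1
  rw [Real.log_mul c1.ne' c2.ne', Real.log_mul (by positivity) (by positivity), Real.log_pow,
    Real.log_pow] at h2
  have h3 : Real.log (Real.cosh a) ≤ a ^ 2 / 2 := by
    rw [Real.log_le_iff_le_exp c4]
    exact Real.cosh_le_exp_half_sq a
  unfold logCosh
  push_cast at h2
  linarith

/-- Symmetrizing over h and -h, the expected energy gain at x is at most θx²/2, which is below x²/2
when θ < 1 and x ≠ 0. -/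
theorem zeroUniqueMinimizer_of_lt_one (μ : Measure ℝ) [IsProbabilityMeasure μ]
    (hsymm : μ.map (fun h => -h) = μ) {θ : ℝ} (hθ : 0 ≤ θ) (hθ1 : θ < 1) :
    ZeroUniqueMinimizer μ θ := by
  intro x hx
  rw [freeEnergy_zero, freeEnergy_eq]
  set t := Real.sqrt θ with ht
  have ht2 : t ^ 2 = θ := Real.sq_sqrt hθ
  have i1 := integrable_energyGain μ θ x
  have hneg : ∫ h, energyGain θ x (-h) ∂μ = ∫ h, energyGain θ x h ∂μ := by
    conv_rhs => rw [← hsymm]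
    exact (integral_map measurable_neg.aemeasurable
      (continuous_energyGain θ x).aestronglyMeasurable).symm
  have i2 : Integrable (fun h => energyGain θ x (-h)) μ :=
    integrable_of_abs_le ((continuous_energyGain θ x).comp continuous_neg)
      fun h => abs_energyGain_le θ x (-h)
  have hle : ∫ h, (energyGain θ x h + energyGain θ x (-h)) ∂μ ≤ θ * x ^ 2 := by
    calc ∫ h, (energyGain θ x h + energyGain θ x (-h)) ∂μ ≤ ∫ _, θ * x ^ 2 ∂μ := by
          refine integral_mono (i1.add i2) (integrable_const _) fun h => ?_
          have h1 := logCosh_add_add_logCosh_sub_le (t * x) h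
          rw [mul_pow, ht2] at h1
          simp only [energyGain, logCosh_neg, ← sub_eq_add_neg, ← ht]
          linarith
      _ = θ * x ^ 2 := by simp
  rw [integral_add i1 i2, hneg] at hle
  have hx2 : 0 < x ^ 2 := by positivity
  nlinarith

theorem tests_succeed_of_truncatedMeanExceeds (μ : Measure ℝ) [IsProbabilityMeasure μ]
    (hsymm : μ.map (fun h => -h) = μ) {θ τ : ℝ} (hτ : 0 < τ)
    (h : TruncatedMeanExceeds μ θ τ) :
    ScanTestSucceeds μ θ τ ∧ GlobalTestSucceeds μ θ τ ∧ CombinedTestSucceeds μ θ τ := by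
  have hs := scanTestSucceeds_of_truncatedMeanExceeds μ hsymm hτ h
  have hg := globalTestSucceeds_of_truncatedMeanExceeds μ hsymm hτ h
  exact ⟨hs, hg, combinedTestSucceeds_of_scan_global hs hg⟩

end PlantedRFCW
end

open PlantedRFCW in
theorem mainTheorem3 (μ : Measure ℝ) [IsProbabilityMeasure μ]
    (hsymm : μ.map (fun h => -h) = μ) (θ : ℝ) (hθ : 0 < θ) (hhigh : θ < 1 / meanSechSq μ) :
    1 < limitSecondMoment μ θ ∧
    (∃ τ : ℝ, 0 < τ ∧ ScanTestSucceeds μ θ τ ∧ GlobalTestSucceeds μ θ τ ∧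
      CombinedTestSucceeds μ θ τ) ∧
    (ZeroUniqueMinimizer μ θ →
      (∀ (n : ℕ → ℕ) (S₀ : ∀ j, Finset (Fin (n j))),
        Tendsto (fun j => (S₀ j).card) atTop atTop →
        Tendsto (fun j => ∫ σ, pairStat (S₀ j) σ ∂(plantedLaw μ θ (S₀ j))) atTop
          (𝓝 (limitSecondMoment μ θ))) ∧
      ∀ τ : ℝ, 0 < τ → τ < limitSecondMoment μ θ - 1 →
        ScanTestSucceeds μ θ τ ∧ GlobalTestSucceeds μ θ τ ∧ CombinedTestSucceeds μ θ τ) := by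
  have hq : 0 < meanSechSq μ := one_div_pos.1 (hθ.trans hhigh)
  have hθq : θ * meanSechSq μ < 1 := (lt_div_iff₀ hq).1 hhigh
  refine ⟨one_lt_limitSecondMoment μ hθ hq hθq, ?_, fun hmin =>
    ⟨tendsto_integral_pairStat μ hsymm hθ hθq hmin, fun τ hτ0 hτ =>
      tests_succeed_of_truncatedMeanExceeds μ hsymm hτ0
        (truncatedMeanExceeds_of_zeroUniqueMinimizer μ hsymm hθ hθq hmin hτ)⟩⟩
  -- Any θ' ≤ θ in (0, 1) would serve: there the minimizer is unique, and the truncated bound passes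
  -- to θ by monotonicity. The threshold is half of V(θ') - 1.
  set θ' := min θ (1 / 2)
  have hθ'0 : 0 < θ' := by positivity
  have hθ'1 : θ' < 1 := (min_le_right _ _).trans_lt (by norm_num)
  have hθ'q : θ' * meanSechSq μ < 1 :=
    (mul_le_mul_of_nonneg_right (min_le_left _ _) hq.le).trans_lt hθq
  have hV := one_lt_limitSecondMoment μ hθ'0 hq hθ'q
  have hτ0 : 0 < (limitSecondMoment μ θ' - 1) / 2 := by linarith
  refine ⟨(limitSecondMoment μ θ' - 1) / 2, hτ0,
    tests_succeed_of_truncatedMeanExceeds μ hsymm hτ0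
      (TruncatedMeanExceeds.mono_theta (min_le_left θ (1 / 2))
        (truncatedMeanExceeds_of_zeroUniqueMinimizer μ hsymm hθ'0 hθ'q
          (zeroUniqueMinimizer_of_lt_one μ hsymm hθ'0.le hθ'1) (by linarith)))⟩
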